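/- **Setting.** Let $G$ be a semisimple Lie group whose Lie algebra $\mathfrak g=\mathfrak g_{-2}\oplus\cdots\oplus\mathfrak g_2$ carries a contact grading ($\dim\mathfrak g_{-2}=1$, $\mathfrak g_{-1}\neq 0$, the bracket $\mathfrak g_{-1}\times\mathfrak g_{-1}\to\mathfrak g_{-2}$ is non-degenerate), put $\mathfrak g^i=\bigoplus_{j\ge i}\mathfrak g_j$, and let $P\subset G$ be a parabolic subgroup (closed, with Lie algebra $\mathfrak p=\mathfrak g^0$ and with $\mathrm{Ad}(P)$ preserving all $\mathfrak g^i$). Let $M$ carry a parabolic contact structure of type $(G,P)$, i.e. a regular normal Cartan geometry $(p:\mathcal G\to M,\omega)$ of type $(G,P)$, with contact subbundle $H\subset TM$ corresponding to $\mathfrak g^{-1}/\mathfrak p$. Let $\xi$ be an infinitesimal automorphism of this geometry which is transverse to $H$, let $\tilde\xi$ be its lift to a $P$-invariant vector field on $\mathcal G$ with $\mathcal L_{\tilde\xi}\omega=0$, and assume that $\xi$ is normal, i.e. the section of the adjoint tractor bundle $\mathcal G\times_P\mathfrak g$ corresponding to $\omega(\tilde\xi)$ is parallel for the tractor connection. Let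 $\rho$ be a finite-dimensional real representation of $G$ on $\mathbb V$, with derivative $\rho':\mathfrak g\to\mathrm{End}(\mathbb V)$; let $\mathcal V=\mathcal G\times_P\mathbb V$ be the corresponding tractor bundle and $d^\nabla$ the covariant exterior derivative on $\Omega^*(M,\mathcal V)$ induced by the tractor connection. Assume $d^\nabla\circ d^\nabla=0$. **Notation.** Let $\mathcal L_{\tilde\xi}$ be the operator on $\Omega^k(M,\mathcal V)$ given by differentiating the corresponding $P$-equivariant functions on $\mathcal G$ along $\tilde\xi$, let $\Xi:\mathcal V\to\mathcal V$ be the bundle map induced by $\rho'(\omega(\tilde\xi))$, and let $\Xi_*$ be its action on the values of $\mathcal V$-valued forms. For $k\ge 0$ put $$A^k=\{\phi\in\Omega^k(M,\mathcal V):\mathcal L_{\tilde\xi}\phi=0\},\qquad A^k_{hor}=\{\phi\in A^k: i_\xi\phi=0\},$$ $$K^k=\{\phi\in A^k_{hor}:\Xi_*\phi=0\},\qquad C^k=A^k_{hor}/\Xi_*(A^k_{hor}).$$ **Theorem.** There is a unique contact form $\alpha\in\Omega^1(M)$ with $\ker\alpha=H$ for which $\xi$ is the Reeb field, i.e. $i_\xi\alpha=1$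 and $i_\xi d\alpha=0$. With $\hat d\phi:=d^\nabla\phi-\alpha\wedge i_\xi d^\nabla\phi$ one obtains complexes $(A^*,d^\nabla)$, $(K^*,d^\nabla)$ (a subcomplex of the first one) and $(C^*,\hat d)$. There are well-defined linear maps, for all $k$, * $j:H^k(K^*,d^\nabla)\to H^k(A^*,d^\nabla)$, induced by the inclusion $K^*\hookrightarrow A^*$; * $\pi:H^k(A^*,d^\nabla)\to H^{k-1}(C^*,\hat d)$, $\pi([\tau])=[i_\xi\tau]$; * $\delta:H^{k-1}(C^*,\hat d)\to H^{k+1}(K^*,d^\nabla)$, $\delta([\phi])=[d\alpha\wedge\phi+\hat d\psi]$ for $\phi\in A^{k-1}_{hor}$ representing a cocycle and any $\psi\in A^k_{hor}$ with $\hat d\phi=\Xi_*\psi$; and these fit into a long exact sequence $$\cdots\overset{\delta}{\to}H^k(K^*,d^\nabla)\overset{j}{\to}H^k(A^*,d^\nabla)\overset{\pi}{\to}H^{k-1}(C^*,\hat d)\overset{\delta}{\to}H^{k+1}(K^*,d^\nabla)\overset{j}{\to}\cdots$$ which starts with $0\to H^0(K^*)\overset{j}{\to}H^0(A^*)\to 0\to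 H^1(K^*)\overset{j}{\to}H^1(A^*)\overset{\pi}{\to}H^0(C^*)\to\cdots$ (cohomology in negative degrees is zero). -/

import Mathlib

open scoped Manifold ContDiff

noncomputable section

namespace ParabolicContact

/-! ## Lie groups, contact gradings, parabolic subgroups -/

instance instLieGroupMinSmoothness {E G : Type*} [NormedAddCommGroup E] [NormedSpace ℝ E]
    [TopologicalSpace G] [ChartedSpace E G] [Group G] [h : LieGroup 𝓘(ℝ, E) ∞ G] :
    LieGroup 𝓘(ℝ, E) (minSmoothness ℝ 3) G :=
  LieGroup.of_le (n := ∞) (by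
    rw [minSmoothness_of_isRCLikeNormedField]; exact ENat.LEInfty.out)

/-- The Lie algebra `𝔤` of the Lie group `G` (modelled on the vector space `E`): the tangent space
at `1`, with the bracket of left invariant vector fields. -/
abbrev LieAlg (E G : Type*) [NormedAddCommGroup E] [NormedSpace ℝ E] [TopologicalSpace G]
    [ChartedSpace E G] [Group G] : Type _ := GroupLieAlgebra 𝓘(ℝ, E) G

/-- A contact grading `𝔤 = 𝔤₋₂ ⊕ 𝔤₋₁ ⊕ 𝔤₀ ⊕ 𝔤₁ ⊕ 𝔤₂` of a Lie algebra: `𝔤₋₂` is one-dimensional,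
and the bracket `𝔤₋₁ × 𝔤₋₁ → 𝔤₋₂` is non-degenerate, so that `𝔤₋₂ ⊕ 𝔤₋₁` is a Heisenberg
algebra. -/
structure ContactGrading (L : Type*) [LieRing L] [LieAlgebra ℝ L] where
  gr : ℤ → Submodule ℝ L
  isInternal : DirectSum.IsInternal gr
  lie_mem : ∀ i j : ℤ, ∀ X ∈ gr i, ∀ Y ∈ gr j, ⁅X, Y⁆ ∈ gr (i + j)
  eq_bot : ∀ i : ℤ, 2 < |i| → gr i = ⊥
  finrank_neg_two : Module.finrank ℝ (gr (-2)) = 1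
  neg_one_ne_bot : gr (-1) ≠ ⊥
  nondegenerate : ∀ X ∈ gr (-1), (∀ Y ∈ gr (-1), ⁅X, Y⁆ = 0) → X = 0

/-- The filtration component `𝔤^i = ⨁_{j ≥ i} 𝔤_j`.  In particular `𝔭 = 𝔤^0`, `𝔭₊ = 𝔤^1`. -/
def ContactGrading.filt {L : Type*} [LieRing L] [LieAlgebra ℝ L] (c : ContactGrading L) (i : ℤ) :
    Submodule ℝ L := ⨆ j : ℤ, ⨆ _ : i ≤ j, c.gr j

/-- The subspace `𝔤₋ = 𝔤₋₂ ⊕ 𝔤₋₁`. -/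
def ContactGrading.neg {L : Type*} [LieRing L] [LieAlgebra ℝ L] (c : ContactGrading L) :
    Submodule ℝ L := c.gr (-2) ⊔ c.gr (-1)

section Groups

variable {EG G EP P : Type*}
  [NormedAddCommGroup EG] [NormedSpace ℝ EG] [FiniteDimensional ℝ EG]
  [TopologicalSpace G] [ChartedSpace EG G] [Group G] [LieGroup 𝓘(ℝ, EG) ∞ G]
  [NormedAddCommGroup EP] [NormedSpace ℝ EP] [FiniteDimensional ℝ EP]
  [TopologicalSpace P] [ChartedSpace EP P] [Group P] [LieGroup 𝓘(ℝ, EP) ∞ P]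

/-- The adjoint action of `g : G` on the Lie algebra of `G`: the derivative at `1` of
conjugation by `g`. -/
def Ad (g : G) : LieAlg EG G →L[ℝ] LieAlg EG G :=
  (mfderiv 𝓘(ℝ, EG) 𝓘(ℝ, EG) (fun x : G => g * x * g⁻¹) 1 : EG →L[ℝ] EG)

/-- The infinitesimal representation `ρ' : 𝔤 → End V` of a representation `ρ` of `G` on `V`. -/
def infRep {V : Type*} [NormedAddCommGroup V] [NormedSpace ℝ V] (ρ : G →* (V →L[ℝ] V)) :
    LieAlg EG G →L[ℝ] (V →L[ℝ] V) :=
  mfderiv 𝓘(ℝ, EG) 𝓘(ℝ, V →L[ℝ] V) (fun g : G => ρ g) 1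

/-- The Lie algebra homomorphism induced by a homomorphism of Lie groups: its derivative at `1`. -/
def derivOne (f : P →* G) : LieAlg EP P →L[ℝ] LieAlg EG G :=
  (mfderiv 𝓘(ℝ, EP) 𝓘(ℝ, EG) f 1 : EP →L[ℝ] EG)

/-- A parabolic subgroup `P ⊆ G` for a contact grading: a closed subgroup (here a Lie group `P`
together with a homomorphism to `G` that is a smooth closed embedding) whose Lie algebra is
`𝔭 = 𝔤^0` and whose elements preserve the filtration of `𝔤` under the adjoint action. -/
structure ParabolicSubgroup (c : ContactGrading (LieAlg EG G)) (EP P : Type*)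
    [NormedAddCommGroup EP] [NormedSpace ℝ EP]
    [TopologicalSpace P] [ChartedSpace EP P] [Group P] where
  incl : P →* G
  contMDiff_incl : ContMDiff 𝓘(ℝ, EP) 𝓘(ℝ, EG) ∞ incl
  isClosedEmbedding_incl : Topology.IsClosedEmbedding incl
  range_derivOne : (derivOne (EG := EG) (EP := EP) incl).range = c.filt 0
  ad_mem : ∀ h : P, ∀ i : ℤ, ∀ X ∈ c.filt i, Ad (EG := EG) (incl h) X ∈ c.filt i

end Groups

/-! ## Differential forms on a manifold

A `V`-valued `k`-form on a manifold `Q` modelled on `E` assigns to `u : Q` an alternating map on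
`T_u Q`; recall that the tangent space `TangentSpace 𝓘(ℝ, E) u` is by definition a copy of `E`. -/

section Forms

variable {E Q V : Type*}
  [NormedAddCommGroup E] [NormedSpace ℝ E]
  [TopologicalSpace Q] [ChartedSpace E Q]
  [NormedAddCommGroup V] [NormedSpace ℝ V]

/-- Not necessarily smooth `V`-valued differential forms of degree `k` on `Q`. -/
abbrev Form (E Q V : Type*) [NormedAddCommGroup E] [NormedSpace ℝ E] [NormedAddCommGroup V]
    [NormedSpace ℝ V] (k : ℕ) : Type _ := Q → E [⋀^Fin k]→L[ℝ] V

/-- The coordinate expression of a form in the preferred chart at `u₀`, i.e. its pullback along the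
inverse of the chart. -/
def chartRep {k : ℕ} (φ : Form E Q V k) (u₀ : Q) (y : E) : E [⋀^Fin k]→L[ℝ] V :=
  (φ ((extChartAt 𝓘(ℝ, E) u₀).symm y)).compContinuousLinearMap
    (mfderiv 𝓘(ℝ, E) 𝓘(ℝ, E) (extChartAt 𝓘(ℝ, E) u₀).symm y : E →L[ℝ] E)

/-- A form is smooth if its coordinate expressions are. -/
def IsSmoothForm {k : ℕ} (φ : Form E Q V k) : Prop :=
  ∀ u₀ : Q, ContDiffOn ℝ ∞ (chartRep φ u₀) (extChartAt 𝓘(ℝ, E) u₀).target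

lemma chartRep_add {k : ℕ} (φ ψ : Form E Q V k) (u₀ : Q) :
    chartRep (φ + ψ) u₀ = chartRep φ u₀ + chartRep ψ u₀ := rfl

lemma chartRep_smul {k : ℕ} (a : ℝ) (φ : Form E Q V k) (u₀ : Q) :
    chartRep (a • φ) u₀ = a • chartRep φ u₀ := rfl

lemma IsSmoothForm.add {k : ℕ} {φ ψ : Form E Q V k} (hφ : IsSmoothForm φ) (hψ : IsSmoothForm ψ) :
    IsSmoothForm (φ + ψ) := fun u₀ => (hφ u₀).add (hψ u₀)

lemma IsSmoothForm.smul {k : ℕ} {φ : Form E Q V k} (a : ℝ) (hφ : IsSmoothForm φ) :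
    IsSmoothForm (a • φ) := fun u₀ => (hφ u₀).const_smul a

lemma IsSmoothForm.zero {k : ℕ} : IsSmoothForm (0 : Form E Q V k) := fun u₀ =>
  (contDiffOn_const (c := (0 : E [⋀^Fin k]→L[ℝ] V))).congr fun _ _ => by
    ext; rfl

lemma IsSmoothForm.differentiableAt {k : ℕ} {φ : Form E Q V k} (hφ : IsSmoothForm φ) (u : Q) :
    DifferentiableAt ℝ (chartRep φ u) (extChartAt 𝓘(ℝ, E) u u) :=
  ((hφ u).contDiffAt ((isOpen_extChartAt_target u).mem_nhds
    (mem_extChartAt_target u))).differentiableAt (by simp)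

/-- The exterior derivative of a form on a manifold, computed in charts. -/
def extD {k : ℕ} (φ : Form E Q V k) : Form E Q V (k + 1) := fun u =>
  (extDeriv (chartRep φ u) (extChartAt 𝓘(ℝ, E) u u)).compContinuousLinearMap
    (mfderiv 𝓘(ℝ, E) 𝓘(ℝ, E) (extChartAt 𝓘(ℝ, E) u) u : E →L[ℝ] E)

lemma extD_add {k : ℕ} {φ ψ : Form E Q V k} (hφ : IsSmoothForm φ) (hψ : IsSmoothForm ψ) :
    extD (φ + ψ) = extD φ + extD ψ := by
  funext u
  simp only [extD, Pi.add_apply, chartRep_add]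
  rw [extDeriv_add (hφ.differentiableAt u) (hψ.differentiableAt u)]
  rfl

lemma extD_smul {k : ℕ} (a : ℝ) (φ : Form E Q V k) : extD (a • φ) = a • extD φ := by
  funext u
  simp only [extD, Pi.smul_apply, chartRep_smul]
  rw [extDeriv_smul]
  rfl

/-- The wedge product `β ∧ φ` of a real valued alternating `p`-form with a `V`-valued alternating
`k`-form, as a linear map of `β`, by recursion on `p` through
`β ∧ φ = 1 / (p + 1) · ∑ᵢ eⁱ ∧ ((ι_{eᵢ} β) ∧ φ)` for `β` of degree `p + 1`.
Thus `(β ∧ φ)(v₀, …, v_k) = ∑ᵢ (-1)ⁱ β(vᵢ) φ(…, v̂ᵢ, …)` for `p = 1`, and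
`(β ∧ φ)(v₀, …, v_{k+1}) = ∑_{i<j} (-1)^{i+j+1} β(vᵢ, vⱼ) φ(…, v̂ᵢ, …, v̂ⱼ, …)` for `p = 2`. -/
def wedge {k : ℕ} (φ : E [⋀^Fin k]→L[ℝ] V) :
    ∀ p : ℕ, (E [⋀^Fin p]→L[ℝ] ℝ) →L[ℝ] (E [⋀^Fin (k + p)]→L[ℝ] V)
  | 0 => (ContinuousAlternatingMap.apply ℝ E ℝ ![]).smulRight φ
  | p + 1 => ((1 : ℝ) / (p + 1)) •
      ((ContinuousAlternatingMap.alternatizeUncurryFinCLM ℝ E V).comp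
        (((wedge φ p).postcomp E).comp
          ContinuousAlternatingMap.curryLeftLI.toContinuousLinearMap))

lemma wedge_add {k : ℕ} (φ ψ : E [⋀^Fin k]→L[ℝ] V) (p : ℕ) (β : E [⋀^Fin p]→L[ℝ] ℝ) :
    wedge (φ + ψ) p β = wedge φ p β + wedge ψ p β := by
  have h : ∀ p, wedge (V := V) (φ + ψ) p = wedge φ p + wedge ψ p := by
    intro p
    induction p with
    | zero => ext β v; simp [wedge]
    | succ p ih =>
      ext1 β
      have : ((wedge φ p + wedge ψ p).postcomp E :
          (E →L[ℝ] E [⋀^Fin p]→L[ℝ] ℝ) →L[ℝ] (E →L[ℝ] E [⋀^Fin (k + p)]→L[ℝ] V)) =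
          (wedge φ p).postcomp E + (wedge ψ p).postcomp E := by ext; rfl
      simp [wedge, ih, this]
  rw [h]; rfl

lemma wedge_smul {k : ℕ} (a : ℝ) (φ : E [⋀^Fin k]→L[ℝ] V) (p : ℕ) (β : E [⋀^Fin p]→L[ℝ] ℝ) :
    wedge (a • φ) p β = a • wedge φ p β := by
  have h : ∀ p, wedge (V := V) (a • φ) p = a • wedge φ p := by
    intro p
    induction p with
    | zero => ext β v; simp [wedge, smul_smul, mul_comm]
    | succ p ih =>
      ext1 β
      have : ((a • wedge φ p).postcomp E :
          (E →L[ℝ] E [⋀^Fin p]→L[ℝ] ℝ) →L[ℝ] (E →L[ℝ] E [⋀^Fin (k + p)]→L[ℝ] V)) =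
          a • (wedge φ p).postcomp E := by ext; rfl
      simp [wedge, ih, this, smul_comm a]
  rw [h]; rfl

end Forms

/-! ## Parabolic contact structures as Cartan geometries -/

section Cartan

variable {EG G EP P EQ EM V : Type*}
  [NormedAddCommGroup EG] [NormedSpace ℝ EG] [FiniteDimensional ℝ EG]
  [TopologicalSpace G] [ChartedSpace EG G] [Group G] [LieGroup 𝓘(ℝ, EG) ∞ G]
  [NormedAddCommGroup EP] [NormedSpace ℝ EP]
  [TopologicalSpace P] [ChartedSpace EP P] [Group P]
  [NormedAddCommGroup EQ] [NormedSpace ℝ EQ] [FiniteDimensional ℝ EQ]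
  [NormedAddCommGroup EM] [NormedSpace ℝ EM]
  [NormedAddCommGroup V] [NormedSpace ℝ V]
  {c : ContactGrading (LieAlg EG G)}

/-- A Cartan geometry of type `(G, P)` on `M`: a principal `P`-bundle `proj : Q → M` (with right
action `act`) together with a Cartan connection `ω ∈ Ω¹(Q, 𝔤)`. -/
structure CartanGeometry (S : ParabolicSubgroup c EP P) (EQ Q EM M : Type*)
    [NormedAddCommGroup EQ] [NormedSpace ℝ EQ] [TopologicalSpace Q] [ChartedSpace EQ Q]
    [IsManifold 𝓘(ℝ, EQ) ∞ Q]
    [NormedAddCommGroup EM] [NormedSpace ℝ EM] [TopologicalSpace M] [ChartedSpace EM M] where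
  /-- the bundle projection -/
  proj : Q → M
  /-- the principal right action `(u, h) ↦ u · h` -/
  act : Q → P → Q
  contMDiff_proj : ContMDiff 𝓘(ℝ, EQ) 𝓘(ℝ, EM) ∞ proj
  contMDiff_act : ContMDiff (𝓘(ℝ, EQ).prod 𝓘(ℝ, EP)) 𝓘(ℝ, EQ) ∞ (fun p : Q × P => act p.1 p.2)
  act_one : ∀ u, act u 1 = u
  act_mul : ∀ u h h', act u (h * h') = act (act u h) h'
  proj_act : ∀ u h, proj (act u h) = proj u
  /-- Local triviality: near every point there is a smooth section `s` such that
  `(y, h) ↦ s y · h` is a diffeomorphism onto the preimage, with inverse `u ↦ (proj u, τ u)`. -/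
  locally_trivial : ∀ x : M, ∃ U : Set M, IsOpen U ∧ x ∈ U ∧ ∃ (s : M → Q) (τ : Q → P),
    ContMDiffOn 𝓘(ℝ, EM) 𝓘(ℝ, EQ) ∞ s U ∧
    ContMDiffOn 𝓘(ℝ, EQ) 𝓘(ℝ, EP) ∞ τ (proj ⁻¹' U) ∧
    (∀ y ∈ U, proj (s y) = y) ∧
    (∀ u, proj u ∈ U → act (s (proj u)) (τ u) = u) ∧
    (∀ y ∈ U, ∀ h, τ (act (s y) h) = h)
  /-- the Cartan connection, a linear isomorphism `T_u Q ≅ 𝔤` at each point -/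
  conn : ∀ u : Q, TangentSpace 𝓘(ℝ, EQ) u ≃L[ℝ] LieAlg EG G
  /-- `ω` is smooth; equivalently, the constant vector fields `ω⁻¹(X)`, `X ∈ 𝔤`, are smooth. -/
  contMDiff_const : ∀ X : LieAlg EG G, ContMDiff 𝓘(ℝ, EQ) 𝓘(ℝ, EQ).tangent ∞
    (fun u => (⟨u, (conn u).symm X⟩ : TangentBundle 𝓘(ℝ, EQ) Q))
  /-- equivariancy, `(R_h)^* ω = Ad(h⁻¹) ∘ ω` -/
  conn_act : ∀ (u : Q) (h : P) (v : TangentSpace 𝓘(ℝ, EQ) u),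
    conn (act u h) (mfderiv 𝓘(ℝ, EQ) 𝓘(ℝ, EQ) (fun u' => act u' h) u v) =
      Ad (S.incl h⁻¹) (conn u v)
  /-- `ω` reproduces the generators of fundamental vector fields. -/
  conn_fundamental : ∀ (u : Q) (X : LieAlg EP P),
    conn (act u 1) (mfderiv 𝓘(ℝ, EP) 𝓘(ℝ, EQ) (fun h => act u h) 1 X) = derivOne S.incl X

namespace CartanGeometry

variable {S : ParabolicSubgroup c EP P} {Q M : Type*}
  [TopologicalSpace Q] [ChartedSpace EQ Q] [IsManifold 𝓘(ℝ, EQ) ∞ Q]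
  [TopologicalSpace M] [ChartedSpace EM M]
  (C : CartanGeometry S EQ Q EM M)

/-- The constant vector field `ω⁻¹(X)` on the Cartan bundle. -/
def constField (X : LieAlg EG G) (u : Q) : TangentSpace 𝓘(ℝ, EQ) u := (C.conn u).symm X

/-- The curvature function `κ(X, Y) = [X, Y] - ω([ω⁻¹(X), ω⁻¹(Y)])` of the Cartan connection, i.e.
the value of `dω + ½[ω, ω]` on `ω⁻¹(X)` and `ω⁻¹(Y)`. -/
def curvature (u : Q) (X Y : LieAlg EG G) : LieAlg EG G :=
  ⁅X, Y⁆ - C.conn u (VectorField.mlieBracket 𝓘(ℝ, EQ) (C.constField X) (C.constField Y) u)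

/-- Regularity: the curvature has positive homogeneity. -/
def IsRegular : Prop := ∀ (u : Q) (i j : ℤ), ∀ X ∈ c.filt i, ∀ Y ∈ c.filt j,
  C.curvature u X Y ∈ c.filt (i + j + 1)

/-- Normality `∂^* κ = 0`: for a basis `Xᵢ` of `𝔤₋ ≅ 𝔤/𝔭` and the basis `Zᵢ` of `𝔭₊` which is dual
with respect to the Killing form,
`(∂^* κ)(Y) = 2 ∑ᵢ [Zᵢ, κ(Y, Xᵢ)] - ∑ᵢ κ([Zᵢ, Y], Xᵢ)` vanishes for all `Y ∈ 𝔤`. -/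
def IsNormal : Prop := ∀ (n : ℕ) (X : Module.Basis (Fin n) ℝ c.neg) (Z : Fin n → LieAlg EG G),
  (∀ i, Z i ∈ c.filt 1) →
  (∀ i j, killingForm ℝ (LieAlg EG G) (Z i) (X j : LieAlg EG G) = if i = j then 1 else 0) →
  ∀ (u : Q) (Y : LieAlg EG G),
    (2 : ℝ) • ∑ i, ⁅Z i, C.curvature u Y (X i : LieAlg EG G)⁆ -
      ∑ i, C.curvature u ⁅Z i, Y⁆ (X i : LieAlg EG G) = 0

/-- A parabolic contact structure of type `(G, P)`: a regular normal Cartan geometry. -/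
def IsParabolicContact : Prop := C.IsRegular ∧ C.IsNormal

/-- The contact subspace `H_x ⊆ T_x M` at `x = proj u`, corresponding to `𝔤^{-1}/𝔭 ⊆ 𝔤/𝔭`. -/
def contactSubspace (u : Q) : Submodule ℝ (TangentSpace 𝓘(ℝ, EM) (C.proj u)) :=
  ((c.filt (-1)).comap ((C.conn u).toLinearEquiv : TangentSpace 𝓘(ℝ, EQ) u →ₗ[ℝ] LieAlg EG G)).map
    (mfderiv 𝓘(ℝ, EQ) 𝓘(ℝ, EM) C.proj u).toLinearMap

/-- An infinitesimal automorphism: a vector field `ξ` on `M` together with its lift `ξ̃` to a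
`P`-invariant vector field on `Q` that preserves the Cartan connection. -/
structure InfAut where
  field : ∀ x : M, TangentSpace 𝓘(ℝ, EM) x
  lift : ∀ u : Q, TangentSpace 𝓘(ℝ, EQ) u
  contMDiff_lift : ContMDiff 𝓘(ℝ, EQ) 𝓘(ℝ, EQ).tangent ∞
    (fun u => (⟨u, lift u⟩ : TangentBundle 𝓘(ℝ, EQ) Q))
  mfderiv_proj : ∀ u, mfderiv 𝓘(ℝ, EQ) 𝓘(ℝ, EM) C.proj u (lift u) = field (C.proj u)
  lift_act : ∀ u h,
    mfderiv 𝓘(ℝ, EQ) 𝓘(ℝ, EQ) (fun u' => C.act u' h) u (lift u) = lift (C.act u h)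
  /-- `L_ξ̃ ω = 0`; equivalently, `ξ̃` commutes with all constant vector fields `ω⁻¹(X)`. -/
  mlieBracket_const : ∀ X u, VectorField.mlieBracket 𝓘(ℝ, EQ) lift (C.constField X) u = 0

variable {C} (ξ : C.InfAut)

namespace InfAut

/-- `ξ` is transverse to the contact subbundle. -/
def IsTransverse : Prop := ∀ u : Q, ξ.field (C.proj u) ∉ C.contactSubspace u

/-- The equivariant function `s = ω(ξ̃) : Q → 𝔤`, i.e. the section of the adjoint tractor bundle
that corresponds to `ξ`. -/
def sec (u : Q) : LieAlg EG G := C.conn u (ξ.lift u)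

/-- The derivative at `u` of the function `s = ω(ξ̃) : Q → 𝔤` in direction `v`. -/
def secDeriv (u : Q) (v : TangentSpace 𝓘(ℝ, EQ) u) : LieAlg EG G :=
  let s : Q → EG := ξ.sec
  (mfderiv 𝓘(ℝ, EQ) 𝓘(ℝ, EG) s u : EQ →L[ℝ] EG) v

/-- `ξ` is normal: the section `s` of the adjoint tractor bundle is parallel for the tractor
connection, which in terms of equivariant functions is `∇_X s = ω⁻¹(X) · s + [X, s]`. -/
def IsNormal : Prop := ∀ (u : Q) (X : LieAlg EG G),
  ξ.secDeriv u (C.constField X u) + ⁅X, ξ.sec u⁆ = 0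

end InfAut

/-! ### Forms with values in a tractor bundle

Differential forms on `M` with values in `𝒱M = Q ×_P V` are viewed as smooth `V`-valued forms on
`Q` which are horizontal and `P`-equivariant. -/

variable (C)

/-- The space `Ω^k(M, 𝒱M)` for the associated bundle `𝒱M = Q ×_P V`: smooth `V`-valued forms `φ` on
`Q` such that `(R_h)^* φ = ρ(h⁻¹) ∘ φ` for `h ∈ P`, and `φ` vanishes upon insertion of a vertical
tangent vector. -/
def bundleForms (ρ : G →* (V →L[ℝ] V)) (k : ℕ) : Submodule ℝ (Form EQ Q V k) where
  carrier := {φ | IsSmoothForm φ ∧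
    (∀ u h, (φ (C.act u h)).compContinuousLinearMap
      (mfderiv 𝓘(ℝ, EQ) 𝓘(ℝ, EQ) (fun u' => C.act u' h) u : EQ →L[ℝ] EQ) =
        (ρ (S.incl h⁻¹)).compContinuousAlternatingMap (φ u)) ∧
    (∀ (u : Q) (v : Fin k → EQ), (∃ i, C.conn u (v i) ∈ c.filt 0) → φ u v = 0)}
  add_mem' := by
    rintro φ ψ ⟨h₁, h₂, h₃⟩ ⟨h₁', h₂', h₃'⟩
    refine ⟨h₁.add h₁', fun u h => ?_, fun u v hv => ?_⟩
    · ext v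
      have e₁ := DFunLike.congr_fun (h₂ u h) v
      have e₂ := DFunLike.congr_fun (h₂' u h) v
      exact (congrArg₂ (· + ·) e₁ e₂).trans (map_add (ρ (S.incl h⁻¹)) (φ u v) (ψ u v)).symm
    · exact (congrArg₂ (· + ·) (h₃ u v hv) (h₃' u v hv)).trans (add_zero _)
  zero_mem' := by
    refine ⟨IsSmoothForm.zero, fun u h => ?_, fun _ _ _ => rfl⟩
    ext v
    exact (map_zero (ρ (S.incl h⁻¹))).symm
  smul_mem' := by
    rintro a φ ⟨h₁, h₂, h₃⟩
    refine ⟨h₁.smul a, fun u h => ?_, fun u v hv => ?_⟩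
    · ext v
      have e := DFunLike.congr_fun (h₂ u h) v
      exact (congrArg (a • ·) e).trans (map_smul (ρ (S.incl h⁻¹)) a (φ u v)).symm
    · exact (congrArg (a • ·) (h₃ u v hv)).trans (smul_zero _)

/-- At `u : Q`, the linear map `v ↦ ρ'(ω(v)) ∘ φ_u`. -/
def connAct (ρ : G →* (V →L[ℝ] V)) {k : ℕ} (φ : Form EQ Q V k) (u : Q) :
    EQ →L[ℝ] EQ [⋀^Fin k]→L[ℝ] V :=
  LinearMap.toContinuousLinearMap
    { toFun := fun v => (infRep ρ (C.conn u v)).compContinuousAlternatingMap (φ u)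
      map_add' := fun v w => by
        ext x
        exact DFunLike.congr_fun (((infRep ρ).comp (C.conn u).toContinuousLinearMap).map_add v w)
          (φ u x)
      map_smul' := fun a v => by
        ext x
        exact DFunLike.congr_fun (((infRep ρ).comp (C.conn u).toContinuousLinearMap).map_smul a v)
          (φ u x) }

/-- The covariant exterior derivative `d^∇ φ = dφ + ω ∧ φ` induced by the tractor connection; here
`(ω ∧ φ)(v₀, …, v_k) = ∑ᵢ (-1)ⁱ ρ'(ω(vᵢ)) (φ(v₀, …, v̂ᵢ, …, v_k))`. -/
def covD (ρ : G →* (V →L[ℝ] V)) {k : ℕ} (φ : Form EQ Q V k) : Form EQ Q V (k + 1) := fun u =>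
  extD φ u + ContinuousAlternatingMap.alternatizeUncurryFin (C.connAct ρ φ u)

namespace InfAut

variable {C}

/-- Insertion `i_ξ` of `ξ`, realized as insertion of the lift `ξ̃`. -/
def insert {k : ℕ} (φ : Form EQ Q V (k + 1)) : Form EQ Q V k := fun u =>
  (φ u).curryLeft (ξ.lift u)

/-- The map `Ξ_*`: `Ξ` acts on `𝒱M` as `ρ'(ω(ξ̃))`, and `Ξ_*` applies `Ξ` to the values. -/
def Xi (ρ : G →* (V →L[ℝ] V)) (k : ℕ) : Form EQ Q V k →ₗ[ℝ] Form EQ Q V k where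
  toFun φ := fun u => (infRep ρ (ξ.sec u)).compContinuousAlternatingMap (φ u)
  map_add' φ ψ := by
    funext u; ext v
    exact map_add (infRep ρ (ξ.sec u)) (φ u v) (ψ u v)
  map_smul' a φ := by
    funext u; ext v
    exact map_smul (infRep ρ (ξ.sec u)) a (φ u v)

/-- The horizontal derivative `d̂ φ = d^∇ φ - α ∧ i_ξ d^∇ φ`. -/
def hatD (ρ : G →* (V →L[ℝ] V)) (α : Form EQ Q ℝ 1) {k : ℕ} (φ : Form EQ Q V k) :
    Form EQ Q V (k + 1) := fun u =>
  C.covD ρ φ u - wedge (ξ.insert (C.covD ρ φ) u) 1 (α u)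

/-- The form `dα ∧ φ`. -/
def wedgeD (α : Form EQ Q ℝ 1) {k : ℕ} (φ : Form EQ Q V k) : Form EQ Q V (k + 2) := fun u =>
  wedge (φ u) 2 (extD α u)

/-- `α ∈ Ω¹(M)` is the contact form associated with `ξ`: its kernel is the contact subbundle
(which corresponds to `𝔤^{-1}/𝔭`), and `ξ` is its Reeb field, i.e. `i_ξ α = 1` and `i_ξ dα = 0`.
Here `Ω¹(M)` is realized as for tractor bundles, with the trivial representation on `ℝ`. -/
structure IsContactFormOf (α : Form EQ Q ℝ 1) : Prop where
  mem : α ∈ C.bundleForms (1 : G →* (ℝ →L[ℝ] ℝ)) 1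
  eq_zero_iff : ∀ (u : Q) (v : EQ), α u ![v] = 0 ↔ C.conn u v ∈ c.filt (-1)
  insert_eq_one : ∀ u, α u ![ξ.lift u] = 1
  insert_extD : ∀ (u : Q) (v : EQ), extD α u ![ξ.lift u, v] = 0

/-- The space `A^k` of forms `φ ∈ Ω^k(M, 𝒱M)` such that `L_ξ̃ φ = 0`, i.e. such that the derivative
along `ξ̃` of the function `Q → Λ^k 𝔤^* ⊗ V` corresponding to `φ` vanishes. (The derivative exists
for every smooth `φ`.) -/
def invForms (ρ : G →* (V →L[ℝ] V)) (k : ℕ) : Submodule ℝ (Form EQ Q V k) where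
  carrier := {φ | φ ∈ C.bundleForms ρ k ∧ ∀ (u : Q) (X : Fin k → LieAlg EG G),
    ∃ D : EQ →L[ℝ] V, HasMFDerivAt 𝓘(ℝ, EQ) 𝓘(ℝ, V)
      (fun u' : Q => φ u' (fun i => C.constField (X i) u')) u D ∧ D (ξ.lift u) = 0}
  add_mem' := by
    rintro φ ψ ⟨h₁, h₂⟩ ⟨h₁', h₂'⟩
    refine ⟨add_mem h₁ h₁', fun u X => ?_⟩
    obtain ⟨D, hD, hD0⟩ := h₂ u X
    obtain ⟨D', hD', hD0'⟩ := h₂' u X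
    exact ⟨D + D', hD.add hD', (congrArg₂ (· + ·) hD0 hD0').trans (add_zero _)⟩
  zero_mem' := ⟨zero_mem _, fun u X => ⟨0, hasMFDerivAt_const _ _, rfl⟩⟩
  smul_mem' := by
    rintro a φ ⟨h₁, h₂⟩
    refine ⟨Submodule.smul_mem _ a h₁, fun u X => ?_⟩
    obtain ⟨D, hD, hD0⟩ := h₂ u X
    exact ⟨a • D, hD.const_smul a, (congrArg (a • ·) hD0).trans (smul_zero _)⟩

/-- The space `A^k_hor` of horizontal elements of `A^k`, i.e. those with `i_ξ φ = 0`. -/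
def horForms (ρ : G →* (V →L[ℝ] V)) (k : ℕ) : Submodule ℝ (Form EQ Q V k) where
  carrier := {φ | φ ∈ ξ.invForms ρ k ∧
    ∀ (u : Q) (v : Fin k → EQ), (∃ i, v i = ξ.lift u) → φ u v = 0}
  add_mem' := by
    rintro φ ψ ⟨h₁, h₂⟩ ⟨h₁', h₂'⟩
    exact ⟨add_mem h₁ h₁', fun u v hv =>
      (congrArg₂ (· + ·) (h₂ u v hv) (h₂' u v hv)).trans (add_zero _)⟩
  zero_mem' := ⟨zero_mem _, fun _ _ _ => rfl⟩
  smul_mem' := by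
    rintro a φ ⟨h₁, h₂⟩
    exact ⟨Submodule.smul_mem _ a h₁, fun u v hv =>
      (congrArg (a • ·) (h₂ u v hv)).trans (smul_zero _)⟩

/-- The space `K^k` of those elements of `A^k_hor` that have values in `ker Ξ`. -/
def kerForms (ρ : G →* (V →L[ℝ] V)) (k : ℕ) : Submodule ℝ (Form EQ Q V k) :=
  ξ.horForms ρ k ⊓ LinearMap.ker (ξ.Xi ρ k)

/-- The image `Ξ_*(A^k_hor)`, so that `C^k = A^k_hor / Ξ_*(A^k_hor)`. -/
def imXi (ρ : G →* (V →L[ℝ] V)) (k : ℕ) : Submodule ℝ (Form EQ Q V k) :=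
  (ξ.horForms ρ k).map (ξ.Xi ρ k)

end InfAut

lemma covD_add (ρ : G →* (V →L[ℝ] V)) {k : ℕ} {φ ψ : Form EQ Q V k}
    (hφ : IsSmoothForm φ) (hψ : IsSmoothForm ψ) :
    C.covD ρ (φ + ψ) = C.covD ρ φ + C.covD ρ ψ := by
  funext u
  have h : C.connAct ρ (φ + ψ) u = C.connAct ρ φ u + C.connAct ρ ψ u := by
    ext v x
    exact map_add (infRep ρ (C.conn u v)) (φ u x) (ψ u x)
  simp only [covD, Pi.add_apply, extD_add hφ hψ, h,
    ContinuousAlternatingMap.alternatizeUncurryFin_add]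
  abel

lemma covD_smul (ρ : G →* (V →L[ℝ] V)) {k : ℕ} (a : ℝ) (φ : Form EQ Q V k) :
    C.covD ρ (a • φ) = a • C.covD ρ φ := by
  funext u
  have h : C.connAct ρ (a • φ) u = a • C.connAct ρ φ u := by
    ext v x
    exact map_smul (infRep ρ (C.conn u v)) a (φ u x)
  simp only [covD, Pi.smul_apply, extD_smul, h,
    ContinuousAlternatingMap.alternatizeUncurryFin_smul, smul_add]

/-- `d^∇` as a linear map on `Ω^k(M, 𝒱M)`. -/
def covDLin (ρ : G →* (V →L[ℝ] V)) (k : ℕ) : C.bundleForms ρ k →ₗ[ℝ] Form EQ Q V (k + 1) where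
  toFun φ := C.covD ρ (φ : Form EQ Q V k)
  map_add' φ ψ := C.covD_add ρ φ.2.1 ψ.2.1
  map_smul' a φ := C.covD_smul ρ a (φ : Form EQ Q V k)

namespace InfAut

variable {C}

/-- `d̂` as a linear map on `Ω^k(M, 𝒱M)`. -/
def hatDLin (ρ : G →* (V →L[ℝ] V)) (α : Form EQ Q ℝ 1) (k : ℕ) :
    C.bundleForms ρ k →ₗ[ℝ] Form EQ Q V (k + 1) where
  toFun φ := ξ.hatD ρ α (φ : Form EQ Q V k)
  map_add' φ ψ := by
    funext u
    have h := C.covD_add ρ φ.2.1 ψ.2.1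
    have hi : ξ.insert (C.covD ρ φ.1 + C.covD ρ ψ.1) u =
      ξ.insert (C.covD ρ φ.1) u + ξ.insert (C.covD ρ ψ.1) u := rfl
    simp only [hatD, Submodule.coe_add, h, hi, wedge_add, Pi.add_apply]
    abel
  map_smul' a φ := by
    funext u
    have h := C.covD_smul ρ a φ.1
    have hi : ξ.insert (a • C.covD ρ φ.1) u = a • ξ.insert (C.covD ρ φ.1) u := rfl
    simp only [hatD, Submodule.coe_smul, h, hi, wedge_smul, Pi.smul_apply, smul_sub,
      RingHom.id_apply]

/-! ### The cohomology groups -/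

/-- The `k`-cocycles of the complex `(A^*, d^∇)`. -/
def cocyclesA (ρ : G →* (V →L[ℝ] V)) (k : ℕ) : Submodule ℝ (Form EQ Q V k) :=
  ξ.invForms ρ k ⊓ (LinearMap.ker (C.covDLin ρ k)).map (C.bundleForms ρ k).subtype

/-- The `k`-coboundaries of the complex `(A^*, d^∇)`. -/
def coboundariesA (ρ : G →* (V →L[ℝ] V)) : ∀ k : ℕ, Submodule ℝ (Form EQ Q V k)
  | 0 => ⊥
  | k + 1 => ((ξ.invForms ρ k).comap (C.bundleForms ρ k).subtype).map (C.covDLin ρ k)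

/-- The `k`-cocycles of the complex `(K^*, d^∇)`. -/
def cocyclesK (ρ : G →* (V →L[ℝ] V)) (k : ℕ) : Submodule ℝ (Form EQ Q V k) :=
  ξ.kerForms ρ k ⊓ (LinearMap.ker (C.covDLin ρ k)).map (C.bundleForms ρ k).subtype

/-- The `k`-coboundaries of the complex `(K^*, d^∇)`. -/
def coboundariesK (ρ : G →* (V →L[ℝ] V)) : ∀ k : ℕ, Submodule ℝ (Form EQ Q V k)
  | 0 => ⊥
  | k + 1 => ((ξ.kerForms ρ k).comap (C.bundleForms ρ k).subtype).map (C.covDLin ρ k)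

/-- The forms `φ ∈ A^k_hor` which represent `k`-cocycles of the complex `(C^*, d̂)`, where
`C^k = A^k_hor / Ξ_*(A^k_hor)`: those with `d̂ φ ∈ Ξ_*(A^{k+1}_hor)`. -/
def cocyclesC (ρ : G →* (V →L[ℝ] V)) (α : Form EQ Q ℝ 1) (k : ℕ) :
    Submodule ℝ (Form EQ Q V k) :=
  ξ.horForms ρ k ⊓
    ((ξ.imXi ρ (k + 1)).comap (ξ.hatDLin ρ α k)).map (C.bundleForms ρ k).subtype

/-- The forms in `A^k_hor` which represent `k`-coboundaries of the complex `(C^*, d̂)`: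
`d̂(A^{k-1}_hor) + Ξ_*(A^k_hor)`. -/
def coboundariesC (ρ : G →* (V →L[ℝ] V)) (α : Form EQ Q ℝ 1) :
    ∀ k : ℕ, Submodule ℝ (Form EQ Q V k)
  | 0 => ξ.imXi ρ 0
  | k + 1 => ((ξ.horForms ρ k).comap (C.bundleForms ρ k).subtype).map (ξ.hatDLin ρ α k) ⊔
      ξ.imXi ρ (k + 1)

/-- `H^k(A^*, d^∇)`. -/
abbrev cohA (ρ : G →* (V →L[ℝ] V)) (k : ℕ) : Type _ :=
  ξ.cocyclesA ρ k ⧸ (ξ.coboundariesA ρ k).submoduleOf (ξ.cocyclesA ρ k)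

/-- `H^k(K^*, d^∇)`. -/
abbrev cohK (ρ : G →* (V →L[ℝ] V)) (k : ℕ) : Type _ :=
  ξ.cocyclesK ρ k ⧸ (ξ.coboundariesK ρ k).submoduleOf (ξ.cocyclesK ρ k)

/-- `H^k(C^*, d̂)`. -/
abbrev cohC (ρ : G →* (V →L[ℝ] V)) (α : Form EQ Q ℝ 1) (k : ℕ) : Type _ :=
  ξ.cocyclesC ρ α k ⧸ (ξ.coboundariesC ρ α k).submoduleOf (ξ.cocyclesC ρ α k)

/-- The class in `H^k(A^*, d^∇)` of a cocycle. -/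
def classA (ρ : G →* (V →L[ℝ] V)) {k : ℕ} (φ : Form EQ Q V k) (h : φ ∈ ξ.cocyclesA ρ k) :
    ξ.cohA ρ k := Submodule.Quotient.mk ⟨φ, h⟩

/-- The class in `H^k(K^*, d^∇)` of a cocycle. -/
def classK (ρ : G →* (V →L[ℝ] V)) {k : ℕ} (φ : Form EQ Q V k) (h : φ ∈ ξ.cocyclesK ρ k) :
    ξ.cohK ρ k := Submodule.Quotient.mk ⟨φ, h⟩

/-- The class in `H^k(C^*, d̂)` of a form representing a cocycle. -/
def classC (ρ : G →* (V →L[ℝ] V)) (α : Form EQ Q ℝ 1) {k : ℕ} (φ : Form EQ Q V k)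
    (h : φ ∈ ξ.cocyclesC ρ α k) : ξ.cohC ρ α k := Submodule.Quotient.mk ⟨φ, h⟩

end InfAut
end CartanGeometry
end Cartan
end ParabolicContact

end

/-!
The proof reduces everything to a formal calculus on the spaces `A^k` of invariant forms. Write `d`
for `d^∇`, `i` for `i_ξ`, `X` for `Ξ_*`, `a` for `α ∧ _` and `e` for `dα ∧ _`. Since the lift of `ξ`
commutes with all constant vector fields, the Lie derivative along the lift, taken on functions
`Q → Λ^k 𝔤^* ⊗ V`, is given by Cartan's formula; in terms of `d` the condition that it vanishes
becomes `i d + d i = X` (`mem_invForms_zero`, `mem_invForms_succ`). As `ξ` is normal, `ω(ξ̃)` is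
parallel, whence `d X = X d` (`covD_Xi`). Together with `d d = 0` this shows that `d`, `i` and `X`
preserve `A^*` (`cartanCalculus`). The Leibniz rule `d a = e - a d` (`covD_wedgeA`) and
`i a = 1 - a i` bring in the contact form; in particular `a` preserves `A^*`
(`wedgeA_mem_invForms`).

The one analytic point is that `d` preserves horizontal equivariant forms on `Q`
(`covD_mem_bundleForms`). Equivariancy and smoothness are direct. For horizontality one pulls a
form `φ` back along `(u, h) ↦ u · h`, where it becomes `ρ(h⁻¹) φ`, and differentiates in direction
`h`: inserting the vertical vector generated by `X ∈ 𝔭` into the ordinary exterior derivative of `φ`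
gives `-ρ'(X) φ` (`curryLeft_extD_vertical`), and this cancels against the algebraic part of `d`.

The contact form is `α = l(ω) / l(ω(ξ̃))` for a linear functional `l` on `𝔤` with kernel `𝔤^{-1}`.
Normality implies that `ω(ξ̃)` is constant along `ξ̃`, so `α` is invariant, and Cartan's formula for
the trivial representation gives `i dα = -d(i α) = -d 1 = 0` (`isContactFormOf_reebForm`).

For the exact sequence, every `τ ∈ A^{k+1}` decomposes as `τ = α ∧ φ + ψ` with horizontal `φ = i τ`
and `ψ`, and then `i d τ = X ψ - d̂ φ` (`insert_covD_eq`). Hence the forms which represent cocycles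
of `C^*` are exactly the `i τ` with `i d τ = 0`, the forms which represent coboundaries are those in
`i d A^*` (`mem_coboundariesC`), and the connecting map sends the class of `i τ` to the class of
`d τ`, which equals `dα ∧ φ + d̂ ψ` (`exists_connecting`, `covD_wedgeA_add`). From this description
exactness is a diagram chase (`exists_longExactSequence`).
-/


noncomputable section

namespace ParabolicContact

set_option maxSynthPendingDepth 3
set_option linter.unusedSectionVars false

/-! ### The exterior derivative on manifolds -/

section FormsOnManifolds

open Filter Topology

variable {E E' Q V : Type*}
  [NormedAddCommGroup E] [NormedSpace ℝ E] [NormedAddCommGroup E'] [NormedSpace ℝ E']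
  [TopologicalSpace Q] [ChartedSpace E Q] [IsManifold 𝓘(ℝ, E) ∞ Q]
  [NormedAddCommGroup V] [NormedSpace ℝ V]

/-- The derivative at `x` of a map between manifolds, as a linear map between the model spaces: each
tangent space is by definition a copy of the model space. -/
def mder (E E' : Type*) {A B : Type*} [NormedAddCommGroup E] [NormedSpace ℝ E]
    [NormedAddCommGroup E'] [NormedSpace ℝ E'] [TopologicalSpace A] [ChartedSpace E A]
    [TopologicalSpace B] [ChartedSpace E' B] (f : A → B) (x : A) : E →L[ℝ] E' :=
  mfderiv 𝓘(ℝ, E) 𝓘(ℝ, E') f x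

section mder

variable {E E' E'' A B D : Type*} [NormedAddCommGroup E] [NormedSpace ℝ E]
  [NormedAddCommGroup E'] [NormedSpace ℝ E'] [NormedAddCommGroup E''] [NormedSpace ℝ E'']
  [TopologicalSpace A] [ChartedSpace E A] [TopologicalSpace B] [ChartedSpace E' B]
  [TopologicalSpace D] [ChartedSpace E'' D]

lemma mder_comp {g : B → D} {f : A → B} (x : A)
    (hg : MDifferentiableAt 𝓘(ℝ, E') 𝓘(ℝ, E'') g (f x))
    (hf : MDifferentiableAt 𝓘(ℝ, E) 𝓘(ℝ, E') f x) :
    mder E E'' (g ∘ f) x = (mder E' E'' g (f x)).comp (mder E E' f x) :=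
  mfderiv_comp x hg hf

lemma mder_congr {f g : A → B} {x : A} (h : f =ᶠ[𝓝 x] g) : mder E E' f x = mder E E' g x :=
  h.mfderiv_eq (I := 𝓘(ℝ, E)) (I' := 𝓘(ℝ, E'))

lemma mder_eq_fderiv (f : E → E') (x : E) : mder E E' f x = fderiv ℝ f x :=
  mfderiv_eq_fderiv

lemma mder_id (x : A) : mder E E (id : A → A) x = ContinuousLinearMap.id ℝ E := mfderiv_id

lemma mder_const (b : B) (x : A) : mder E E' (fun _ : A => b) x = 0 := mfderiv_const

end mder

/-- The derivative of the preferred chart at `u`, evaluated at `u`, is the identity. -/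
lemma mder_extChartAt_base (u : Q) :
    mder E E (extChartAt 𝓘(ℝ, E) u) u = ContinuousLinearMap.id ℝ E := by
  have : IsManifold 𝓘(ℝ, E) 1 Q := IsManifold.of_le (n := ∞) ENat.LEInfty.out
  exact mfderiv_extChartAt_self (I := 𝓘(ℝ, E)) (x := u)

lemma mder_extChartAt_symm_base (u : Q) :
    mder E E (extChartAt 𝓘(ℝ, E) u).symm (extChartAt 𝓘(ℝ, E) u u) =
      ContinuousLinearMap.id ℝ E := by
  have : IsManifold 𝓘(ℝ, E) 1 Q := IsManifold.of_le (n := ∞) ENat.LEInfty.out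
  have h := mfderivWithin_range_extChartAt_symm (I := 𝓘(ℝ, E)) (x := u)
  rw [modelWithCornersSelf_coe, Set.range_id, mfderivWithin_univ] at h
  exact h

lemma chartRep_base {k : ℕ} (φ : Form E Q V k) (u : Q) :
    chartRep φ u (extChartAt 𝓘(ℝ, E) u u) = φ u := by
  have : ∀ (u' : Q) (L : E →L[ℝ] E), u' = u → L = ContinuousLinearMap.id ℝ E →
      (φ u').compContinuousLinearMap L = φ u := by
    rintro _ _ rfl rfl; rfl
  exact this _ _ (extChartAt_to_inv (I := 𝓘(ℝ, E)) u) (mder_extChartAt_symm_base u)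

lemma extD_eq_extDeriv {k : ℕ} (φ : Form E Q V k) (u : Q) :
    extD φ u = extDeriv (chartRep φ u) (extChartAt 𝓘(ℝ, E) u u) := by
  change (extDeriv (chartRep φ u) (extChartAt 𝓘(ℝ, E) u u)).compContinuousLinearMap
    (mder E E (extChartAt 𝓘(ℝ, E) u) u) = _
  rw [mder_extChartAt_base]; rfl

lemma contMDiffAt_extChartAt_symm (u : Q) {y : E} (hy : y ∈ (extChartAt 𝓘(ℝ, E) u).target) :
    ContMDiffAt 𝓘(ℝ, E) 𝓘(ℝ, E) ∞ (extChartAt 𝓘(ℝ, E) u).symm y :=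
  (contMDiffOn_extChartAt_symm u).contMDiffAt ((isOpen_extChartAt_target u).mem_nhds hy)

lemma mdifferentiableAt_extChartAt_symm (u : Q) {y : E}
    (hy : y ∈ (extChartAt 𝓘(ℝ, E) u).target) :
    MDifferentiableAt 𝓘(ℝ, E) 𝓘(ℝ, E) (extChartAt 𝓘(ℝ, E) u).symm y :=
  (contMDiffAt_extChartAt_symm u hy).mdifferentiableAt (by simp)

lemma mdifferentiableAt_extChartAt' (u : Q) {u' : Q}
    (hu : u' ∈ (extChartAt 𝓘(ℝ, E) u).source) :
    MDifferentiableAt 𝓘(ℝ, E) 𝓘(ℝ, E) (extChartAt 𝓘(ℝ, E) u) u' :=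
  (contMDiffAt_extChartAt' (n := ∞) (by simpa using hu)).mdifferentiableAt (by simp)

/-- The exterior derivative is natural with respect to pullback along a smooth map defined on a
vector space. -/
theorem extDeriv_pullbackForm {k : ℕ} {φ : Form E Q V k} (hφ : IsSmoothForm φ) {f : E' → Q}
    {x : E'} (hf : ContMDiffAt 𝓘(ℝ, E') 𝓘(ℝ, E) ∞ f x) :
    extDeriv (fun x' => (φ (f x')).compContinuousLinearMap (mder E' E f x')) x =
      (extD φ (f x)).compContinuousLinearMap (mder E' E f x) := by
  set e := extChartAt 𝓘(ℝ, E) (f x) with he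
  set g : E' → E := e ∘ f with hg
  have hgc : ContDiffAt ℝ ∞ g x :=
    contMDiffAt_iff_contDiffAt.1 ((contMDiffAt_extChartAt (x := f x)).comp x hf)
  have hf2 : ContMDiffAt 𝓘(ℝ, E') 𝓘(ℝ, E) 2 f x := hf.of_le ENat.LEInfty.out
  have : IsManifold 𝓘(ℝ, E) 2 Q := IsManifold.of_le (n := ∞) ENat.LEInfty.out
  have h1 : ∀ᶠ x' in 𝓝 x, ContMDiffAt 𝓘(ℝ, E') 𝓘(ℝ, E) 2 f x' := by
    obtain ⟨s, hs, hfs⟩ := (contMDiffAt_iff_contMDiffOn_nhds (by simp)).1 hf2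
    filter_upwards [eventually_mem_nhds_iff.2 hs] with x' hx' using hfs.contMDiffAt hx'
  have h2 : ∀ᶠ x' in 𝓝 x, f x' ∈ e.source :=
    hf.continuousAt.preimage_mem_nhds (extChartAt_source_mem_nhds (f x))
  have key : (fun x' => (φ (f x')).compContinuousLinearMap (mder E' E f x')) =ᶠ[𝓝 x]
      fun x' => (chartRep φ (f x) (g x')).compContinuousLinearMap (fderiv ℝ g x') := by
    filter_upwards [h1, h2, h2.eventually_nhds] with x' hx1 hx2 hx3
    have hgx : MDifferentiableAt 𝓘(ℝ, E') 𝓘(ℝ, E) g x' :=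
      (mdifferentiableAt_extChartAt' (f x) hx2).comp x' (hx1.mdifferentiableAt (by simp))
    have hc : f =ᶠ[𝓝 x'] e.symm ∘ g := by
      filter_upwards [hx3] with z hz using (e.left_inv hz).symm
    have hd : mder E' E f x' = (mder E E e.symm (g x')).comp (fderiv ℝ g x') := by
      rw [mder_congr hc, mder_comp x'
        (mdifferentiableAt_extChartAt_symm (f x) (e.map_source hx2)) hgx, mder_eq_fderiv]
    have hv : e.symm (g x') = f x' := e.left_inv hx2
    rw [hd, ← hv]
    rfl
  have hp : extDeriv (fun x' => (chartRep φ (f x) (g x')).compContinuousLinearMap (fderiv ℝ g x'))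
      x = (extDeriv (chartRep φ (f x)) (g x)).compContinuousLinearMap (fderiv ℝ g x) :=
    extDeriv_pullback (r := ∞) (hφ.differentiableAt (f x)) hgc
      (by rw [minSmoothness_of_isRCLikeNormedField]; exact ENat.LEInfty.out)
  rw [key.extDeriv_eq, hp]
  have hd : fderiv ℝ g x = (mder E E e (f x)).comp (mder E' E f x) := by
    rw [← mder_eq_fderiv]
    exact mder_comp x (mdifferentiableAt_extChartAt' (f x) (mem_extChartAt_source (f x)))
      (hf.mdifferentiableAt (by simp))
  rw [hd]
  rfl

/-- The exterior derivative may be computed in any of the preferred charts. -/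
lemma chartRep_extD {k : ℕ} {φ : Form E Q V k} (hφ : IsSmoothForm φ) (u : Q) {y : E}
    (hy : y ∈ (extChartAt 𝓘(ℝ, E) u).target) :
    chartRep (extD φ) u y = extDeriv (chartRep φ u) y :=
  (extDeriv_pullbackForm hφ (contMDiffAt_extChartAt_symm u hy)).symm

lemma IsSmoothForm.extD {k : ℕ} {φ : Form E Q V k} (hφ : IsSmoothForm φ) :
    IsSmoothForm (extD φ) := by
  intro u
  refine ContDiffOn.congr (f := extDeriv (chartRep φ u)) ?_ (fun y hy => chartRep_extD hφ u hy)
  have : ContDiffOn ℝ ∞ (fderiv ℝ (chartRep φ u)) (extChartAt 𝓘(ℝ, E) u).target :=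
    (hφ u).fderiv_of_isOpen (isOpen_extChartAt_target u) (by simp)
  exact (ContinuousAlternatingMap.alternatizeUncurryFinCLM ℝ E V).contDiff.comp_contDiffOn this

end FormsOnManifolds

/-! ### Alternating maps and wedge products -/

section AlternatingAlgebra

open ContinuousAlternatingMap (alternatizeUncurryFin alternatizeUncurryFinCLM
  alternatizeUncurryFin_apply alternatizeUncurryFin_add curryLeft_apply_apply curryLeftLI
  compContinuousLinearMapCLM alternatizeUncurryFin_alternatizeUncurryFinCLM_comp_of_symmetric)

variable {E E' V V' : Type*}
  [NormedAddCommGroup E] [NormedSpace ℝ E] [NormedAddCommGroup E'] [NormedSpace ℝ E']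
  [NormedAddCommGroup V] [NormedSpace ℝ V] [NormedAddCommGroup V'] [NormedSpace ℝ V']

/-- Insertion of a vector into an alternating map, as a continuous linear map. -/
def insertCLM (V : Type*) [NormedAddCommGroup V] [NormedSpace ℝ V] (k : ℕ) (w : E) :
    (E [⋀^Fin (k + 1)]→L[ℝ] V) →L[ℝ] (E [⋀^Fin k]→L[ℝ] V) :=
  (ContinuousLinearMap.apply ℝ (E [⋀^Fin k]→L[ℝ] V) w).comp
    curryLeftLI.toContinuousLinearMap

@[simp] lemma insertCLM_apply {k : ℕ} (w : E) (φ : E [⋀^Fin (k + 1)]→L[ℝ] V) :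
    insertCLM V k w φ = φ.curryLeft w := rfl

/-- A linear map acting on the values of alternating maps. -/
def valCLM (E : Type*) [NormedAddCommGroup E] [NormedSpace ℝ E] (k : ℕ) (A : V →L[ℝ] V') :
    (E [⋀^Fin k]→L[ℝ] V) →L[ℝ] (E [⋀^Fin k]→L[ℝ] V') :=
  ContinuousLinearMap.compContinuousAlternatingMapCLM ℝ E V V' (Fin k) A

@[simp] lemma valCLM_apply {k : ℕ} (A : V →L[ℝ] V') (φ : E [⋀^Fin k]→L[ℝ] V) :
    valCLM E k A φ = A.compContinuousAlternatingMap φ := rfl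

lemma curryLeft_alternatize {k : ℕ} (f : E →L[ℝ] E [⋀^Fin (k + 1)]→L[ℝ] V) (w : E) :
    (alternatizeUncurryFin f).curryLeft w =
      f w - alternatizeUncurryFin ((insertCLM V k w).comp f) := by
  ext v
  rw [curryLeft_apply_apply, alternatizeUncurryFin_apply, ContinuousAlternatingMap.sub_apply,
    alternatizeUncurryFin_apply, Fin.sum_univ_succ, sub_eq_add_neg, ← Finset.sum_neg_distrib]
  congr 1
  · simp
  · refine Finset.sum_congr rfl fun i _ => ?_
    have : i.succ.removeNth (Matrix.vecCons w v) = Matrix.vecCons w (i.removeNth v) := by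
      ext j
      refine Fin.cases ?_ (fun j => ?_) j <;> simp [Fin.removeNth]
    rw [this]
    simp [pow_succ]

lemma curryLeft_alternatize_zero (f : E →L[ℝ] E [⋀^Fin 0]→L[ℝ] V) (w : E) :
    (alternatizeUncurryFin f).curryLeft w = f w := by
  ext v
  rw [curryLeft_apply_apply, alternatizeUncurryFin_apply]
  simp

lemma alternatize_compContinuousLinearMap {k : ℕ} (f : E →L[ℝ] E [⋀^Fin k]→L[ℝ] V)
    (g : E' →L[ℝ] E) :
    (alternatizeUncurryFin f).compContinuousLinearMap g =
      alternatizeUncurryFin ((compContinuousLinearMapCLM g).comp (f.comp g)) := by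
  ext v
  simp [alternatizeUncurryFin_apply]
  rfl

lemma comp_alternatize {k : ℕ} (A : V →L[ℝ] V') (f : E →L[ℝ] E [⋀^Fin k]→L[ℝ] V) :
    A.compContinuousAlternatingMap (alternatizeUncurryFin f) =
      alternatizeUncurryFin ((valCLM E k A).comp f) := by
  ext v
  simp [alternatizeUncurryFin_apply]

/-- Alternating in two variables changes sign when these are exchanged. -/
lemma alternatize_alternatize_flip {k : ℕ} (B : E →L[ℝ] E →L[ℝ] E [⋀^Fin k]→L[ℝ] V) :
    alternatizeUncurryFin ((alternatizeUncurryFinCLM ℝ E V).comp B) =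
      -alternatizeUncurryFin ((alternatizeUncurryFinCLM ℝ E V).comp B.flip) := by
  have h := alternatizeUncurryFin_alternatizeUncurryFinCLM_comp_of_symmetric (f := B + B.flip)
    (fun x y => by simp [add_comm])
  rw [ContinuousLinearMap.comp_add, alternatizeUncurryFin_add] at h
  exact eq_neg_of_add_eq_zero_left h

/-- Alternating maps in one variable as linear maps. -/
def toLin (E : Type*) [NormedAddCommGroup E] [NormedSpace ℝ E] :
    (E [⋀^Fin 1]→L[ℝ] ℝ) →L[ℝ] (E →L[ℝ] ℝ) :=
  ((ContinuousAlternatingMap.apply ℝ E ℝ ![]).postcomp E).comp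
    curryLeftLI.toContinuousLinearMap

@[simp] lemma toLin_apply (β : E [⋀^Fin 1]→L[ℝ] ℝ) (v : E) : toLin E β v = β ![v] := rfl

/-- The wedge product `β ∧ φ` with a fixed one-form `β`, as a continuous linear map of `φ`. -/
def wedgeOne (V : Type*) [NormedAddCommGroup V] [NormedSpace ℝ V] (k : ℕ)
    (β : E [⋀^Fin 1]→L[ℝ] ℝ) : (E [⋀^Fin k]→L[ℝ] V) →L[ℝ] (E [⋀^Fin (k + 1)]→L[ℝ] V) :=
  (alternatizeUncurryFinCLM ℝ E V).comp
    (ContinuousLinearMap.smulRightL ℝ E (E [⋀^Fin k]→L[ℝ] V) (toLin E β))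

lemma wedge_one {k : ℕ} (φ : E [⋀^Fin k]→L[ℝ] V) (β : E [⋀^Fin 1]→L[ℝ] ℝ) :
    wedge φ 1 β = alternatizeUncurryFin ((toLin E β).smulRight φ) := by
  simp only [wedge, Nat.cast_zero, zero_add, div_one, one_smul]
  rfl

lemma wedgeOne_apply {k : ℕ} (φ : E [⋀^Fin k]→L[ℝ] V) (β : E [⋀^Fin 1]→L[ℝ] ℝ) :
    wedgeOne V k β φ = wedge φ 1 β := (wedge_one φ β).symm

lemma wedge_two {k : ℕ} (φ : E [⋀^Fin k]→L[ℝ] V) (β : E [⋀^Fin 2]→L[ℝ] ℝ) :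
    wedge φ 2 β = (1 / 2 : ℝ) • alternatizeUncurryFin ((wedge φ 1).comp β.curryLeft) := by
  rw [wedge]
  norm_num

lemma curryLeft_wedge_one {k : ℕ} (φ : E [⋀^Fin (k + 1)]→L[ℝ] V) (β : E [⋀^Fin 1]→L[ℝ] ℝ)
    (w : E) : (wedge φ 1 β).curryLeft w = β ![w] • φ - wedge (φ.curryLeft w) 1 β := by
  rw [wedge_one, wedge_one, curryLeft_alternatize]
  congr 2

lemma curryLeft_wedge_one_zero (φ : E [⋀^Fin 0]→L[ℝ] V) (β : E [⋀^Fin 1]→L[ℝ] ℝ)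
    (w : E) : (wedge φ 1 β).curryLeft w = β ![w] • φ := by
  rw [wedge_one, curryLeft_alternatize_zero]
  rfl

lemma apply_swap (β : E [⋀^Fin 2]→L[ℝ] ℝ) (v w : E) : β ![v, w] = -β ![w, v] := by
  have h := β.toAlternatingMap.map_swap ![w, v] (i := 0) (j := 1) (by decide)
  have e : (![w, v] ∘ Equiv.swap (0 : Fin 2) 1) = ![v, w] := by
    ext i; fin_cases i <;> simp
  rw [e] at h
  exact h

lemma curryLeft_wedge_two {k : ℕ} (φ : E [⋀^Fin (k + 1)]→L[ℝ] V) {β : E [⋀^Fin 2]→L[ℝ] ℝ}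
    {w : E} (h : ∀ v, β ![w, v] = 0) :
    (wedge φ 2 β).curryLeft w = wedge (φ.curryLeft w) 2 β := by
  have h0 : β.curryLeft w = 0 := by
    ext v
    have : v = ![v 0] := by ext i; fin_cases i; rfl
    rw [this]; exact h _
  have h1 : (insertCLM V (k + 1) w).comp ((wedge φ 1).comp β.curryLeft) =
      -(wedge (φ.curryLeft w) 1).comp β.curryLeft := by
    ext1 v
    have : (β.curryLeft v) ![w] = 0 := (apply_swap β v w).trans (by rw [h, neg_zero])
    change (wedge φ 1 (β.curryLeft v)).curryLeft w = -wedge (φ.curryLeft w) 1 (β.curryLeft v)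
    rw [curryLeft_wedge_one, this, zero_smul, zero_sub]
  rw [wedge_two, wedge_two, ContinuousAlternatingMap.curryLeft_smul, smul_apply,
    curryLeft_alternatize, h1]
  have h2 : ((wedge φ 1).comp β.curryLeft) w = 0 := by
    rw [ContinuousLinearMap.comp_apply, h0, map_zero]
  have h3 : alternatizeUncurryFin (-(wedge (φ.curryLeft w) 1).comp β.curryLeft) =
      -alternatizeUncurryFin ((wedge (φ.curryLeft w) 1).comp β.curryLeft) :=
    map_neg (alternatizeUncurryFinCLM ℝ E V) _
  rw [h2, h3, zero_sub, neg_neg]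

lemma curryLeft_wedge_two_zero (φ : E [⋀^Fin 0]→L[ℝ] V) {β : E [⋀^Fin 2]→L[ℝ] ℝ}
    {w : E} (h : ∀ v, β ![w, v] = 0) :
    (wedge φ 2 β).curryLeft w = 0 := by
  have h0 : β.curryLeft w = 0 := by
    ext v
    have : v = ![v 0] := by ext i; fin_cases i; rfl
    rw [this]; exact h _
  have h1 : (insertCLM V 0 w).comp ((wedge φ 1).comp β.curryLeft) = 0 := by
    ext1 v
    have : (β.curryLeft v) ![w] = 0 := (apply_swap β v w).trans (by rw [h, neg_zero])
    change (wedge φ 1 (β.curryLeft v)).curryLeft w = 0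
    rw [curryLeft_wedge_one_zero, this, zero_smul]
  rw [wedge_two, ContinuousAlternatingMap.curryLeft_smul, smul_apply,
    curryLeft_alternatize, h1]
  have h2 : ((wedge φ 1).comp β.curryLeft) w = 0 := by
    rw [ContinuousLinearMap.comp_apply, h0, map_zero]
  have h3 : alternatizeUncurryFin (0 : E →L[ℝ] E [⋀^Fin 0]→L[ℝ] V) = 0 :=
    map_zero (alternatizeUncurryFinCLM ℝ E V)
  rw [h2, h3, sub_zero, smul_zero]

/-- The part of the Leibniz rule `d(β ∧ φ) = dβ ∧ φ - β ∧ dφ` in which `β` is differentiated. -/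
lemma wedge_two_alternatize {k : ℕ} (φ : E [⋀^Fin k]→L[ℝ] V) (D : E →L[ℝ] E [⋀^Fin 1]→L[ℝ] ℝ) :
    wedge φ 2 (alternatizeUncurryFin D) = alternatizeUncurryFin ((wedge φ 1).comp D) := by
  let B : E →L[ℝ] E →L[ℝ] E [⋀^Fin k]→L[ℝ] V :=
    ((ContinuousLinearMap.smulRightL ℝ E (E [⋀^Fin k]→L[ℝ] V)).flip φ).comp ((toLin E).comp D)
  have h1 : (wedge φ 1).comp D = (alternatizeUncurryFinCLM ℝ E V).comp B := by
    ext1 v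
    exact wedge_one φ (D v)
  have h2 : (wedge φ 1).comp (alternatizeUncurryFin D).curryLeft =
      (alternatizeUncurryFinCLM ℝ E V).comp B - (alternatizeUncurryFinCLM ℝ E V).comp B.flip := by
    ext1 v
    rw [ContinuousLinearMap.comp_apply, curryLeft_alternatize, map_sub, ← h1]
    congr 1
    refine (wedge_one _ _).trans ?_
    change _ = alternatizeUncurryFin (B.flip v)
    congr 1
    ext1 x
    have : alternatizeUncurryFin ((insertCLM ℝ 0 v).comp D) ![x] = D x ![v] := by
      simp [alternatizeUncurryFin_apply]
    change (alternatizeUncurryFin ((insertCLM ℝ 0 v).comp D) ![x]) • φ = D x ![v] • φ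
    rw [this]
  have h3 : ∀ f g : E →L[ℝ] E [⋀^Fin (k + 1)]→L[ℝ] V,
      alternatizeUncurryFin (f - g) = alternatizeUncurryFin f - alternatizeUncurryFin g :=
    map_sub (alternatizeUncurryFinCLM ℝ E V)
  rw [wedge_two, h2, h3, alternatize_alternatize_flip B.flip, ContinuousLinearMap.flip_flip,
    sub_neg_eq_add, ← two_smul ℝ, smul_smul, h1]
  norm_num

/-- The part of the Leibniz rule `d(β ∧ φ) = dβ ∧ φ - β ∧ dφ` in which `φ` is differentiated. -/
lemma alternatize_wedgeOne_comp {k : ℕ} (D : E →L[ℝ] E [⋀^Fin k]→L[ℝ] V)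
    (β : E [⋀^Fin 1]→L[ℝ] ℝ) :
    alternatizeUncurryFin ((wedgeOne V k β).comp D) = -wedge (alternatizeUncurryFin D) 1 β := by
  let B : E →L[ℝ] E →L[ℝ] E [⋀^Fin k]→L[ℝ] V :=
    (ContinuousLinearMap.smulRightL ℝ E (E [⋀^Fin k]→L[ℝ] V) (toLin E β)).comp D
  change alternatizeUncurryFin ((alternatizeUncurryFinCLM ℝ E V).comp B) = _
  rw [alternatize_alternatize_flip, wedge_one]
  congr 2
  ext1 v
  have : B.flip v = (β ![v]) • D := by ext1 x; rfl
  change alternatizeUncurryFin (B.flip v) = _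
  rw [this, ContinuousAlternatingMap.alternatizeUncurryFin_smul]
  rfl

lemma wedge_one_wedge_one {k : ℕ} (φ : E [⋀^Fin k]→L[ℝ] V) (β : E [⋀^Fin 1]→L[ℝ] ℝ) :
    wedge (wedge φ 1 β) 1 β = 0 := by
  have h := alternatize_wedgeOne_comp ((toLin E β).smulRight φ) β
  have h2 : (wedgeOne V k β).comp ((toLin E β).smulRight φ) =
      (toLin E β).smulRight (wedge φ 1 β) := by
    ext1 v
    simp [wedgeOne_apply]
  rw [h2, ← wedge_one, ← wedge_one] at h
  have h3 : (2 : ℝ) • wedge (wedge φ 1 β) 1 β = 0 := by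
    rw [two_smul]
    exact eq_neg_iff_add_eq_zero.1 h
  exact (smul_eq_zero.1 h3).resolve_left two_ne_zero

lemma wedge_one_compContinuousLinearMap {k : ℕ} (φ : E [⋀^Fin k]→L[ℝ] V)
    (β : E [⋀^Fin 1]→L[ℝ] ℝ) (g : E' →L[ℝ] E) :
    (wedge φ 1 β).compContinuousLinearMap g =
      wedge (φ.compContinuousLinearMap g) 1 (β.compContinuousLinearMap g) := by
  rw [wedge_one, wedge_one, alternatize_compContinuousLinearMap]
  congr 1
  ext v x
  have : ∀ v : E', g ∘ ![v] = ![g v] := fun v => by ext i; fin_cases i; rfl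
  simp [this]

lemma comp_wedge_one {k : ℕ} (A : V →L[ℝ] V') (φ : E [⋀^Fin k]→L[ℝ] V)
    (β : E [⋀^Fin 1]→L[ℝ] ℝ) :
    A.compContinuousAlternatingMap (wedge φ 1 β) =
      wedge (A.compContinuousAlternatingMap φ) 1 β := by
  rw [wedge_one, wedge_one, comp_alternatize]
  congr 1
  ext v x
  simp

/-- If `f` vanishes on `S`, and all values of `f` vanish upon insertion of an element of `S`, then
the alternation of `f` vanishes upon insertion of an element of `S`. -/
lemma alternatize_apply_eq_zero {k : ℕ} (f : E →L[ℝ] E [⋀^Fin k]→L[ℝ] V) (S : Set E)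
    (h1 : ∀ w ∈ S, f w = 0) (h2 : ∀ x (v : Fin k → E), (∃ i, v i ∈ S) → f x v = 0)
    (v : Fin (k + 1) → E) (hv : ∃ i, v i ∈ S) : alternatizeUncurryFin f v = 0 := by
  obtain ⟨i, hi⟩ := hv
  rw [alternatizeUncurryFin_apply]
  refine Finset.sum_eq_zero fun j _ => ?_
  rcases eq_or_ne j i with rfl | hj
  · rw [h1 _ hi]; simp
  · obtain ⟨l, hl⟩ := Fin.exists_succAbove_eq hj.symm
    rw [h2 _ _ ⟨l, by rw [Fin.removeNth, hl]; exact hi⟩, smul_zero]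

lemma wedge_sub {k : ℕ} (φ ψ : E [⋀^Fin k]→L[ℝ] V) (β : E [⋀^Fin 1]→L[ℝ] ℝ) :
    wedge (φ - ψ) 1 β = wedge φ 1 β - wedge ψ 1 β := by
  simp only [← wedgeOne_apply, map_sub]

lemma wedge_zero {k : ℕ} (β : E [⋀^Fin 1]→L[ℝ] ℝ) :
    wedge (0 : E [⋀^Fin k]→L[ℝ] V) 1 β = 0 := by
  simp only [← wedgeOne_apply, map_zero]

end AlternatingAlgebra

/-! ### Vector fields and infinitesimal representations -/

section VectorFields

open Filter Topology VectorField

variable {E Q F : Type*}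
  [NormedAddCommGroup E] [NormedSpace ℝ E]
  [TopologicalSpace Q] [ChartedSpace E Q] [IsManifold 𝓘(ℝ, E) ∞ Q]
  [NormedAddCommGroup F] [NormedSpace ℝ F]

/-- The coordinate expression of a vector field in the preferred chart at `u`. Vector fields are
regarded as functions with values in the model space. -/
def fieldRep (X : Q → E) (u : Q) (y : E) : E :=
  (mder E E (extChartAt 𝓘(ℝ, E) u).symm y).inverse (X ((extChartAt 𝓘(ℝ, E) u).symm y))

/-- A `C^n` vector field, as a section of the tangent bundle. -/
def SmoothField (n : ℕ∞ω) (X : Q → E) : Prop :=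
  ContMDiff 𝓘(ℝ, E) 𝓘(ℝ, E).tangent n (fun u => (⟨u, X u⟩ : TangentBundle 𝓘(ℝ, E) Q))

lemma isInvertible_mder_symm (u : Q) {y : E} (hy : y ∈ (extChartAt 𝓘(ℝ, E) u).target) :
    (mder E E (extChartAt 𝓘(ℝ, E) u).symm y).IsInvertible := by
  have : IsManifold 𝓘(ℝ, E) 1 Q := IsManifold.of_le (n := ∞) ENat.LEInfty.out
  have h := isInvertible_mfderivWithin_extChartAt_symm (I := 𝓘(ℝ, E)) hy
  rw [modelWithCornersSelf_coe, Set.range_id, mfderivWithin_univ] at h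
  exact h

lemma mder_symm_fieldRep (X : Q → E) (u : Q) {y : E}
    (hy : y ∈ (extChartAt 𝓘(ℝ, E) u).target) :
    mder E E (extChartAt 𝓘(ℝ, E) u).symm y (fieldRep X u y) =
      X ((extChartAt 𝓘(ℝ, E) u).symm y) := by
  obtain ⟨L, hL⟩ := isInvertible_mder_symm u hy
  rw [fieldRep, ← hL, ContinuousLinearMap.inverse_equiv]
  exact L.apply_symm_apply _

lemma fieldRep_base (X : Q → E) (u : Q) :
    fieldRep X u (extChartAt 𝓘(ℝ, E) u u) = X u := by
  have h := mder_symm_fieldRep X u (mem_extChartAt_target u)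
  rw [mder_extChartAt_symm_base] at h
  refine h.trans ?_
  rw [extChartAt_to_inv (I := 𝓘(ℝ, E)) u]

lemma SmoothField.contDiffOn_fieldRep [CompleteSpace E] {n : ℕ∞ω} (hn : n + 1 ≤ ∞) {X : Q → E}
    (hX : SmoothField n X) (u : Q) :
    ContDiffOn ℝ n (fieldRep X u) (extChartAt 𝓘(ℝ, E) u).target := by
  have : IsManifold 𝓘(ℝ, E) (n + 1) Q := IsManifold.of_le (n := ∞) hn
  intro y hy
  have : IsManifold 𝓘(ℝ, E) 1 Q := IsManifold.of_le (n := ∞) ENat.LEInfty.out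
  have h0 := (hX ((extChartAt 𝓘(ℝ, E) u).symm y)).mpullback_vectorField_preimage
    (contMDiffAt_extChartAt_symm u hy) (isInvertible_mder_symm (E := E) u hy) hn
  have h1 : ContDiffAt ℝ n (fieldRep (E := E) X u) y :=
    contMDiffAt_vectorSpace_iff_contDiffAt.1 h0
  exact h1.contDiffWithinAt

lemma SmoothField.differentiableAt_fieldRep [CompleteSpace E] {n : ℕ∞ω} (hn : n + 1 ≤ ∞)
    (hn' : n ≠ 0) {X : Q → E} (hX : SmoothField n X) (u : Q) :
    DifferentiableAt ℝ (fieldRep X u) (extChartAt 𝓘(ℝ, E) u u) :=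
  ((hX.contDiffOn_fieldRep hn u).contDiffAt ((isOpen_extChartAt_target u).mem_nhds
    (mem_extChartAt_target u))).differentiableAt hn'

lemma mlieBracket_eq_lieBracket (X Y : Q → E) (u : Q) :
    (mlieBracket 𝓘(ℝ, E) X Y u : E) =
      lieBracket ℝ (fieldRep X u) (fieldRep Y u) (extChartAt 𝓘(ℝ, E) u u) := by
  have h0 := mlieBracketWithin_apply (I := 𝓘(ℝ, E)) (V := X) (W := Y) (s := Set.univ) (x₀ := u)
  have h : ∀ Z : E, (mder E E (extChartAt 𝓘(ℝ, E) u) u).inverse Z = Z := fun Z => by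
    rw [mder_extChartAt_base, ContinuousLinearMap.inverse_id]; rfl
  refine h0.trans ((h _).trans ?_)
  simp only [modelWithCornersSelf_coe, Set.range_id, Set.preimage_univ, Set.inter_univ]
  have hm : ∀ Z : Q → E, (mpullbackWithin 𝓘(ℝ, E) 𝓘(ℝ, E) (extChartAt 𝓘(ℝ, E) u).symm Z
      Set.univ : E → E) = fieldRep Z u := fun Z => mpullbackWithin_univ
  exact (congrArg₂ (fun A B : E → E => lieBracketWithin ℝ A B Set.univ (extChartAt 𝓘(ℝ, E) u u))
    (hm X) (hm Y)).trans (congrFun lieBracketWithin_univ _)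

/-- The Lie bracket of vector fields acts on functions as a commutator. -/
lemma mder_mlieBracket {X Y : Q → E} {u : Q}
    (hX : DifferentiableAt ℝ (fieldRep X u) (extChartAt 𝓘(ℝ, E) u u))
    (hY : DifferentiableAt ℝ (fieldRep Y u) (extChartAt 𝓘(ℝ, E) u u)) {f : Q → F}
    (hf : ContMDiff 𝓘(ℝ, E) 𝓘(ℝ, F) ∞ f) :
    mder E F f u (mlieBracket 𝓘(ℝ, E) X Y u) =
      fderiv ℝ (fun y => mder E F f ((extChartAt 𝓘(ℝ, E) u).symm y)
          (Y ((extChartAt 𝓘(ℝ, E) u).symm y))) (extChartAt 𝓘(ℝ, E) u u) (X u) -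
        fderiv ℝ (fun y => mder E F f ((extChartAt 𝓘(ℝ, E) u).symm y)
          (X ((extChartAt 𝓘(ℝ, E) u).symm y))) (extChartAt 𝓘(ℝ, E) u u) (Y u) := by
  set e := extChartAt 𝓘(ℝ, E) u with he
  set g : E → F := f ∘ e.symm with hg
  have hgc : ContDiffOn ℝ ∞ g e.target :=
    contMDiffOn_iff_contDiffOn.1 (hf.comp_contMDiffOn (contMDiffOn_extChartAt_symm u))
  have hg0 : ContDiffAt ℝ ∞ g (e u) := hgc.contDiffAt
    ((isOpen_extChartAt_target u).mem_nhds (mem_extChartAt_target u))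
  have hder : ∀ y ∈ e.target, fderiv ℝ g y = (mder E F f (e.symm y)).comp (mder E E e.symm y) := by
    intro y hy
    rw [← mder_eq_fderiv]
    exact mder_comp y ((hf _).mdifferentiableAt (by simp)) (mdifferentiableAt_extChartAt_symm u hy)
  have hev : ∀ Z : Q → E,
      (fun y => mder E F f (e.symm y) (Z (e.symm y))) =ᶠ[𝓝 (e u)]
        fun y => fderiv ℝ g y (fieldRep Z u y) := by
    intro Z
    filter_upwards [extChartAt_target_mem_nhds (I := 𝓘(ℝ, E)) u] with y hy
    rw [hder y hy, ContinuousLinearMap.comp_apply, mder_symm_fieldRep Z u hy]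
  have hd : DifferentiableAt ℝ (fderiv ℝ g) (e u) :=
    (hg0.fderiv_right (m := ∞) (by simp)).differentiableAt (by simp)
  have hsymm := (hg0.isSymmSndFDerivAt (by
    rw [minSmoothness_of_isRCLikeNormedField]; exact ENat.LEInfty.out)).eq (X u) (Y u)
  have h0 : fderiv ℝ g (e u) = mder E F f u := by
    rw [hder _ (mem_extChartAt_target u), mder_extChartAt_symm_base,
      extChartAt_to_inv (I := 𝓘(ℝ, E)) u]
    rfl
  have hb : (mlieBracket 𝓘(ℝ, E) X Y u : E) =
      fderiv ℝ (fieldRep Y u) (e u) (X u) - fderiv ℝ (fieldRep X u) (e u) (Y u) := by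
    rw [mlieBracket_eq_lieBracket, lieBracket, fieldRep_base, fieldRep_base]
  rw [(hev Y).fderiv_eq, (hev X).fderiv_eq, fderiv_clm_apply hd hY, fderiv_clm_apply hd hX, hb, h0]
  simp only [add_apply, ContinuousLinearMap.comp_apply,
    ContinuousLinearMap.flip_apply, map_sub]
  rw [fieldRep_base, fieldRep_base, hsymm]
  abel

end VectorFields

section Representations

open VectorField

variable {EG G EP P V : Type*}
  [NormedAddCommGroup EG] [NormedSpace ℝ EG]
  [TopologicalSpace G] [ChartedSpace EG G] [Group G] [LieGroup 𝓘(ℝ, EG) ∞ G]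
  [NormedAddCommGroup EP] [NormedSpace ℝ EP]
  [TopologicalSpace P] [ChartedSpace EP P] [Group P] [LieGroup 𝓘(ℝ, EP) ∞ P]
  [NormedAddCommGroup V] [NormedSpace ℝ V]

/-- The infinitesimal representation, as a linear map on the model space of `G`. -/
def infRep' (EG : Type*) {G : Type*} [NormedAddCommGroup EG] [NormedSpace ℝ EG]
    [TopologicalSpace G] [ChartedSpace EG G] [Group G] (ρ : G →* (V →L[ℝ] V)) :
    EG →L[ℝ] V →L[ℝ] V := mder EG (V →L[ℝ] V) ρ 1

lemma rep_comp_inv {G : Type*} [Group G] (ρ : G →* (V →L[ℝ] V)) (g : G) :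
    (ρ g).comp (ρ g⁻¹) = ContinuousLinearMap.id ℝ V := by
  have : ρ g * ρ g⁻¹ = 1 := by rw [← map_mul, mul_inv_cancel, map_one]
  exact this

lemma infRep_Ad {ρ : G →* (V →L[ℝ] V)} (hρ : ContMDiff 𝓘(ℝ, EG) 𝓘(ℝ, V →L[ℝ] V) ∞ ρ)
    (g : G) (X : EG) :
    infRep' EG ρ (Ad g X) = (ρ g).comp ((infRep' EG ρ X).comp (ρ g⁻¹)) := by
  let L : (V →L[ℝ] V) →L[ℝ] (V →L[ℝ] V) :=
    ((ContinuousLinearMap.compL ℝ V V V) (ρ g)).comp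
      ((ContinuousLinearMap.compL ℝ V V V).flip (ρ g⁻¹))
  have hc : ContMDiff 𝓘(ℝ, EG) 𝓘(ℝ, EG) ∞ (fun x : G => g * x * g⁻¹) :=
    (contMDiff_const.mul contMDiff_id).mul contMDiff_const
  have h1 : (fun x : G => ρ x) ∘ (fun x : G => g * x * g⁻¹) = L ∘ fun x : G => ρ x := by
    funext x
    simp only [Function.comp_apply, map_mul]
    rfl
  have h2 := mder_comp (E := EG) (E' := EG) (E'' := V →L[ℝ] V) (1 : G)
    ((hρ _).mdifferentiableAt (by simp)) ((hc 1).mdifferentiableAt (by simp))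
  have h3 := mder_comp (E := EG) (E' := V →L[ℝ] V) (E'' := V →L[ℝ] V) (g := L)
    (f := fun x : G => ρ x) (1 : G) L.differentiableAt.mdifferentiableAt
    ((hρ 1).mdifferentiableAt (by simp))
  have h4 := congrArg (fun T : EG →L[ℝ] V →L[ℝ] V => T X) (h2.symm.trans ((congrArg
    (fun f : G → (V →L[ℝ] V) => mder EG (V →L[ℝ] V) f 1) h1).trans h3))
  rw [mder_eq_fderiv, L.fderiv, mul_one, mul_inv_cancel] at h4
  exact h4

/-- A representation maps left invariant vector fields to left invariant vector fields. -/
lemma mder_rep_mulInvariant {ρ : G →* (V →L[ℝ] V)}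
    (hρ : ContMDiff 𝓘(ℝ, EG) 𝓘(ℝ, V →L[ℝ] V) ∞ ρ) (g : G) (X : EG) :
    mder EG (V →L[ℝ] V) ρ g
      (mulInvariantVectorField (I := 𝓘(ℝ, EG)) (G := G) X g) =
      (ρ g).comp (infRep' EG ρ X) := by
  let L : (V →L[ℝ] V) →L[ℝ] (V →L[ℝ] V) := (ContinuousLinearMap.compL ℝ V V V) (ρ g)
  have hc : ContMDiff 𝓘(ℝ, EG) 𝓘(ℝ, EG) ∞ (fun x : G => g * x) :=
    contMDiff_const.mul contMDiff_id
  have h1 : (fun x : G => ρ x) ∘ (fun x : G => g * x) = L ∘ fun x : G => ρ x := by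
    funext x
    simp only [Function.comp_apply, map_mul]
    rfl
  have h2 := mder_comp (E := EG) (E' := EG) (E'' := V →L[ℝ] V) (1 : G)
    ((hρ _).mdifferentiableAt (by simp)) ((hc 1).mdifferentiableAt (by simp))
  have h3 := mder_comp (E := EG) (E' := V →L[ℝ] V) (E'' := V →L[ℝ] V) (g := L)
    (f := fun x : G => ρ x) (1 : G) L.differentiableAt.mdifferentiableAt
    ((hρ 1).mdifferentiableAt (by simp))
  have h4 := congrArg (fun T : EG →L[ℝ] V →L[ℝ] V => T X) (h2.symm.trans ((congrArg
    (fun f : G → (V →L[ℝ] V) => mder EG (V →L[ℝ] V) f 1) h1).trans h3))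
  rw [mder_eq_fderiv, L.fderiv, mul_one] at h4
  exact h4

/-- The infinitesimal representation is a homomorphism of Lie algebras. -/
lemma infRep_lie [FiniteDimensional ℝ EG] {ρ : G →* (V →L[ℝ] V)}
    (hρ : ContMDiff 𝓘(ℝ, EG) 𝓘(ℝ, V →L[ℝ] V) ∞ ρ)
    (X Y : LieAlg EG G) :
    infRep' EG ρ (⁅X, Y⁆ : LieAlg EG G) =
      (infRep' EG ρ X).comp (infRep' EG ρ Y) - (infRep' EG ρ Y).comp (infRep' EG ρ X) := by
  have : IsManifold 𝓘(ℝ, EG) ∞ G := inferInstance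
  have hsm : ∀ Z : EG, DifferentiableAt ℝ
      (fieldRep (mulInvariantVectorField (I := 𝓘(ℝ, EG)) (G := G) Z) 1)
      (extChartAt 𝓘(ℝ, EG) (1 : G) 1) := fun Z => by
    refine SmoothField.differentiableAt_fieldRep (n := 2) ?_ (by simp) ?_ 1
    · exact (by norm_num : (2 : ℕ∞ω) + 1 = 3) ▸ ENat.LEInfty.out
    · exact (contMDiff_mulInvariantVectorField (I := 𝓘(ℝ, EG)) (G := G) Z).of_le le_minSmoothness
  have h := mder_mlieBracket (hsm X) (hsm Y) hρ
  have hone : ∀ Z : EG, (mulInvariantVectorField (I := 𝓘(ℝ, EG)) (G := G) Z 1 : EG) = Z := by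
    intro Z
    have : (fun x : G => 1 * x) = id := by funext x; simp
    change mder EG EG (fun x : G => 1 * x) 1 Z = Z
    rw [this, mder_id]; rfl
  have hd : ∀ Z W : EG, fderiv ℝ (fun y => mder EG (V →L[ℝ] V) ρ
      ((extChartAt 𝓘(ℝ, EG) (1 : G)).symm y)
      (mulInvariantVectorField (I := 𝓘(ℝ, EG)) (G := G) Z
        ((extChartAt 𝓘(ℝ, EG) (1 : G)).symm y))) (extChartAt 𝓘(ℝ, EG) (1 : G) 1) W =
      (infRep' EG ρ W).comp (infRep' EG ρ Z) := by
    intro Z W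
    let L : (V →L[ℝ] V) →L[ℝ] (V →L[ℝ] V) :=
      (ContinuousLinearMap.compL ℝ V V V).flip (infRep' EG ρ Z)
    have h1 : (fun y => mder EG (V →L[ℝ] V) ρ
      ((extChartAt 𝓘(ℝ, EG) (1 : G)).symm y)
      (mulInvariantVectorField (I := 𝓘(ℝ, EG)) (G := G) Z
        ((extChartAt 𝓘(ℝ, EG) (1 : G)).symm y))) =
        L ∘ (⇑ρ ∘ (extChartAt 𝓘(ℝ, EG) (1 : G)).symm) := by
      funext y
      exact mder_rep_mulInvariant hρ _ Z
    have hs := mdifferentiableAt_extChartAt_symm (1 : G) (mem_extChartAt_target (I := 𝓘(ℝ, EG)) 1)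
    have h2 := mder_comp (E := EG) (E' := EG) (E'' := V →L[ℝ] V)
      (g := ρ) (extChartAt 𝓘(ℝ, EG) (1 : G) 1)
      ((hρ _).mdifferentiableAt (by simp)) hs
    have h3 : DifferentiableAt ℝ (⇑ρ ∘ (extChartAt 𝓘(ℝ, EG) (1 : G)).symm)
        (extChartAt 𝓘(ℝ, EG) (1 : G) 1) :=
      (((hρ _).mdifferentiableAt (by simp)).comp _ hs).differentiableAt
    rw [mder_eq_fderiv, mder_extChartAt_symm_base, extChartAt_to_inv (I := 𝓘(ℝ, EG)) (1 : G)] at h2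
    rw [h1, fderiv_comp _ L.differentiableAt h3, L.fderiv, h2]
    rfl
  refine h.trans (congrArg₂ (· - ·) ((hd Y _).trans ?_) ((hd X _).trans ?_))
  · exact congrArg (fun Z => (infRep' EG ρ Z).comp _) (hone X)
  · exact congrArg (fun Z => (infRep' EG ρ Z).comp _) (hone Y)

/-- The derivative at `1` of `h ↦ ρ(f(h)⁻¹)`, for a homomorphism `f` of Lie groups. -/
lemma mder_rep_inv [CompleteSpace V] {ρ : G →* (V →L[ℝ] V)}
    (hρ : ContMDiff 𝓘(ℝ, EG) 𝓘(ℝ, V →L[ℝ] V) ∞ ρ)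
    {f : P →* G} (hf : ContMDiff 𝓘(ℝ, EP) 𝓘(ℝ, EG) ∞ f) (X : EP) :
    mder EP (V →L[ℝ] V) (fun h : P => ρ (f h⁻¹)) 1 X = -infRep' EG ρ (mder EP EG f 1 X) := by
  have h0 : (fun h : P => ρ (f h⁻¹)) = (Ring.inverse : (V →L[ℝ] V) → (V →L[ℝ] V)) ∘ (ρ ∘ f) := by
    funext h
    have h1 : ρ (f h) * ρ (f h)⁻¹ = 1 := by rw [← map_mul, mul_inv_cancel, map_one]
    have h2 : ρ (f h)⁻¹ * ρ (f h) = 1 := by rw [← map_mul, inv_mul_cancel, map_one]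
    rw [map_inv]
    exact (Ring.inverse_unit (⟨ρ (f h), ρ (f h)⁻¹, h1, h2⟩ : (V →L[ℝ] V)ˣ)).symm
  have hone : ρ (f 1) = 1 := by rw [map_one, map_one]
  have hi : HasFDerivAt (Ring.inverse : (V →L[ℝ] V) → (V →L[ℝ] V))
      (-ContinuousLinearMap.mulLeftRight ℝ (V →L[ℝ] V) 1 1) (ρ (f 1)) := by
    rw [hone]
    simpa using hasFDerivAt_ringInverse (𝕜 := ℝ) (1 : (V →L[ℝ] V)ˣ)
  have h2 := mder_comp (E := EP) (E' := V →L[ℝ] V) (E'' := V →L[ℝ] V) (g := Ring.inverse)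
    (f := ⇑ρ ∘ f) (1 : P) hi.differentiableAt.mdifferentiableAt
    (((hρ.comp hf) 1).mdifferentiableAt (by simp))
  have h3 := mder_comp (E := EP) (E' := EG) (E'' := V →L[ℝ] V) (g := ρ)
    (f := f) (1 : P) ((hρ _).mdifferentiableAt (by simp)) ((hf 1).mdifferentiableAt (by simp))
  rw [h0, h2, mder_eq_fderiv, Function.comp_apply, hi.fderiv, h3, map_one f]
  ext v
  simp [infRep']

end Representations

/-! ### Vanishing of alternating maps, and smooth dependence on parameters -/

section AlternatingBundles

open ContinuousAlternatingMap (alternatizeUncurryFin alternatizeUncurryFinCLM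
  alternatizeUncurryFin_apply curryLeft_apply_apply curryLeftLI compContinuousLinearMapCLM)

variable {E E' V V' : Type*}
  [NormedAddCommGroup E] [NormedSpace ℝ E] [NormedAddCommGroup E'] [NormedSpace ℝ E']
  [NormedAddCommGroup V] [NormedSpace ℝ V] [NormedAddCommGroup V'] [NormedSpace ℝ V']

/-- Composition of a linear map with the values of an alternating map, as a bilinear map. -/
def valL (E V : Type*) [NormedAddCommGroup E] [NormedSpace ℝ E] [NormedAddCommGroup V]
    [NormedSpace ℝ V] (k : ℕ) :
    (V →L[ℝ] V) →L[ℝ] (E [⋀^Fin k]→L[ℝ] V) →L[ℝ] (E [⋀^Fin k]→L[ℝ] V) :=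
  LinearMap.mkContinuous
    { toFun := fun A => valCLM (V := V) (V' := V) E k A
      map_add' := fun A B => by ext φ v; simp
      map_smul' := fun a A => by ext φ v; simp } 1
    fun A => ContinuousLinearMap.opNorm_le_bound _ (by positivity) fun φ => by
      rw [one_mul]
      exact ContinuousLinearMap.norm_compContinuousAlternatingMap_le A φ

/-- If `w` is annihilated by all values of `f`, then inserting `w` into the alternation of `f`
gives `f w`. -/
lemma curryLeft_alternatize_of_vanish {k : ℕ} (f : E →L[ℝ] E [⋀^Fin k]→L[ℝ] V) (w : E)
    (h : ∀ x (v : Fin k → E), (∃ i, v i = w) → f x v = 0) :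
    (alternatizeUncurryFin f).curryLeft w = f w := by
  ext v
  rw [curryLeft_apply_apply, alternatizeUncurryFin_apply, Fin.sum_univ_succ,
    Finset.sum_eq_zero, add_zero]
  · simp
  · intro i _
    rw [h, smul_zero]
    cases k with
    | zero => exact i.elim0
    | succ k =>
      refine ⟨0, ?_⟩
      simp [Fin.removeNth]

/-- An alternating map which vanishes if `w` is inserted into the first slot vanishes if `w` is
inserted into any slot. -/
lemma apply_eq_zero_of_curryLeft {k : ℕ} (A : E [⋀^Fin (k + 1)]→L[ℝ] V) {w : E}
    (h : A.curryLeft w = 0) (v : Fin (k + 1) → E) {i : Fin (k + 1)} (hi : v i = w) : A v = 0 := by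
  have h0 : ∀ v' : Fin (k + 1) → E, v' 0 = w → A v' = 0 := by
    intro v' hv'
    have h1 : v' = Matrix.vecCons w (Matrix.vecTail v') := by
      rw [← hv']; exact (Matrix.cons_head_tail v').symm
    rw [h1, ← curryLeft_apply_apply, h]; rfl
  rcases eq_or_ne i 0 with rfl | hi0
  · exact h0 v hi
  · have h2 := A.toAlternatingMap.map_swap v (i := 0) (j := i) hi0.symm
    have h3 : A (v ∘ Equiv.swap 0 i) = 0 := h0 _ (by simp [hi])
    have h4 : A (v ∘ Equiv.swap 0 i) = -A v := h2
    rw [h3] at h4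
    exact neg_eq_zero.1 h4.symm

lemma curryLeft_eq_zero {k : ℕ} {A : E [⋀^Fin (k + 1)]→L[ℝ] V} {w : E}
    (h : ∀ v : Fin (k + 1) → E, (∃ i, v i = w) → A v = 0) : A.curryLeft w = 0 := by
  ext v
  exact h _ ⟨0, rfl⟩

/-- Vectors which are annihilated by an alternating map may be added to its arguments. -/
lemma apply_add_of_vanish {k : ℕ} (A : E [⋀^Fin k]→L[ℝ] V) (v w : Fin k → E)
    (h : ∀ i (x : Fin k → E), x i = w i → A x = 0) : A (v + w) = A v := by
  have h1 : A (v + w) = ∑ s : Finset (Fin k), A (s.piecewise v w) :=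
    A.toAlternatingMap.toMultilinearMap.map_add_univ v w
  rw [h1, Finset.sum_eq_single Finset.univ, Finset.piecewise_univ]
  · intro s _ hs
    obtain ⟨i, hi⟩ : ∃ i, i ∉ s := by
      by_contra hc
      push Not at hc
      exact hs (Finset.eq_univ_iff_forall.2 hc)
    exact h i _ (by simp [hi])
  · intro hc
    exact absurd (Finset.mem_univ _) hc

end AlternatingBundles

section Smoothness

open ContinuousAlternatingMap (alternatizeUncurryFin alternatizeUncurryFinCLM curryLeftLI)

variable {D E V : Type*}
  [NormedAddCommGroup D] [NormedSpace ℝ D] [NormedAddCommGroup E] [NormedSpace ℝ E]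
  [NormedAddCommGroup V] [NormedSpace ℝ V] {s : Set D} {n : ℕ∞ω} {k : ℕ}

lemma contDiffOn_curryLeft {φ : D → E [⋀^Fin (k + 1)]→L[ℝ] V} {X : D → E}
    (hφ : ContDiffOn ℝ n φ s) (hX : ContDiffOn ℝ n X s) :
    ContDiffOn ℝ n (fun y => (φ y).curryLeft (X y)) s :=
  ((curryLeftLI (𝕜 := ℝ) (E := E) (F := V) (n := k)).toContinuousLinearMap.contDiff.comp_contDiffOn
    hφ).clm_apply hX

lemma contDiffOn_compCAM {φ : D → E [⋀^Fin k]→L[ℝ] V} {A : D → V →L[ℝ] V}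
    (hA : ContDiffOn ℝ n A s) (hφ : ContDiffOn ℝ n φ s) :
    ContDiffOn ℝ n (fun y => (A y).compContinuousAlternatingMap (φ y)) s :=
  ((valL E V k).contDiff.comp_contDiffOn hA).clm_apply hφ

lemma contDiffOn_wedge_one {φ : D → E [⋀^Fin k]→L[ℝ] V} {β : D → E [⋀^Fin 1]→L[ℝ] ℝ}
    (hφ : ContDiffOn ℝ n φ s) (hβ : ContDiffOn ℝ n β s) :
    ContDiffOn ℝ n (fun y => wedge (φ y) 1 (β y)) s := by
  have h1 : ContDiffOn ℝ n (fun y => ContinuousLinearMap.smulRightL ℝ E (E [⋀^Fin k]→L[ℝ] V)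
      (toLin E (β y))) s :=
    (ContinuousLinearMap.smulRightL ℝ E (E [⋀^Fin k]→L[ℝ] V)).contDiff.comp_contDiffOn
      ((toLin E).contDiff.comp_contDiffOn hβ)
  refine ((alternatizeUncurryFinCLM ℝ E V).contDiff.comp_contDiffOn (h1.clm_apply hφ)).congr ?_
  intro y _
  exact wedge_one _ _

/-- At a point, `v ↦ A(ω(v)) ∘ φ` for alternating `φ`. -/
def actCLM {L : Type*} [NormedAddCommGroup L] [NormedSpace ℝ L] (A : L →L[ℝ] V →L[ℝ] V)
    (ω' : E →L[ℝ] L) (φ : E [⋀^Fin k]→L[ℝ] V) : E →L[ℝ] E [⋀^Fin k]→L[ℝ] V :=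
  ((valL E V k).flip φ).comp (A.comp ω')

lemma contDiffOn_actCLM {L : Type*} [NormedAddCommGroup L] [NormedSpace ℝ L]
    (A : L →L[ℝ] V →L[ℝ] V) {φ : D → E [⋀^Fin k]→L[ℝ] V} {ω' : D → E →L[ℝ] L}
    (hω : ContDiffOn ℝ n ω' s) (hφ : ContDiffOn ℝ n φ s) :
    ContDiffOn ℝ n (fun y => actCLM A (ω' y) (φ y)) s :=
  ((valL E V k).flip.contDiff.comp_contDiffOn hφ).clm_comp (contDiffOn_const.clm_comp hω)

end Smoothness

/-! ### The covariant exterior derivative of tractor-valued forms -/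

lemma infRep_Ad_comp {EG G V : Type*} [NormedAddCommGroup EG] [NormedSpace ℝ EG]
    [TopologicalSpace G] [ChartedSpace EG G] [Group G] [LieGroup 𝓘(ℝ, EG) ∞ G]
    [NormedAddCommGroup V] [NormedSpace ℝ V] {ρ : G →* (V →L[ℝ] V)}
    (hρ : ContMDiff 𝓘(ℝ, EG) 𝓘(ℝ, V →L[ℝ] V) ∞ ρ) (g : G) (X : EG) :
    (infRep' EG ρ (Ad g X)).comp (ρ g) = (ρ g).comp (infRep' EG ρ X) := by
  rw [infRep_Ad hρ g X]
  have h2 : (ρ g⁻¹).comp (ρ g) = ContinuousLinearMap.id ℝ V := by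
    have := rep_comp_inv ρ g⁻¹
    rwa [inv_inv] at this
  rw [ContinuousLinearMap.comp_assoc, ContinuousLinearMap.comp_assoc, h2,
    ContinuousLinearMap.comp_id]

lemma chartRep_add_apply {E Q V : Type*} [NormedAddCommGroup E] [NormedSpace ℝ E]
    [TopologicalSpace Q] [ChartedSpace E Q] [NormedAddCommGroup V] [NormedSpace ℝ V] {k : ℕ}
    (φ ψ : Form E Q V k) (u : Q) (y : E) :
    chartRep (fun u' => φ u' + ψ u') u y = chartRep φ u y + chartRep ψ u y := rfl

section CartanConnection

open Filter Topology
open ContinuousAlternatingMap (alternatizeUncurryFin alternatizeUncurryFinCLM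
  alternatizeUncurryFin_apply curryLeft_apply_apply curryLeftLI compContinuousLinearMapCLM)

namespace CartanGeometry

variable {EG G EP P EQ EM V : Type*}
  [NormedAddCommGroup EG] [NormedSpace ℝ EG] [FiniteDimensional ℝ EG]
  [TopologicalSpace G] [ChartedSpace EG G] [Group G] [LieGroup 𝓘(ℝ, EG) ∞ G]
  [NormedAddCommGroup EP] [NormedSpace ℝ EP]
  [TopologicalSpace P] [ChartedSpace EP P] [Group P]
  [NormedAddCommGroup EQ] [NormedSpace ℝ EQ] [FiniteDimensional ℝ EQ]
  [NormedAddCommGroup EM] [NormedSpace ℝ EM]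
  [NormedAddCommGroup V] [NormedSpace ℝ V]
  {c : ContactGrading (LieAlg EG G)} {S : ParabolicSubgroup c EP P} {Q M : Type*}
  [TopologicalSpace Q] [ChartedSpace EQ Q] [IsManifold 𝓘(ℝ, EQ) ∞ Q]
  [TopologicalSpace M] [ChartedSpace EM M]
  (C : CartanGeometry S EQ Q EM M)

/-- The Cartan connection, as an isomorphism between the model spaces of `Q` and `G`. -/
def connE (u : Q) : EQ ≃L[ℝ] EG := C.conn u

/-- The constant vector field `ω⁻¹(X)`, as a function with values in the model space. -/
def constFieldE (X : EG) (u : Q) : EQ := (C.connE u).symm X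

/-- The derivative at `u` of the right translation by `h`. -/
def actDeriv (h : P) (u : Q) : EQ →L[ℝ] EQ := mder EQ EQ (fun u' => C.act u' h) u

lemma smoothField_const (X : EG) : SmoothField ∞ (C.constFieldE X) := C.contMDiff_const X

/-- The coordinate expression of the Cartan connection in the preferred chart at `u`. -/
def connRep (u : Q) (y : EQ) : EQ →L[ℝ] EG :=
  ((C.connE ((extChartAt 𝓘(ℝ, EQ) u).symm y)).toContinuousLinearMap).comp
    (mder EQ EQ (extChartAt 𝓘(ℝ, EQ) u).symm y)

lemma contDiffOn_connRep (u : Q) :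
    ContDiffOn ℝ ∞ (C.connRep u) (extChartAt 𝓘(ℝ, EQ) u).target := by
  have : CompleteSpace EQ := FiniteDimensional.complete ℝ EQ
  have : CompleteSpace EG := FiniteDimensional.complete ℝ EG
  let N : EQ → EG →L[ℝ] EQ := fun y =>
    (mder EQ EQ (extChartAt 𝓘(ℝ, EQ) u).symm y).inverse.comp
      (C.connE ((extChartAt 𝓘(ℝ, EQ) u).symm y)).symm.toContinuousLinearMap
  have hN : ContDiffOn ℝ ∞ N (extChartAt 𝓘(ℝ, EQ) u).target :=
    contDiffOn_clm_apply.2 fun X => (C.smoothField_const X).contDiffOn_fieldRep (by simp) u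
  intro y hy
  obtain ⟨L, hL⟩ := isInvertible_mder_symm (E := EQ) u hy
  let T : EG ≃L[ℝ] EQ := (C.connE ((extChartAt 𝓘(ℝ, EQ) u).symm y)).symm.trans L.symm
  have hNT : ∀ z ∈ (extChartAt 𝓘(ℝ, EQ) u).target, C.connRep u z = (N z).inverse := by
    intro z hz
    obtain ⟨L, hL⟩ := isInvertible_mder_symm (E := EQ) u hz
    have : N z = ((C.connE ((extChartAt 𝓘(ℝ, EQ) u).symm z)).symm.trans L.symm :
        EG ≃L[ℝ] EQ).toContinuousLinearMap := by
      ext X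
      change (mder EQ EQ (extChartAt 𝓘(ℝ, EQ) u).symm z).inverse _ = _
      rw [← hL, ContinuousLinearMap.inverse_equiv]
      rfl
    rw [this, ContinuousLinearMap.inverse_equiv, connRep, ← hL]
    rfl
  have hT : N y = T.toContinuousLinearMap := by
    ext X
    change (mder EQ EQ (extChartAt 𝓘(ℝ, EQ) u).symm y).inverse _ = _
    rw [← hL, ContinuousLinearMap.inverse_equiv]
    rfl
  have h1 : ContDiffWithinAt ℝ ∞ (fun z => (N z).inverse) (extChartAt 𝓘(ℝ, EQ) u).target y := by
    have h0 : ContDiffAt ℝ ∞ (ContinuousLinearMap.inverse : (EG →L[ℝ] EQ) → EQ →L[ℝ] EG) (N y) := by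
      rw [hT]
      exact contDiffAt_map_inverse T
    exact h0.comp_contDiffWithinAt y (hN y hy)
  exact h1.congr hNT (hNT y hy)

lemma contMDiff_act_right (h : P) : ContMDiff 𝓘(ℝ, EQ) 𝓘(ℝ, EQ) ∞ (fun u => C.act u h) :=
  C.contMDiff_act.comp (contMDiff_id.prodMk _root_.contMDiff_const)

lemma connE_actDeriv (u : Q) (h : P) (v : EQ) :
    C.connE (C.act u h) (C.actDeriv h u v) = Ad (S.incl h⁻¹) (C.connE u v) :=
  C.conn_act u h v

section Forms

variable {ρ : G →* (V →L[ℝ] V)} {k : ℕ}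

lemma connAct_eq (φ : Form EQ Q V k) (u : Q) :
    C.connAct ρ φ u = actCLM (infRep' EG ρ) (C.connE u).toContinuousLinearMap (φ u) := rfl

/-- The coordinate expression of the covariant exterior derivative. -/
lemma chartRep_covD {φ : Form EQ Q V k} (hφ : IsSmoothForm φ) (u : Q) {y : EQ}
    (hy : y ∈ (extChartAt 𝓘(ℝ, EQ) u).target) :
    chartRep (C.covD ρ φ) u y = extDeriv (chartRep φ u) y +
      alternatizeUncurryFin (actCLM (infRep' EG ρ) (C.connRep u y) (chartRep φ u y)) := by
  rw [← chartRep_extD hφ u hy]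
  refine (chartRep_add_apply (extD φ)
    (fun u' => alternatizeUncurryFin (C.connAct ρ φ u')) u y).trans ?_
  congr 1
  exact alternatize_compContinuousLinearMap _ _

lemma isSmoothForm_covD {φ : Form EQ Q V k} (hφ : IsSmoothForm φ) :
    IsSmoothForm (C.covD ρ φ) := by
  intro u
  refine ContDiffOn.congr (f := fun y => chartRep (extD φ) u y +
    alternatizeUncurryFin (actCLM (infRep' EG ρ) (C.connRep u y) (chartRep φ u y))) ?_
    (fun y hy => ?_)
  · exact (hφ.extD u).add ((alternatizeUncurryFinCLM ℝ EQ V).contDiff.comp_contDiffOn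
      (contDiffOn_actCLM _ (C.contDiffOn_connRep u) (hφ u)))
  · rw [C.chartRep_covD hφ u hy, chartRep_extD hφ u hy]

lemma covD_equivariant (hρ : ContMDiff 𝓘(ℝ, EG) 𝓘(ℝ, V →L[ℝ] V) ∞ ρ) {φ : Form EQ Q V k}
    (hφ : φ ∈ C.bundleForms ρ k) (u : Q) (h : P) :
    (C.covD ρ φ (C.act u h)).compContinuousLinearMap (C.actDeriv h u) =
      (ρ (S.incl h⁻¹)).compContinuousAlternatingMap (C.covD ρ φ u) := by
  obtain ⟨hs, he, -⟩ := hφ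
  have he' : ∀ u, (φ (C.act u h)).compContinuousLinearMap (C.actDeriv h u) =
      (ρ (S.incl h⁻¹)).compContinuousAlternatingMap (φ u) := fun u => he u h
  set e := extChartAt 𝓘(ℝ, EQ) u with hedef
  have hbase : e.symm (e u) = u := extChartAt_to_inv (I := 𝓘(ℝ, EQ)) u
  let f : EQ → Q := (fun u' => C.act u' h) ∘ e.symm
  have hf : ∀ y ∈ e.target, mder EQ EQ f y = (C.actDeriv h (e.symm y)).comp (mder EQ EQ e.symm y) :=
    fun y hy => mder_comp y ((C.contMDiff_act_right h _).mdifferentiableAt (by simp))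
      (mdifferentiableAt_extChartAt_symm u hy)
  have h1 := extDeriv_pullbackForm hs (f := f) (x := e u)
    ((C.contMDiff_act_right h _).comp _ (contMDiffAt_extChartAt_symm u (mem_extChartAt_target u)))
  have h2 : (fun y => (φ (f y)).compContinuousLinearMap (mder EQ EQ f y)) =ᶠ[𝓝 (e u)]
      valCLM EQ k (ρ (S.incl h⁻¹)) ∘ chartRep φ u := by
    filter_upwards [extChartAt_target_mem_nhds (I := 𝓘(ℝ, EQ)) u] with y hy
    rw [hf y hy]
    exact congrArg (fun A : EQ [⋀^Fin k]→L[ℝ] V => A.compContinuousLinearMap (mder EQ EQ e.symm y))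
      (he' (e.symm y))
  have h3 : extDeriv (valCLM EQ k (ρ (S.incl h⁻¹)) ∘ chartRep φ u) (e u) =
      (ρ (S.incl h⁻¹)).compContinuousAlternatingMap (extD φ u) := by
    rw [extDeriv, fderiv_comp _ (ContinuousLinearMap.differentiableAt _) (hs.differentiableAt u),
      ContinuousLinearMap.fderiv, extD_eq_extDeriv, extDeriv, comp_alternatize]
  have h4 : f (e u) = C.act u h := congrArg (fun u' => C.act u' h) hbase
  have h5 : mder EQ EQ f (e u) = C.actDeriv h u := by
    rw [hf _ (mem_extChartAt_target u), mder_extChartAt_symm_base, hbase]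
    rfl
  rw [h2.extDeriv_eq, h3, h4, h5] at h1
  have h6 : (alternatizeUncurryFin (C.connAct ρ φ (C.act u h))).compContinuousLinearMap
      (C.actDeriv h u) = (ρ (S.incl h⁻¹)).compContinuousAlternatingMap
        (alternatizeUncurryFin (C.connAct ρ φ u)) := by
    rw [alternatize_compContinuousLinearMap, comp_alternatize]
    congr 1
    ext1 v
    have h7 : ((infRep' EG ρ (C.connE (C.act u h) (C.actDeriv h u v))).compContinuousAlternatingMap
        (φ (C.act u h))).compContinuousLinearMap (C.actDeriv h u) =
        (infRep' EG ρ (C.connE (C.act u h) (C.actDeriv h u v))).compContinuousAlternatingMap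
        ((φ (C.act u h)).compContinuousLinearMap (C.actDeriv h u)) := rfl
    refine h7.trans ?_
    rw [he' u, connE_actDeriv]
    ext x
    exact DFunLike.congr_fun (infRep_Ad_comp hρ (S.incl h⁻¹) (C.connE u v)) (φ u x)
  ext v
  have a1 := DFunLike.congr_fun h1 v
  have a2 := DFunLike.congr_fun h6 v
  exact (congrArg₂ (· + ·) a1.symm a2).trans (map_add (ρ (S.incl h⁻¹)) _ _).symm

end Forms

section Horizontal

variable [LieGroup 𝓘(ℝ, EP) ∞ P] {ρ : G →* (V →L[ℝ] V)} {k : ℕ}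

/-- The derivative at `h` of the orbit map `P → Q`, `h ↦ u · h`, takes values in vertical
vectors. -/
lemma connE_mder_orbit (u : Q) (h : P) (b : EP) :
    (C.connE (C.act u h) (mder EP EQ (fun h' => C.act u h') h b) : LieAlg EG G) ∈ c.filt 0 := by
  have hact : ∀ u : Q, ContMDiff 𝓘(ℝ, EP) 𝓘(ℝ, EQ) ∞ (fun h' => C.act u h') := fun u =>
    C.contMDiff_act.comp (_root_.contMDiff_const.prodMk contMDiff_id)
  have hmul : ContMDiff 𝓘(ℝ, EP) 𝓘(ℝ, EP) ∞ (fun h' : P => h⁻¹ * h') :=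
    _root_.contMDiff_const.mul contMDiff_id
  have h1 : (fun h' => C.act u h') =
      (fun h' => C.act (C.act u h) h') ∘ (fun h' : P => h⁻¹ * h') := by
    funext h'
    rw [Function.comp_apply, ← C.act_mul, mul_inv_cancel_left]
  have h2 := mder_comp (E := EP) (E' := EP) (E'' := EQ) (g := fun h' => C.act (C.act u h) h') h
    ((hact _ _).mdifferentiableAt (by simp)) ((hmul h).mdifferentiableAt (by simp))
  rw [← h1, inv_mul_cancel] at h2
  have h3 := C.conn_fundamental (C.act u h) (mder EP EP (fun h' : P => h⁻¹ * h') h b)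
  have h4 : C.connE (C.act (C.act u h) 1) (mder EP EQ (fun h' => C.act (C.act u h) h') 1
      (mder EP EP (fun h' : P => h⁻¹ * h') h b)) =
      derivOne S.incl (mder EP EP (fun h' : P => h⁻¹ * h') h b) := h3
  rw [C.act_one] at h4
  rw [h2, ContinuousLinearMap.comp_apply, h4, ← S.range_derivOne]
  exact ⟨_, rfl⟩

/-- Inserting the generator of a right translation into the exterior derivative of a horizontal and
equivariant form gives the infinitesimal form of equivariancy. -/
lemma curryLeft_extD_vertical [FiniteDimensional ℝ V]
    (hρ : ContMDiff 𝓘(ℝ, EG) 𝓘(ℝ, V →L[ℝ] V) ∞ ρ) {φ : Form EQ Q V k}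
    (hφ : φ ∈ C.bundleForms ρ k) (u : Q) (X : EP) :
    (extD φ u).curryLeft (mder EP EQ (fun h => C.act u h) 1 X) =
      -(infRep' EG ρ (mder EP EG S.incl 1 X)).compContinuousAlternatingMap (φ u) := by
  have : CompleteSpace V := FiniteDimensional.complete ℝ V
  obtain ⟨hs, he, hz⟩ := hφ
  have he' : ∀ u h, (φ (C.act u h)).compContinuousLinearMap (C.actDeriv h u) =
      (ρ (S.incl h⁻¹)).compContinuousAlternatingMap (φ u) := he
  have hz' : ∀ (u : Q) (v : Fin k → EQ) (i : Fin k),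
      (C.connE u (v i) : LieAlg EG G) ∈ c.filt 0 → φ u v = 0 := fun u v i hi => hz u v ⟨i, hi⟩
  set e := extChartAt 𝓘(ℝ, EQ) u with hedef
  set eP := extChartAt 𝓘(ℝ, EP) (1 : P) with heP
  have hbase : e.symm (e u) = u := extChartAt_to_inv (I := 𝓘(ℝ, EQ)) u
  have hbaseP : eP.symm (eP 1) = 1 := extChartAt_to_inv (I := 𝓘(ℝ, EP)) (1 : P)
  let f : EQ × EP → Q := fun p => C.act (e.symm p.1) (eP.symm p.2)
  have hact : ∀ u : Q, ContMDiff 𝓘(ℝ, EP) 𝓘(ℝ, EQ) ∞ (fun h' => C.act u h') := fun u =>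
    C.contMDiff_act.comp (_root_.contMDiff_const.prodMk contMDiff_id)
  have hfs : ∀ y ∈ e.target, ∀ z ∈ eP.target,
      ContMDiffAt 𝓘(ℝ, EQ × EP) 𝓘(ℝ, EQ) ∞ f (y, z) := by
    intro y hy z hz
    have h1 : ContMDiffAt 𝓘(ℝ, EQ × EP) 𝓘(ℝ, EQ) ∞ (fun p : EQ × EP => e.symm p.1) (y, z) :=
      (contMDiffAt_extChartAt_symm u hy).comp (y, z)
        (contDiff_fst.contMDiff (n := ∞) (f := (Prod.fst : EQ × EP → EQ)) (y, z))
    have h2 : ContMDiffAt 𝓘(ℝ, EQ × EP) 𝓘(ℝ, EP) ∞ (fun p : EQ × EP => eP.symm p.2) (y, z) :=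
      (contMDiffAt_extChartAt_symm (1 : P) hz).comp (y, z)
        (contDiff_snd.contMDiff (n := ∞) (f := (Prod.snd : EQ × EP → EP)) (y, z))
    exact (C.contMDiff_act _).comp (y, z) (h1.prodMk h2)
  -- the partial derivatives of `f`
  have hf1 : ∀ y ∈ e.target, ∀ z ∈ eP.target, ∀ a : EQ, mder (EQ × EP) EQ f (y, z) (a, 0) =
      C.actDeriv (eP.symm z) (e.symm y) (mder EQ EQ e.symm y a) := by
    intro y hy z hz a
    have h1 := mder_comp (E := EQ) (E' := EQ × EP) (E'' := EQ) (g := f)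
      (f := fun y' : EQ => (y', z)) y ((hfs y hy z hz).mdifferentiableAt (by simp))
      (differentiableAt_id.prodMk (differentiableAt_const z)).mdifferentiableAt
    have h2 := mder_comp (E := EQ) (E' := EQ) (E'' := EQ) (g := fun u' => C.act u' (eP.symm z))
      (f := e.symm) y ((C.contMDiff_act_right _ _).mdifferentiableAt (by simp))
      (mdifferentiableAt_extChartAt_symm u hy)
    have h3 : mder EQ (EQ × EP) (fun y' : EQ => (y', z)) y a = (a, 0) := by
      rw [mder_eq_fderiv, (hasFDerivAt_prodMk_left y z).fderiv]
      rfl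
    have h4 := congrArg (fun T : EQ →L[ℝ] EQ => T a) (h1.symm.trans h2)
    refine (congrArg _ h3.symm).trans h4
  have hf2 : ∀ y ∈ e.target, ∀ z ∈ eP.target, ∀ b : EP, mder (EQ × EP) EQ f (y, z) (0, b) =
      mder EP EQ (fun h => C.act (e.symm y) h) (eP.symm z) (mder EP EP eP.symm z b) := by
    intro y hy z hz b
    have h1 := mder_comp (E := EP) (E' := EQ × EP) (E'' := EQ) (g := f)
      (f := fun z' : EP => (y, z')) z ((hfs y hy z hz).mdifferentiableAt (by simp))
      ((differentiableAt_const y).prodMk differentiableAt_id).mdifferentiableAt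
    have h2 := mder_comp (E := EP) (E' := EP) (E'' := EQ) (g := fun h => C.act (e.symm y) h)
      (f := eP.symm) z ((hact _ _).mdifferentiableAt (by simp))
      (mdifferentiableAt_extChartAt_symm (1 : P) hz)
    have h3 : mder EP (EQ × EP) (fun z' : EP => (y, z')) z b = (0, b) := by
      rw [mder_eq_fderiv, (hasFDerivAt_prodMk_right y z).fderiv]
      rfl
    have h4 := congrArg (fun T : EP →L[ℝ] EQ => T b) (h1.symm.trans h2)
    refine (congrArg _ h3.symm).trans h4
  -- by equivariancy and horizontality, the pullback of `φ` along `f` is `ρ(h⁻¹) φ`, where `h` is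
  -- the second coordinate
  let D : EQ × EP → EQ [⋀^Fin k]→L[ℝ] V := fun p =>
    valL EQ V k (ρ (S.incl (eP.symm p.2)⁻¹)) (chartRep φ u p.1)
  let R := compContinuousLinearMapCLM (ι := Fin k) (F := V) (ContinuousLinearMap.fst ℝ EQ EP)
  have hpull :
      (fun p => (φ (f p)).compContinuousLinearMap (mder (EQ × EP) EQ f p)) =ᶠ[𝓝 (e u, eP 1)]
        R ∘ D := by
    filter_upwards [prod_mem_nhds (extChartAt_target_mem_nhds (I := 𝓘(ℝ, EQ)) u)
      (extChartAt_target_mem_nhds (I := 𝓘(ℝ, EP)) (1 : P))] with p hp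
    obtain ⟨y, z⟩ := p
    obtain ⟨hy, hz0⟩ := hp
    ext v
    change φ (f (y, z)) (fun i => mder (EQ × EP) EQ f (y, z) (v i)) =
      ρ (S.incl (eP.symm z)⁻¹) (φ (e.symm y) (fun i => mder EQ EQ e.symm y (v i).1))
    have h1 : (fun i => mder (EQ × EP) EQ f (y, z) (v i)) =
        (fun i => C.actDeriv (eP.symm z) (e.symm y) (mder EQ EQ e.symm y (v i).1)) +
        (fun i => mder EP EQ (fun h => C.act (e.symm y) h) (eP.symm z)
          (mder EP EP eP.symm z (v i).2)) := by
      funext i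
      rw [Pi.add_apply, ← hf1 y hy z hz0, ← hf2 y hy z hz0, ← map_add, Prod.mk_add_mk, add_zero,
        zero_add]
    rw [h1, apply_add_of_vanish]
    · exact DFunLike.congr_fun (he' (e.symm y) (eP.symm z)) _
    · intro i x hx
      refine hz' _ x i ?_
      rw [hx]
      exact C.connE_mder_orbit _ _ _
  have hr : DifferentiableAt ℝ (fun z : EP => ρ (S.incl (eP.symm z)⁻¹)) (eP 1) ∧
      ∀ X, fderiv ℝ (fun z : EP => ρ (S.incl (eP.symm z)⁻¹)) (eP 1) X =
        -infRep' EG ρ (mder EP EG S.incl 1 X) := by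
    have hc : ContMDiff 𝓘(ℝ, EP) 𝓘(ℝ, V →L[ℝ] V) ∞ (fun h : P => ρ (S.incl h⁻¹)) :=
      hρ.comp (S.contMDiff_incl.comp (contMDiff_inv 𝓘(ℝ, EP) ∞))
    have hs := mdifferentiableAt_extChartAt_symm (1 : P) (mem_extChartAt_target (I := 𝓘(ℝ, EP)) 1)
    have h2 := mder_comp (E := EP) (E' := EP) (E'' := V →L[ℝ] V)
      (g := fun h : P => ρ (S.incl h⁻¹)) (eP 1)
      ((hc _).mdifferentiableAt (by simp)) hs
    refine ⟨(((hc _).mdifferentiableAt (by simp)).comp _ hs).differentiableAt, fun X => ?_⟩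
    rw [mder_eq_fderiv, mder_extChartAt_symm_base, hbaseP] at h2
    exact (congrArg (fun T : EP →L[ℝ] V →L[ℝ] V => T X) h2).trans
      (mder_rep_inv hρ S.contMDiff_incl X)
  have hD : DifferentiableAt ℝ D (e u, eP 1) ∧ fderiv ℝ D (e u, eP 1) (0, X) =
      -(infRep' EG ρ (mder EP EG S.incl 1 X)).compContinuousAlternatingMap (φ u) := by
    have d1 : DifferentiableAt ℝ (fun p : EQ × EP => valL EQ V k (ρ (S.incl (eP.symm p.2)⁻¹)))
        (e u, eP 1) :=
      (valL EQ V k).differentiableAt.comp (e u, eP 1)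
        (DifferentiableAt.comp (g := fun z : EP => ρ (S.incl (eP.symm z)⁻¹)) (e u, eP 1) hr.1
          differentiableAt_snd)
    have d2 : DifferentiableAt ℝ (fun p : EQ × EP => chartRep φ u p.1) (e u, eP 1) :=
      DifferentiableAt.comp (g := chartRep φ u) (e u, eP 1) (hs.differentiableAt u)
        differentiableAt_fst
    have d3 : DifferentiableAt ℝ D (e u, eP 1) := d1.clm_apply d2
    refine ⟨d3, ?_⟩
    have h1 : fderiv ℝ D (e u, eP 1) (0, X) = fderiv ℝ (fun z => D (e u, z)) (eP 1) X := by
      have := fderiv_comp (eP 1) d3 (hasFDerivAt_prodMk_right (e u) (eP 1)).differentiableAt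
      have h2 : (fun z => D (e u, z)) = D ∘ fun z => (e u, z) := rfl
      rw [h2, this, (hasFDerivAt_prodMk_right (e u) (eP 1)).fderiv]
      rfl
    have h2 : (fun z => D (e u, z)) =
        (valL EQ V k).flip (φ u) ∘ fun z : EP => ρ (S.incl (eP.symm z)⁻¹) := by
      funext z
      change valL EQ V k (ρ (S.incl (eP.symm z)⁻¹)) (chartRep φ u (e u)) = _
      rw [chartRep_base]
      rfl
    rw [h1, h2, fderiv_comp _ (ContinuousLinearMap.differentiableAt _) hr.1,
      ContinuousLinearMap.fderiv, ContinuousLinearMap.comp_apply, hr.2, map_neg]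
    rfl
  have key := extDeriv_pullbackForm hs (hfs (e u) (mem_extChartAt_target u) (eP 1)
    (mem_extChartAt_target 1))
  rw [hpull.extDeriv_eq, extDeriv, fderiv_comp _ R.differentiableAt hD.1, R.fderiv] at key
  have hfu : f (e u, eP 1) = u := by
    change C.act (e.symm (e u)) (eP.symm (eP 1)) = u
    rw [hbase, hbaseP, C.act_one]
  have h5 : ∀ a : EQ, mder (EQ × EP) EQ f (e u, eP 1) (a, 0) = a := by
    intro a
    rw [hf1 _ (mem_extChartAt_target u) _ (mem_extChartAt_target 1), mder_extChartAt_symm_base,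
      hbase, hbaseP]
    have : (fun u' => C.act u' (1 : P)) = id := by funext u'; exact C.act_one u'
    rw [actDeriv, this, mder_id]
    rfl
  have h6 : mder (EQ × EP) EQ f (e u, eP 1) (0, X) = mder EP EQ (fun h => C.act u h) 1 X := by
    rw [hf2 _ (mem_extChartAt_target u) _ (mem_extChartAt_target 1), mder_extChartAt_symm_base,
      hbase, hbaseP]
    rfl
  -- the values of `R` vanish upon insertion of `(0, X)`, so that only one term survives in the
  -- exterior derivative
  have h7 := curryLeft_alternatize_of_vanish (R.comp (fderiv ℝ D (e u, eP 1))) (0, X) (by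
    rintro x v ⟨i, hi⟩
    exact ContinuousAlternatingMap.map_coord_zero (fderiv ℝ D (e u, eP 1) x) i
      (congrArg Prod.fst hi))
  rw [key, hfu] at h7
  ext v
  have h8 := DFunLike.congr_fun h7 (fun i => (v i, (0 : EP)))
  have h9 : (R.comp (fderiv ℝ D (e u, eP 1)) (0, X)) (fun i => (v i, (0 : EP))) =
      fderiv ℝ D (e u, eP 1) (0, X) v := rfl
  rw [h9, hD.2] at h8
  refine Eq.trans ?_ h8
  rw [curryLeft_apply_apply, curryLeft_apply_apply]
  change _ = extD φ u (mder (EQ × EP) EQ f (e u, eP 1) ∘ _)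
  congr 1
  funext i
  refine Fin.cases ?_ (fun j => ?_) i
  · exact h6.symm
  · exact (h5 (v j)).symm

/-- The covariant exterior derivative preserves forms with values in a tractor bundle. -/
theorem covD_mem_bundleForms [FiniteDimensional ℝ V]
    (hρ : ContMDiff 𝓘(ℝ, EG) 𝓘(ℝ, V →L[ℝ] V) ∞ ρ) {φ : Form EQ Q V k}
    (hφ : φ ∈ C.bundleForms ρ k) : C.covD ρ φ ∈ C.bundleForms ρ (k + 1) := by
  refine ⟨C.isSmoothForm_covD hφ.1, C.covD_equivariant hρ hφ, ?_⟩
  rintro u v ⟨i, hi⟩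
  refine apply_eq_zero_of_curryLeft _ ?_ v (i := i) rfl
  have hmem : (C.connE u (v i) : LieAlg EG G) ∈ c.filt 0 := hi
  rw [← S.range_derivOne] at hi
  obtain ⟨X, hX⟩ := hi
  have hX' : mder EP EG S.incl 1 X = C.connE u (v i) := hX
  have h1 : C.connE (C.act u 1) (mder EP EQ (fun h => C.act u h) 1 X) = mder EP EG S.incl 1 X :=
    C.conn_fundamental u X
  rw [C.act_one, hX'] at h1
  have h2 := C.curryLeft_extD_vertical hρ hφ u X
  rw [(C.connE u).injective h1, hX'] at h2
  have h3 := curryLeft_alternatize_of_vanish (C.connAct ρ φ u) (v i) (by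
    rintro x w ⟨j, hj⟩
    have : φ u w = 0 := hφ.2.2 u w ⟨j, by rw [hj]; exact hmem⟩
    change infRep' EG ρ (C.connE u x) (φ u w) = 0
    rw [this, map_zero])
  have h4 : (C.covD ρ φ u).curryLeft (v i) = (extD φ u).curryLeft (v i) +
    (alternatizeUncurryFin (C.connAct ρ φ u)).curryLeft (v i) := rfl
  rw [h4, h2, h3]
  exact neg_add_cancel _

end Horizontal

end CartanGeometry

end CartanConnection

/-! ### Insertion, `Ξ_*` and wedge products on tractor-valued forms -/

section Derivatives

open ContinuousAlternatingMap (alternatizeUncurryFin alternatizeUncurryFinCLM curryLeftLI)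

variable {D E V : Type*}
  [NormedAddCommGroup D] [NormedSpace ℝ D] [NormedAddCommGroup E] [NormedSpace ℝ E]
  [NormedAddCommGroup V] [NormedSpace ℝ V] {k : ℕ} {x : D}

lemma hasFDerivAt_wedge_one {φ : D → E [⋀^Fin k]→L[ℝ] V} {β : D → E [⋀^Fin 1]→L[ℝ] ℝ}
    {φ' : D →L[ℝ] E [⋀^Fin k]→L[ℝ] V} {β' : D →L[ℝ] E [⋀^Fin 1]→L[ℝ] ℝ}
    (hφ : HasFDerivAt φ φ' x) (hβ : HasFDerivAt β β' x) :
    HasFDerivAt (fun y => wedge (φ y) 1 (β y))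
      ((wedgeOne V k (β x)).comp φ' + (wedge (φ x) 1).comp β') x := by
  let B := (ContinuousLinearMap.smulRightL ℝ E (E [⋀^Fin k]→L[ℝ] V)).comp (toLin E)
  have h1 : HasFDerivAt (fun y => B (β y)) (B.comp β') x := B.hasFDerivAt.comp x hβ
  have h2 := (alternatizeUncurryFinCLM ℝ E V (n := k)).hasFDerivAt.comp x (h1.clm_apply hφ)
  have h3 : (fun y => wedge (φ y) 1 (β y)) =
      (alternatizeUncurryFinCLM ℝ E V (n := k)) ∘ fun y => B (β y) (φ y) :=
    funext fun y => wedge_one _ _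
  rw [h3]
  refine h2.congr_fderiv ?_
  ext1 v
  exact (map_add (alternatizeUncurryFinCLM ℝ E V) _ _).trans
    (congrArg (_ + ·) (wedge_one _ _).symm)

lemma hasFDerivAt_curryLeft {φ : D → E [⋀^Fin (k + 1)]→L[ℝ] V} {X : D → E}
    {φ' : D →L[ℝ] E [⋀^Fin (k + 1)]→L[ℝ] V} {X' : D →L[ℝ] E}
    (hφ : HasFDerivAt φ φ' x) (hX : HasFDerivAt X X' x) :
    HasFDerivAt (fun y => (φ y).curryLeft (X y))
      ((insertCLM V k (X x)).comp φ' + (φ x).curryLeft.comp X') x := by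
  have h1 := ((curryLeftLI (𝕜 := ℝ) (E := E) (F := V)
    (n := k)).toContinuousLinearMap.hasFDerivAt.comp x hφ).clm_apply hX
  refine h1.congr_fderiv ?_
  ext1 v
  exact add_comm _ _

lemma hasFDerivAt_compCAM {A : D → V →L[ℝ] V} {φ : D → E [⋀^Fin k]→L[ℝ] V}
    {A' : D →L[ℝ] V →L[ℝ] V} {φ' : D →L[ℝ] E [⋀^Fin k]→L[ℝ] V}
    (hA : HasFDerivAt A A' x) (hφ : HasFDerivAt φ φ' x) :
    HasFDerivAt (fun y => (A y).compContinuousAlternatingMap (φ y))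
      ((valCLM E k (A x)).comp φ' + ((valL E V k).flip (φ x)).comp A') x := by
  have h1 := ((valL E V k).hasFDerivAt.comp x hA).clm_apply hφ
  exact h1.congr_fderiv (by ext1 v; rfl)

lemma sum_update_eq_alternatize (A : E [⋀^Fin (k + 1)]→L[ℝ] V) (T : E →L[ℝ] E)
    (v : Fin (k + 1) → E) :
    ∑ i, A (Function.update v i (T (v i))) = alternatizeUncurryFin (A.curryLeft.comp T) v := by
  rw [ContinuousAlternatingMap.alternatizeUncurryFin_apply]
  refine Finset.sum_congr rfl fun i _ => ?_
  have h1 := A.toAlternatingMap.map_insertNth i (T (v i)) (i.removeNth v)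
  rw [Fin.insertNth_removeNth] at h1
  exact h1

end Derivatives

section ExteriorCalculus

open Filter Topology
open ContinuousAlternatingMap (alternatizeUncurryFin alternatizeUncurryFinCLM
  alternatizeUncurryFin_apply curryLeft_apply_apply curryLeftLI compContinuousLinearMapCLM)

namespace CartanGeometry

variable {EG G EP P EQ EM V : Type*}
  [NormedAddCommGroup EG] [NormedSpace ℝ EG] [FiniteDimensional ℝ EG]
  [TopologicalSpace G] [ChartedSpace EG G] [Group G] [LieGroup 𝓘(ℝ, EG) ∞ G]
  [NormedAddCommGroup EP] [NormedSpace ℝ EP]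
  [TopologicalSpace P] [ChartedSpace EP P] [Group P]
  [NormedAddCommGroup EQ] [NormedSpace ℝ EQ] [FiniteDimensional ℝ EQ]
  [NormedAddCommGroup EM] [NormedSpace ℝ EM]
  [NormedAddCommGroup V] [NormedSpace ℝ V]
  {c : ContactGrading (LieAlg EG G)} {S : ParabolicSubgroup c EP P} {Q M : Type*}
  [TopologicalSpace Q] [ChartedSpace EQ Q] [IsManifold 𝓘(ℝ, EQ) ∞ Q]
  [TopologicalSpace M] [ChartedSpace EM M]
  {C : CartanGeometry S EQ Q EM M} {ρ : G →* (V →L[ℝ] V)} {k : ℕ}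

/-- The covariant exterior derivative at the base point of a chart, as an alternation. -/
lemma covD_eq_alternatize {φ : Form EQ Q V k} {u : Q} {φ' : EQ →L[ℝ] EQ [⋀^Fin k]→L[ℝ] V}
    (h : HasFDerivAt (chartRep φ u) φ' (extChartAt 𝓘(ℝ, EQ) u u)) :
    C.covD ρ φ u = alternatizeUncurryFin (φ' + C.connAct ρ φ u) := by
  rw [covD, extD_eq_extDeriv, extDeriv, h.fderiv,
    ContinuousAlternatingMap.alternatizeUncurryFin_add]

namespace InfAut

variable (ξ : C.InfAut)

/-- The lift of an infinitesimal automorphism, as a function with values in the model space. -/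
def liftE (u : Q) : EQ := ξ.lift u

/-- The function `s = ω(ξ̃)`, with values in the model space of `G`. -/
def secE (u : Q) : EG := C.connE u (ξ.liftE u)

lemma smoothField_lift : SmoothField ∞ ξ.liftE := ξ.contMDiff_lift

lemma contDiffOn_liftRep (u : Q) :
    ContDiffOn ℝ ∞ (fieldRep ξ.liftE u) (extChartAt 𝓘(ℝ, EQ) u).target := by
  have : CompleteSpace EQ := FiniteDimensional.complete ℝ EQ
  exact ξ.smoothField_lift.contDiffOn_fieldRep (by simp) u

lemma secE_symm (u : Q) {y : EQ} (hy : y ∈ (extChartAt 𝓘(ℝ, EQ) u).target) :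
    ξ.secE ((extChartAt 𝓘(ℝ, EQ) u).symm y) = C.connRep u y (fieldRep ξ.liftE u y) := by
  rw [secE, connRep, ContinuousLinearMap.comp_apply, mder_symm_fieldRep _ u hy]
  rfl

lemma contDiffOn_secE (u : Q) :
    ContDiffOn ℝ ∞ (fun y => ξ.secE ((extChartAt 𝓘(ℝ, EQ) u).symm y))
      (extChartAt 𝓘(ℝ, EQ) u).target :=
  ((C.contDiffOn_connRep u).clm_apply (ξ.contDiffOn_liftRep u)).congr
    fun _ hy => ξ.secE_symm u hy

lemma liftE_act (u : Q) (h : P) : ξ.liftE (C.act u h) = C.actDeriv h u (ξ.liftE u) :=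
  (ξ.lift_act u h).symm

lemma secE_act (u : Q) (h : P) : ξ.secE (C.act u h) = Ad (S.incl h⁻¹) (ξ.secE u) := by
  rw [secE, liftE_act, connE_actDeriv]
  rfl

lemma chartRep_insert (φ : Form EQ Q V (k + 1)) (u : Q) {y : EQ}
    (hy : y ∈ (extChartAt 𝓘(ℝ, EQ) u).target) :
    chartRep (ξ.insert φ) u y = (chartRep φ u y).curryLeft (fieldRep ξ.liftE u y) := by
  ext v
  have h1 := mder_symm_fieldRep ξ.liftE u hy
  rw [curryLeft_apply_apply]
  change φ _ (Matrix.vecCons (ξ.liftE _) (fun i => mder EQ EQ _ y (v i))) =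
    φ _ (mder EQ EQ (extChartAt 𝓘(ℝ, EQ) u).symm y ∘ Matrix.vecCons (fieldRep ξ.liftE u y) v)
  rw [← h1]
  congr 1
  funext i
  refine Fin.cases ?_ (fun j => ?_) i <;> rfl

lemma insert_mem {φ : Form EQ Q V (k + 1)} (hφ : φ ∈ C.bundleForms ρ (k + 1)) :
    ξ.insert φ ∈ C.bundleForms ρ k := by
  obtain ⟨hs, he, hz⟩ := hφ
  refine ⟨fun u => (contDiffOn_curryLeft (hs u) (ξ.contDiffOn_liftRep u)).congr
    fun y hy => ξ.chartRep_insert φ u hy, fun u h => ?_, ?_⟩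
  · ext v
    have h1 := DFunLike.congr_fun (he u h) (Matrix.vecCons (ξ.liftE u) v)
    refine Eq.trans ?_ h1
    change φ (C.act u h) (Matrix.vecCons (ξ.liftE (C.act u h)) fun i => C.actDeriv h u (v i)) =
      φ (C.act u h) (C.actDeriv h u ∘ Matrix.vecCons (ξ.liftE u) v)
    rw [liftE_act]
    congr 1
    funext i
    refine Fin.cases ?_ (fun j => ?_) i <;> rfl
  · rintro u v ⟨i, hi⟩
    exact hz u _ ⟨i.succ, hi⟩

lemma Xi_apply (φ : Form EQ Q V k) (u : Q) :
    ξ.Xi ρ k φ u = (infRep' EG ρ (ξ.secE u)).compContinuousAlternatingMap (φ u) := rfl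

lemma Xi_mem (hρ : ContMDiff 𝓘(ℝ, EG) 𝓘(ℝ, V →L[ℝ] V) ∞ ρ) {φ : Form EQ Q V k}
    (hφ : φ ∈ C.bundleForms ρ k) : ξ.Xi ρ k φ ∈ C.bundleForms ρ k := by
  obtain ⟨hs, he, hz⟩ := hφ
  refine ⟨fun u => contDiffOn_compCAM
    ((infRep' EG ρ).contDiff.comp_contDiffOn (ξ.contDiffOn_secE u)) (hs u), fun u h => ?_, ?_⟩
  · ext v
    have h1 := DFunLike.congr_fun (he u h) v
    refine (congrArg (infRep' EG ρ (ξ.secE (C.act u h))) h1).trans ?_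
    rw [secE_act]
    exact DFunLike.congr_fun (infRep_Ad_comp hρ (S.incl h⁻¹) (ξ.secE u)) (φ u v)
  · intro u v hv
    exact (congrArg (infRep' EG ρ (ξ.secE u)) (hz u v hv)).trans (map_zero _)

/-- The form `α ∧ φ`. -/
def wedgeA (α : Form EQ Q ℝ 1) (φ : Form EQ Q V k) : Form EQ Q V (k + 1) := fun u =>
  wedge (φ u) 1 (α u)

lemma chartRep_wedgeA (α : Form EQ Q ℝ 1) (φ : Form EQ Q V k) (u : Q) (y : EQ) :
    chartRep (wedgeA α φ) u y = wedge (chartRep φ u y) 1 (chartRep α u y) :=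
  wedge_one_compContinuousLinearMap _ _ _

lemma wedgeA_mem {α : Form EQ Q ℝ 1} (hα : α ∈ C.bundleForms (1 : G →* (ℝ →L[ℝ] ℝ)) 1)
    {φ : Form EQ Q V k} (hφ : φ ∈ C.bundleForms ρ k) :
    wedgeA α φ ∈ C.bundleForms ρ (k + 1) := by
  obtain ⟨hs, he, hz⟩ := hφ
  obtain ⟨as, ae, az⟩ := hα
  refine ⟨fun u => (contDiffOn_wedge_one (hs u) (as u)).congr fun y _ => chartRep_wedgeA α φ u y,
    fun u h => ?_, ?_⟩
  · refine (wedge_one_compContinuousLinearMap (φ (C.act u h)) (α (C.act u h))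
      (C.actDeriv h u)).trans ?_
    refine Eq.trans ?_ (comp_wedge_one (ρ (S.incl h⁻¹)) (φ u) (α u)).symm
    have h1 : (α (C.act u h)).compContinuousLinearMap (C.actDeriv h u) = α u := by
      refine (ae u h).trans ?_
      ext v; rfl
    exact congrArg₂ (fun (A : EQ [⋀^Fin k]→L[ℝ] V) (B : EQ [⋀^Fin 1]→L[ℝ] ℝ) => wedge A 1 B)
      (he u h) h1
  · intro u v hv
    change wedge (φ u) 1 (α u) v = 0
    rw [wedge_one]
    refine alternatize_apply_eq_zero _ {w | (C.connE u w : LieAlg EG G) ∈ c.filt 0} ?_ ?_ v hv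
    · intro w hw
      have : α u ![w] = 0 := az u ![w] ⟨0, hw⟩
      ext x
      change α u ![w] • φ u x = 0
      rw [this, zero_smul]
    · rintro x w hw
      have : φ u w = 0 := hz u w hw
      change α u ![x] • φ u w = 0
      rw [this, smul_zero]

lemma differentiableAt_liftRep (u : Q) :
    DifferentiableAt ℝ (fieldRep ξ.liftE u) (extChartAt 𝓘(ℝ, EQ) u u) :=
  ((ξ.contDiffOn_liftRep u).contDiffAt ((isOpen_extChartAt_target u).mem_nhds
    (mem_extChartAt_target u))).differentiableAt (by simp)

/-- The derivative of the functions representing a form with respect to the trivialization of the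
tangent bundle by constant vector fields. -/
lemma hasMFDerivAt_components {φ : Form EQ Q V k} (hφ : IsSmoothForm φ) (X : Fin k → EG) (u : Q) :
    ∃ D : EQ →L[ℝ] V, HasMFDerivAt 𝓘(ℝ, EQ) 𝓘(ℝ, V)
      (fun u' : Q => φ u' (fun i => C.constFieldE (X i) u')) u D ∧
      D (ξ.liftE u) =
        fderiv ℝ (chartRep φ u) (extChartAt 𝓘(ℝ, EQ) u u) (ξ.liftE u)
          (fun i => C.constFieldE (X i) u) +
        ∑ i, φ u (Function.update (fun i => C.constFieldE (X i) u) i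
          (fderiv ℝ (fieldRep ξ.liftE u) (extChartAt 𝓘(ℝ, EQ) u u) (C.constFieldE (X i) u))) := by
  have : CompleteSpace EQ := FiniteDimensional.complete ℝ EQ
  set e := extChartAt 𝓘(ℝ, EQ) u with he
  have hX : ∀ i, DifferentiableAt ℝ (fieldRep (C.constFieldE (X i)) u) (e u) := fun i =>
    (C.smoothField_const (X i)).differentiableAt_fieldRep (n := ∞) (by simp) (by simp) u
  let g : EQ → V := fun y => chartRep φ u y (fun i => fieldRep (C.constFieldE (X i)) u y)
  have hg : DifferentiableAt ℝ g (e u) := (hφ.differentiableAt u).continuousAlternatingMap_apply hX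
  have hev : (fun u' : Q => φ u' (fun i => C.constFieldE (X i) u')) =ᶠ[𝓝 u] g ∘ e := by
    filter_upwards [extChartAt_source_mem_nhds (I := 𝓘(ℝ, EQ)) u] with u' hu'
    have h1 : e.symm (e u') = u' := e.left_inv hu'
    have h2 : ∀ i, mder EQ EQ e.symm (e u') (fieldRep (C.constFieldE (X i)) u (e u')) =
        C.constFieldE (X i) u' := fun i => by
      rw [mder_symm_fieldRep _ u (e.map_source hu'), h1]
    change _ = φ (e.symm (e u')) (fun i => mder EQ EQ e.symm (e u') _)
    rw [h1]
    exact congrArg (φ u') (funext fun i => (h2 i).symm)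
  have hmd : HasMFDerivAt 𝓘(ℝ, EQ) 𝓘(ℝ, EQ) e u (ContinuousLinearMap.id ℝ EQ) := by
    have h1 := (mdifferentiableAt_extChartAt' u (mem_extChartAt_source (I := 𝓘(ℝ, EQ))
      u)).hasMFDerivAt
    have h2 := mder_extChartAt_base (E := EQ) u
    exact h2 ▸ h1
  have hD : HasMFDerivAt 𝓘(ℝ, EQ) 𝓘(ℝ, V)
      (fun u' : Q => φ u' (fun i => C.constFieldE (X i) u')) u
      ((fderiv ℝ g (e u)).comp (ContinuousLinearMap.id ℝ EQ)) :=
    (HasMFDerivAt.comp u hg.hasFDerivAt.hasMFDerivAt hmd).congr_of_eventuallyEq hev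
  refine ⟨_, hD, ?_⟩
  change fderiv ℝ g (e u) (ξ.liftE u) = _
  rw [fderiv_continuousAlternatingMap_apply_apply (hφ.differentiableAt u) hX, chartRep_base]
  have hb : ∀ i, fieldRep (C.constFieldE (X i)) u (e u) = C.constFieldE (X i) u := fun i =>
    fieldRep_base _ u
  have hbr : ∀ i, fderiv ℝ (fieldRep (C.constFieldE (X i)) u) (e u) (ξ.liftE u) =
      fderiv ℝ (fieldRep ξ.liftE u) (e u) (C.constFieldE (X i) u) := by
    intro i
    have h1 := mlieBracket_eq_lieBracket ξ.liftE (C.constFieldE (X i)) u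
    have h2 : (VectorField.mlieBracket 𝓘(ℝ, EQ) ξ.liftE (C.constFieldE (X i)) u : EQ) = 0 :=
      ξ.mlieBracket_const (X i) u
    rw [h2, VectorField.lieBracket, fieldRep_base, fieldRep_base] at h1
    exact sub_eq_zero.1 h1.symm
  refine congrArg₂ (· + ·) (congrArg _ (funext hb)) (Finset.sum_congr rfl fun i _ => ?_)
  exact congrArg (φ u) (congrArg₂ (fun a b => Function.update a i b) (funext hb) (hbr i))

/-- The forms in `A^0`, characterized through the covariant exterior derivative. -/
lemma mem_invForms_zero {φ : Form EQ Q V 0} :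
    φ ∈ ξ.invForms ρ 0 ↔ φ ∈ C.bundleForms ρ 0 ∧ ξ.insert (C.covD ρ φ) = ξ.Xi ρ 0 φ := by
  refine and_congr_right fun hb => ?_
  have hs := hb.1
  have h1 : ∀ u, ξ.insert (C.covD ρ φ) u - ξ.Xi ρ 0 φ u =
      fderiv ℝ (chartRep φ u) (extChartAt 𝓘(ℝ, EQ) u u) (ξ.liftE u) := by
    intro u
    change (C.covD ρ φ u).curryLeft (ξ.liftE u) - _ = _
    rw [covD_eq_alternatize (hs.differentiableAt u).hasFDerivAt, curryLeft_alternatize_zero,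
      add_apply, add_sub_assoc, add_eq_left]
    exact sub_self _
  constructor
  · intro h
    funext u
    rw [← sub_eq_zero, h1]
    obtain ⟨D, hD, hD0⟩ := h u ![]
    obtain ⟨D', hD', hD0'⟩ := ξ.hasMFDerivAt_components hs ![] u
    have hDD : D = D' := hasMFDerivAt_unique hD hD'
    have h2 : D' (ξ.liftE u) = 0 := hDD ▸ hD0
    rw [hD0', Finset.univ_eq_empty, Finset.sum_empty, add_zero] at h2
    ext v
    rw [Subsingleton.elim v (fun i => C.constFieldE ((![] : Fin 0 → EG) i) u)]
    exact h2
  · intro h u X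
    obtain ⟨D', hD', hD0'⟩ := ξ.hasMFDerivAt_components hs X u
    refine ⟨D', hD', hD0'.trans ?_⟩
    rw [Finset.univ_eq_empty, Finset.sum_empty, add_zero, ← h1, h, sub_self]
    rfl

/-- The Lie derivative of a form along `ξ̃`, in a chart, is the deviation from the covariant Cartan
formula `i_ξ d^∇ + d^∇ i_ξ = Ξ_*`. -/
lemma covariant_cartan {φ : Form EQ Q V (k + 1)} (hs : IsSmoothForm φ) (u : Q) :
    ξ.insert (C.covD ρ φ) u + C.covD ρ (ξ.insert φ) u - ξ.Xi ρ (k + 1) φ u =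
      fderiv ℝ (chartRep φ u) (extChartAt 𝓘(ℝ, EQ) u u) (ξ.liftE u) +
      alternatizeUncurryFin ((φ u).curryLeft.comp
        (fderiv ℝ (fieldRep ξ.liftE u) (extChartAt 𝓘(ℝ, EQ) u u))) := by
  have hev : chartRep (ξ.insert φ) u =ᶠ[𝓝 (extChartAt 𝓘(ℝ, EQ) u u)]
      fun y => (chartRep φ u y).curryLeft (fieldRep ξ.liftE u y) := by
    filter_upwards [extChartAt_target_mem_nhds (I := 𝓘(ℝ, EQ)) u] with y hy
    exact ξ.chartRep_insert φ u hy
  have h1 := (hasFDerivAt_curryLeft (hs.differentiableAt u).hasFDerivAt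
    (ξ.differentiableAt_liftRep u).hasFDerivAt).congr_of_eventuallyEq hev
  rw [fieldRep_base, chartRep_base] at h1
  change (C.covD ρ φ u).curryLeft (ξ.liftE u) + _ - _ = _
  rw [covD_eq_alternatize (hs.differentiableAt u).hasFDerivAt, covD_eq_alternatize h1,
    curryLeft_alternatize, add_apply]
  have h2 : C.connAct ρ φ u (ξ.liftE u) = ξ.Xi ρ (k + 1) φ u := rfl
  have h3 : (insertCLM V k (ξ.liftE u)).comp (C.connAct ρ φ u) =
    C.connAct ρ (ξ.insert φ) u := rfl
  rw [ContinuousLinearMap.comp_add, h2, h3]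
  simp only [ContinuousAlternatingMap.alternatizeUncurryFin_add]
  abel

/-- The forms in `A^{k+1}`, characterized by a covariant version of Cartan's formula. -/
lemma mem_invForms_succ {φ : Form EQ Q V (k + 1)} :
    φ ∈ ξ.invForms ρ (k + 1) ↔ φ ∈ C.bundleForms ρ (k + 1) ∧
      ξ.insert (C.covD ρ φ) + C.covD ρ (ξ.insert φ) = ξ.Xi ρ (k + 1) φ := by
  refine and_congr_right fun hb => ?_
  have hs := hb.1
  have h1 := ξ.covariant_cartan (ρ := ρ) hs
  constructor
  · intro h
    funext u
    rw [← sub_eq_zero]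
    refine (h1 u).trans ?_
    ext v
    obtain ⟨D, hD, hD0⟩ := h u (fun i => C.connE u (v i))
    obtain ⟨D', hD', hD0'⟩ := ξ.hasMFDerivAt_components hs (fun i => C.connE u (v i)) u
    have hDD : D = D' := hasMFDerivAt_unique hD hD'
    have h2 : D' (ξ.liftE u) = 0 := hDD ▸ hD0
    have h3' : ∀ i, C.constFieldE (C.connE u (v i)) u = v i :=
      fun i => (C.connE u).symm_apply_apply (v i)
    rw [hD0'] at h2
    simp only [h3'] at h2
    rw [sum_update_eq_alternatize] at h2
    exact h2
  · intro h u X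
    obtain ⟨D', hD', hD0'⟩ := ξ.hasMFDerivAt_components hs X u
    refine ⟨D', hD', hD0'.trans ?_⟩
    rw [sum_update_eq_alternatize (φ u) _ (fun i => C.constFieldE (X i) u)]
    have h2 := (h1 u).symm.trans (sub_eq_zero.2 (congrFun h u))
    exact DFunLike.congr_fun h2 (fun i => C.constFieldE (X i) u)

lemma secE_eventuallyEq (u : Q) :
    ξ.secE =ᶠ[𝓝 u] (fun y => ξ.secE ((extChartAt 𝓘(ℝ, EQ) u).symm y)) ∘
      extChartAt 𝓘(ℝ, EQ) u := by
  filter_upwards [extChartAt_source_mem_nhds (I := 𝓘(ℝ, EQ)) u] with u' hu'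
  exact congrArg ξ.secE ((extChartAt 𝓘(ℝ, EQ) u).left_inv hu').symm

lemma differentiableAt_secE (u : Q) :
    DifferentiableAt ℝ (fun y => ξ.secE ((extChartAt 𝓘(ℝ, EQ) u).symm y))
      (extChartAt 𝓘(ℝ, EQ) u u) :=
  ((ξ.contDiffOn_secE u).contDiffAt ((isOpen_extChartAt_target u).mem_nhds
    (mem_extChartAt_target u))).differentiableAt (by simp)

lemma mdifferentiableAt_secE (u : Q) : MDifferentiableAt 𝓘(ℝ, EQ) 𝓘(ℝ, EG) ξ.secE u :=
  ((ξ.differentiableAt_secE u).mdifferentiableAt.comp u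
    (mdifferentiableAt_extChartAt' u (mem_extChartAt_source u))).congr_of_eventuallyEq
      (ξ.secE_eventuallyEq u)

lemma hasFDerivAt_secE (u : Q) :
    HasFDerivAt (fun y => ξ.secE ((extChartAt 𝓘(ℝ, EQ) u).symm y)) (mder EQ EG ξ.secE u)
      (extChartAt 𝓘(ℝ, EQ) u u) := by
  have h1 := ξ.differentiableAt_secE u
  have h2 := mder_comp (E := EQ) (E' := EQ) (E'' := EG)
    (g := fun y => ξ.secE ((extChartAt 𝓘(ℝ, EQ) u).symm y)) (f := extChartAt 𝓘(ℝ, EQ) u) u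
    h1.mdifferentiableAt (mdifferentiableAt_extChartAt' u (mem_extChartAt_source u))
  rw [mder_congr (ξ.secE_eventuallyEq u), h2, mder_extChartAt_base, mder_eq_fderiv,
    ContinuousLinearMap.comp_id]
  exact h1.hasFDerivAt

/-- Normality of `ξ`: the derivative of `s = ω(ξ̃)` in direction `v` is `[s, ω(v)]`. -/
lemma mder_secE (hξ : ξ.IsNormal) (u : Q) (v : EQ) :
    mder EQ EG ξ.secE u v = (⁅ξ.sec u, C.conn u v⁆ : LieAlg EG G) := by
  have h1 := hξ u (C.connE u v)
  have h2 : ξ.secDeriv u (C.constField (C.connE u v) u) = mder EQ EG ξ.secE u v :=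
    congrArg (mder EQ EG ξ.secE u) ((C.connE u).symm_apply_apply v)
  rw [h2] at h1
  have h3 := eq_neg_of_add_eq_zero_left h1
  exact h3.trans (lie_skew _ _)

/-- Since `ξ` is normal, `Ξ` is parallel. -/
lemma covD_Xi (hρ : ContMDiff 𝓘(ℝ, EG) 𝓘(ℝ, V →L[ℝ] V) ∞ ρ) (hξ : ξ.IsNormal)
    {φ : Form EQ Q V k} (hs : IsSmoothForm φ) :
    C.covD ρ (ξ.Xi ρ k φ) = ξ.Xi ρ (k + 1) (C.covD ρ φ) := by
  funext u
  have hbase : (extChartAt 𝓘(ℝ, EQ) u).symm (extChartAt 𝓘(ℝ, EQ) u u) = u :=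
    extChartAt_to_inv (I := 𝓘(ℝ, EQ)) u
  have h1 : HasFDerivAt (chartRep (ξ.Xi ρ k φ) u) _ (extChartAt 𝓘(ℝ, EQ) u u) :=
    hasFDerivAt_compCAM ((infRep' EG ρ).hasFDerivAt.comp _ (ξ.hasFDerivAt_secE u))
      (hs.differentiableAt u).hasFDerivAt
  rw [Function.comp_apply, hbase, chartRep_base] at h1
  rw [covD_eq_alternatize h1, Xi_apply, covD_eq_alternatize (hs.differentiableAt u).hasFDerivAt,
    comp_alternatize]
  congr 1
  rw [ContinuousLinearMap.comp_add, add_assoc]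
  congr 1
  ext v x
  have h2 := DFunLike.congr_fun (infRep_lie hρ (ξ.sec u) (C.conn u v)) (φ u x)
  change infRep' EG ρ (mder EQ EG ξ.secE u v) (φ u x) +
    infRep' EG ρ (C.connE u v) (infRep' EG ρ (ξ.secE u) (φ u x)) =
    infRep' EG ρ (ξ.secE u) (infRep' EG ρ (C.connE u v) (φ u x))
  rw [ξ.mder_secE hξ]
  refine (congrArg (· + _) h2).trans ?_
  exact sub_add_cancel _ _

/-- The Leibniz rule `d(α ∧ φ) = dα ∧ φ - α ∧ dφ`. -/
lemma covD_wedgeA {α : Form EQ Q ℝ 1} (hα : IsSmoothForm α) {φ : Form EQ Q V k}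
    (hs : IsSmoothForm φ) :
    C.covD ρ (wedgeA α φ) = wedgeD α φ - wedgeA α (C.covD ρ φ) := by
  funext u
  have h0 : chartRep (wedgeA α φ) u = fun y => wedge (chartRep φ u y) 1 (chartRep α u y) :=
    funext fun y => chartRep_wedgeA α φ u y
  have h1 := hasFDerivAt_wedge_one (hs.differentiableAt u).hasFDerivAt
    (hα.differentiableAt u).hasFDerivAt
  rw [← h0, chartRep_base, chartRep_base] at h1
  have h2 : C.connAct ρ (wedgeA α φ) u = (wedgeOne V k (α u)).comp (C.connAct ρ φ u) := by
    ext1 v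
    refine (comp_wedge_one _ _ _).trans ?_
    exact (wedgeOne_apply _ _).symm
  rw [covD_eq_alternatize h1, h2, Pi.sub_apply, wedgeD, wedgeA,
    covD_eq_alternatize (hs.differentiableAt u).hasFDerivAt, extD_eq_extDeriv, extDeriv,
    wedge_two_alternatize, sub_eq_add_neg, ← alternatize_wedgeOne_comp,
    ContinuousLinearMap.comp_add]
  simp only [ContinuousAlternatingMap.alternatizeUncurryFin_add]
  abel

end InfAut

end CartanGeometry

end ExteriorCalculus

/-! ### Cartan's calculus on invariant forms -/

section CartanCalculus

namespace CartanGeometry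

variable {EG G EP P EQ EM V : Type*}
  [NormedAddCommGroup EG] [NormedSpace ℝ EG] [FiniteDimensional ℝ EG]
  [TopologicalSpace G] [ChartedSpace EG G] [Group G] [LieGroup 𝓘(ℝ, EG) ∞ G]
  [NormedAddCommGroup EP] [NormedSpace ℝ EP]
  [TopologicalSpace P] [ChartedSpace EP P] [Group P]
  [NormedAddCommGroup EQ] [NormedSpace ℝ EQ] [FiniteDimensional ℝ EQ]
  [NormedAddCommGroup EM] [NormedSpace ℝ EM]
  [NormedAddCommGroup V] [NormedSpace ℝ V]
  {c : ContactGrading (LieAlg EG G)} {S : ParabolicSubgroup c EP P} {Q M : Type*}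
  [TopologicalSpace Q] [ChartedSpace EQ Q] [IsManifold 𝓘(ℝ, EQ) ∞ Q]
  [TopologicalSpace M] [ChartedSpace EM M]
  {C : CartanGeometry S EQ Q EM M} {ρ : G →* (V →L[ℝ] V)} {k : ℕ}

lemma covD_sub {φ ψ : Form EQ Q V k} (hφ : IsSmoothForm φ) (hψ : IsSmoothForm ψ) :
    C.covD ρ (φ - ψ) = C.covD ρ φ - C.covD ρ ψ := by
  have h1 : φ - ψ = φ + (-1 : ℝ) • ψ := by rw [neg_one_smul, sub_eq_add_neg]
  rw [h1, C.covD_add ρ hφ (hψ.smul (-1)), covD_smul, neg_one_smul, sub_eq_add_neg]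

lemma covD_zero : C.covD ρ (0 : Form EQ Q V k) = 0 := by
  have h1 := C.covD_smul ρ 0 (0 : Form EQ Q V k)
  rwa [zero_smul, zero_smul] at h1

namespace InfAut

variable {ξ : C.InfAut} {α : Form EQ Q ℝ 1}

lemma insert_add (φ ψ : Form EQ Q V (k + 1)) : ξ.insert (φ + ψ) = ξ.insert φ + ξ.insert ψ := rfl

lemma insert_sub (φ ψ : Form EQ Q V (k + 1)) : ξ.insert (φ - ψ) = ξ.insert φ - ξ.insert ψ := rfl

lemma insert_zero : ξ.insert (0 : Form EQ Q V (k + 1)) = 0 := rfl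

lemma insert_insert (φ : Form EQ Q V (k + 2)) : ξ.insert (ξ.insert φ) = 0 := by
  funext u
  ext v
  exact (φ u).map_eq_zero_of_eq _ (i := 0) (j := 1) rfl (by simp)

lemma insert_Xi (φ : Form EQ Q V (k + 1)) : ξ.insert (ξ.Xi ρ (k + 1) φ) = ξ.Xi ρ k (ξ.insert φ) :=
  rfl

lemma wedgeA_add (φ ψ : Form EQ Q V k) : wedgeA α (φ + ψ) = wedgeA α φ + wedgeA α ψ :=
  funext fun _ => wedge_add _ _ _ _

lemma wedgeA_sub (φ ψ : Form EQ Q V k) : wedgeA α (φ - ψ) = wedgeA α φ - wedgeA α ψ :=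
  funext fun _ => wedge_sub _ _ _

lemma wedgeA_zero : wedgeA α (0 : Form EQ Q V k) = 0 := funext fun _ => wedge_zero _

lemma wedgeA_wedgeA (φ : Form EQ Q V k) : wedgeA α (wedgeA α φ) = 0 :=
  funext fun _ => wedge_one_wedge_one _ _

lemma Xi_wedgeA (φ : Form EQ Q V k) :
    ξ.Xi ρ (k + 1) (wedgeA α φ) = wedgeA α (ξ.Xi ρ k φ) :=
  funext fun u => comp_wedge_one (infRep' EG ρ (ξ.secE u)) (φ u) (α u)

lemma insert_wedgeA (hα : ξ.IsContactFormOf α) (φ : Form EQ Q V (k + 1)) :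
    ξ.insert (wedgeA α φ) = φ - wedgeA α (ξ.insert φ) := by
  funext u
  refine (curryLeft_wedge_one (φ u) (α u) (ξ.liftE u)).trans ?_
  have : α u ![ξ.liftE u] = 1 := hα.insert_eq_one u
  rw [this, one_smul]
  rfl

lemma insert_wedgeA_zero (hα : ξ.IsContactFormOf α) (φ : Form EQ Q V 0) :
    ξ.insert (wedgeA α φ) = φ := by
  funext u
  refine (curryLeft_wedge_one_zero (φ u) (α u) (ξ.liftE u)).trans ?_
  have : α u ![ξ.liftE u] = 1 := hα.insert_eq_one u
  rw [this, one_smul]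

lemma insert_wedgeD (hα : ξ.IsContactFormOf α) (φ : Form EQ Q V (k + 1)) :
    ξ.insert (wedgeD α φ) = wedgeD α (ξ.insert φ) :=
  funext fun u => curryLeft_wedge_two (φ u) (hα.insert_extD u)

lemma insert_wedgeD_zero (hα : ξ.IsContactFormOf α) (φ : Form EQ Q V 0) :
    ξ.insert (wedgeD α φ) = 0 :=
  funext fun u => curryLeft_wedge_two_zero (φ u) (hα.insert_extD u)

lemma wedgeD_zero : wedgeD α (0 : Form EQ Q V k) = 0 := by
  funext u
  have h1 := wedge_smul 0 (0 : EQ [⋀^Fin k]→L[ℝ] V) 2 (extD α u)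
  rwa [zero_smul, zero_smul] at h1

lemma mem_horForms_zero {φ : Form EQ Q V 0} : φ ∈ ξ.horForms ρ 0 ↔ φ ∈ ξ.invForms ρ 0 :=
  ⟨fun h => h.1, fun h => ⟨h, fun _ _ ⟨i, _⟩ => i.elim0⟩⟩

lemma mem_horForms_succ {φ : Form EQ Q V (k + 1)} :
    φ ∈ ξ.horForms ρ (k + 1) ↔ φ ∈ ξ.invForms ρ (k + 1) ∧ ξ.insert φ = 0 := by
  refine and_congr_right fun _ => ⟨fun h => ?_, fun h => ?_⟩
  · funext u
    exact curryLeft_eq_zero (w := ξ.liftE u) (h u)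
  · rintro u v ⟨i, hi⟩
    exact apply_eq_zero_of_curryLeft (φ u) (w := ξ.liftE u) (congrFun h u) v hi

/-- Cartan's calculus on the spaces `A^k`: they are preserved by `d^∇`, by `i_ξ` and by `Ξ_*`;
`d^∇` is a differential which commutes with `Ξ_*`, and `i_ξ d^∇ + d^∇ i_ξ = Ξ_*`. -/
structure CartanCalculus (ξ : C.InfAut) (ρ : G →* (V →L[ℝ] V)) : Prop where
  covD_mem : ∀ {k : ℕ} {φ : Form EQ Q V k}, φ ∈ ξ.invForms ρ k → C.covD ρ φ ∈ ξ.invForms ρ (k + 1)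
  insert_mem : ∀ {k : ℕ} {φ : Form EQ Q V (k + 1)}, φ ∈ ξ.invForms ρ (k + 1) →
    ξ.insert φ ∈ ξ.invForms ρ k
  Xi_mem : ∀ {k : ℕ} {φ : Form EQ Q V k}, φ ∈ ξ.invForms ρ k → ξ.Xi ρ k φ ∈ ξ.invForms ρ k
  covD_covD : ∀ {k : ℕ} {φ : Form EQ Q V k}, φ ∈ ξ.invForms ρ k → C.covD ρ (C.covD ρ φ) = 0
  covD_Xi : ∀ {k : ℕ} {φ : Form EQ Q V k}, φ ∈ ξ.invForms ρ k →
    C.covD ρ (ξ.Xi ρ k φ) = ξ.Xi ρ (k + 1) (C.covD ρ φ)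
  cartan_zero : ∀ {φ : Form EQ Q V 0}, φ ∈ ξ.invForms ρ 0 → ξ.insert (C.covD ρ φ) = ξ.Xi ρ 0 φ
  cartan_succ : ∀ {k : ℕ} {φ : Form EQ Q V (k + 1)}, φ ∈ ξ.invForms ρ (k + 1) →
    ξ.insert (C.covD ρ φ) + C.covD ρ (ξ.insert φ) = ξ.Xi ρ (k + 1) φ

theorem cartanCalculus [FiniteDimensional ℝ V] [LieGroup 𝓘(ℝ, EP) ∞ P] (hξ : ξ.IsNormal)
    (hρ : ContMDiff 𝓘(ℝ, EG) 𝓘(ℝ, V →L[ℝ] V) ∞ ρ)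
    (hflat : ∀ (k : ℕ), ∀ φ ∈ C.bundleForms ρ k, C.covD ρ (C.covD ρ φ) = 0) :
    ξ.CartanCalculus ρ where
  covD_mem := by
    rintro k φ hφ
    refine ξ.mem_invForms_succ.2 ⟨C.covD_mem_bundleForms hρ hφ.1, ?_⟩
    rw [hflat k φ hφ.1, insert_zero, zero_add]
    cases k with
    | zero => rw [(ξ.mem_invForms_zero.1 hφ).2, ξ.covD_Xi hρ hξ hφ.1.1]
    | succ k =>
      have h1 := (ξ.mem_invForms_succ.1 hφ).2
      have h2 := ξ.insert_mem hφ.1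
      rw [eq_sub_of_add_eq h1, covD_sub (ξ.Xi_mem hρ hφ.1).1 (C.isSmoothForm_covD h2.1),
        hflat k _ h2, sub_zero, ξ.covD_Xi hρ hξ hφ.1.1]
  insert_mem := by
    rintro k φ hφ
    have h1 := congrArg ξ.insert (ξ.mem_invForms_succ.1 hφ).2
    rw [insert_add, insert_insert, zero_add] at h1
    cases k with
    | zero => exact ξ.mem_invForms_zero.2 ⟨ξ.insert_mem hφ.1, h1⟩
    | succ k =>
      refine ξ.mem_invForms_succ.2 ⟨ξ.insert_mem hφ.1, ?_⟩
      rw [insert_insert, covD_zero, add_zero]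
      exact h1
  Xi_mem := by
    rintro k φ hφ
    cases k with
    | zero =>
      refine ξ.mem_invForms_zero.2 ⟨ξ.Xi_mem hρ hφ.1, ?_⟩
      rw [ξ.covD_Xi hρ hξ hφ.1.1, insert_Xi, (ξ.mem_invForms_zero.1 hφ).2]
    | succ k =>
      refine ξ.mem_invForms_succ.2 ⟨ξ.Xi_mem hρ hφ.1, ?_⟩
      rw [ξ.covD_Xi hρ hξ hφ.1.1, insert_Xi, insert_Xi, ξ.covD_Xi hρ hξ (ξ.insert_mem hφ.1).1,
        ← map_add, (ξ.mem_invForms_succ.1 hφ).2]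
  covD_covD := fun hφ => hflat _ _ hφ.1
  covD_Xi := fun hφ => ξ.covD_Xi hρ hξ hφ.1.1
  cartan_zero := fun hφ => (ξ.mem_invForms_zero.1 hφ).2
  cartan_succ := fun hφ => (ξ.mem_invForms_succ.1 hφ).2

lemma wedgeA_mem_invForms (hα : ξ.IsContactFormOf α) {φ : Form EQ Q V k}
    (hφ : φ ∈ ξ.invForms ρ k) : wedgeA α φ ∈ ξ.invForms ρ (k + 1) := by
  have hsm : ∀ {j : ℕ} {ψ : Form EQ Q V j}, IsSmoothForm ψ → IsSmoothForm (wedgeA α ψ) :=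
    fun {j ψ} hψ u => (contDiffOn_wedge_one (hψ u) (hα.mem.1 u)).congr
      fun y _ => chartRep_wedgeA α ψ u y
  refine ξ.mem_invForms_succ.2 ⟨wedgeA_mem hα.mem hφ.1, ?_⟩
  rw [covD_wedgeA hα.mem.1 hφ.1.1, insert_sub, insert_wedgeA hα, Xi_wedgeA]
  cases k with
  | zero =>
    rw [insert_wedgeA_zero hα, insert_wedgeD_zero hα, (ξ.mem_invForms_zero.1 hφ).2]
    abel
  | succ k =>
    have hi := ξ.insert_mem hφ.1
    rw [insert_wedgeA hα, insert_wedgeD hα, covD_sub hφ.1.1 (hsm hi.1),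
      covD_wedgeA hα.mem.1 hi.1, ← (ξ.mem_invForms_succ.1 hφ).2, wedgeA_add]
    abel




end InfAut

end CartanGeometry

end CartanCalculus

/-! ### The long exact sequence -/

/-- A linear map factors through a surjective linear map whose kernel it annihilates. -/
lemma exists_linearMap_comp_eq {A B D : Type*} [AddCommGroup A] [Module ℝ A] [AddCommGroup B]
    [Module ℝ B] [AddCommGroup D] [Module ℝ D] (f : A →ₗ[ℝ] B) (g : A →ₗ[ℝ] D)
    (hf : Function.Surjective f) (hfg : ∀ a, f a = 0 → g a = 0) :
    ∃ h : B →ₗ[ℝ] D, ∀ a, h (f a) = g a := by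
  refine ⟨((LinearMap.ker f).liftQ g hfg).comp (f.quotKerEquivOfSurjective hf).symm.toLinearMap,
    fun a => ?_⟩
  have h1 : f a = f.quotKerEquivOfSurjective hf (Submodule.Quotient.mk a) := rfl
  rw [LinearMap.comp_apply, h1, LinearEquiv.coe_toLinearMap, LinearEquiv.symm_apply_apply]
  rfl

section ExactSequence

namespace CartanGeometry

variable {EG G EP P EQ EM V : Type*}
  [NormedAddCommGroup EG] [NormedSpace ℝ EG] [FiniteDimensional ℝ EG]
  [TopologicalSpace G] [ChartedSpace EG G] [Group G] [LieGroup 𝓘(ℝ, EG) ∞ G]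
  [NormedAddCommGroup EP] [NormedSpace ℝ EP]
  [TopologicalSpace P] [ChartedSpace EP P] [Group P]
  [NormedAddCommGroup EQ] [NormedSpace ℝ EQ] [FiniteDimensional ℝ EQ]
  [NormedAddCommGroup EM] [NormedSpace ℝ EM]
  [NormedAddCommGroup V] [NormedSpace ℝ V]
  {c : ContactGrading (LieAlg EG G)} {S : ParabolicSubgroup c EP P} {Q M : Type*}
  [TopologicalSpace Q] [ChartedSpace EQ Q] [IsManifold 𝓘(ℝ, EQ) ∞ Q]
  [TopologicalSpace M] [ChartedSpace EM M]
  {C : CartanGeometry S EQ Q EM M} {ρ : G →* (V →L[ℝ] V)} {k : ℕ}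

namespace InfAut

variable {ξ : C.InfAut} {α : Form EQ Q ℝ 1}

lemma mem_cocyclesA {φ : Form EQ Q V k} :
    φ ∈ ξ.cocyclesA ρ k ↔ φ ∈ ξ.invForms ρ k ∧ C.covD ρ φ = 0 := by
  refine and_congr_right fun h => ⟨?_, fun h1 => ⟨⟨φ, h.1⟩, h1, rfl⟩⟩
  rintro ⟨ψ, h1, rfl⟩
  exact h1

lemma mem_coboundariesA {φ : Form EQ Q V (k + 1)} :
    φ ∈ ξ.coboundariesA ρ (k + 1) ↔ ∃ σ ∈ ξ.invForms ρ k, C.covD ρ σ = φ :=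
  ⟨fun ⟨σ, h1, h2⟩ => ⟨σ, h1, h2⟩, fun ⟨σ, h1, h2⟩ => ⟨⟨σ, h1.1⟩, h1, h2⟩⟩

lemma mem_kerForms {φ : Form EQ Q V k} :
    φ ∈ ξ.kerForms ρ k ↔ φ ∈ ξ.horForms ρ k ∧ ξ.Xi ρ k φ = 0 := Iff.rfl

lemma mem_cocyclesK {φ : Form EQ Q V k} :
    φ ∈ ξ.cocyclesK ρ k ↔ φ ∈ ξ.kerForms ρ k ∧ C.covD ρ φ = 0 := by
  refine and_congr_right fun h => ⟨?_, fun h1 => ⟨⟨φ, h.1.1.1⟩, h1, rfl⟩⟩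
  rintro ⟨ψ, h1, rfl⟩
  exact h1

lemma mem_coboundariesK {φ : Form EQ Q V (k + 1)} :
    φ ∈ ξ.coboundariesK ρ (k + 1) ↔ ∃ σ ∈ ξ.kerForms ρ k, C.covD ρ σ = φ :=
  ⟨fun ⟨σ, h1, h2⟩ => ⟨σ, h1, h2⟩, fun ⟨σ, h1, h2⟩ => ⟨⟨σ, h1.1.1.1⟩, h1, h2⟩⟩

lemma mem_cocyclesC {φ : Form EQ Q V k} :
    φ ∈ ξ.cocyclesC ρ α k ↔ φ ∈ ξ.horForms ρ k ∧
      ∃ ψ ∈ ξ.horForms ρ (k + 1), ξ.Xi ρ (k + 1) ψ = ξ.hatD ρ α φ := by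
  refine and_congr_right fun h => ⟨?_, fun ⟨ψ, h1, h2⟩ => ⟨⟨φ, h.1.1⟩, ⟨ψ, h1, h2⟩, rfl⟩⟩
  rintro ⟨_, ⟨ψ, h1, h2⟩, rfl⟩
  exact ⟨ψ, h1, h2⟩

lemma mem_coboundariesC_zero {φ : Form EQ Q V 0} :
    φ ∈ ξ.coboundariesC ρ α 0 ↔ ∃ χ ∈ ξ.horForms ρ 0, ξ.Xi ρ 0 χ = φ := Iff.rfl

lemma mem_coboundariesC_succ {φ : Form EQ Q V (k + 1)} :
    φ ∈ ξ.coboundariesC ρ α (k + 1) ↔ ∃ β ∈ ξ.horForms ρ k, ∃ χ ∈ ξ.horForms ρ (k + 1),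
      ξ.hatD ρ α β + ξ.Xi ρ (k + 1) χ = φ := by
  refine Submodule.mem_sup.trans ⟨?_, ?_⟩
  · rintro ⟨_, ⟨β, h1, rfl⟩, _, ⟨χ, h2, rfl⟩, h3⟩
    exact ⟨β, h1, χ, h2, h3⟩
  · rintro ⟨β, h1, χ, h2, h3⟩
    exact ⟨_, ⟨⟨β, h1.1.1⟩, h1, rfl⟩, _, ⟨χ, h2, rfl⟩, h3⟩

lemma hatD_eq (φ : Form EQ Q V k) :
    ξ.hatD ρ α φ = C.covD ρ φ - wedgeA α (ξ.insert (C.covD ρ φ)) := rfl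

lemma hatD_neg {φ : Form EQ Q V k} (hφ : φ ∈ C.bundleForms ρ k) :
    ξ.hatD ρ α (-φ) = -ξ.hatD ρ α φ :=
  (ξ.hatDLin ρ α k).map_neg ⟨φ, hφ⟩

lemma insert_wedgeA_of_mem_hor (hα : ξ.IsContactFormOf α) {φ : Form EQ Q V k}
    (hφ : φ ∈ ξ.horForms ρ k) : ξ.insert (wedgeA α φ) = φ := by
  cases k with
  | zero => exact insert_wedgeA_zero hα φ
  | succ k => rw [insert_wedgeA hα, (mem_horForms_succ.1 hφ).2, wedgeA_zero, sub_zero]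

namespace CartanCalculus

lemma insert_covD (H : ξ.CartanCalculus ρ) {φ : Form EQ Q V k} (hφ : φ ∈ ξ.horForms ρ k) :
    ξ.insert (C.covD ρ φ) = ξ.Xi ρ k φ := by
  cases k with
  | zero => exact H.cartan_zero hφ.1
  | succ k =>
    rw [← H.cartan_succ hφ.1, (mem_horForms_succ.1 hφ).2, covD_zero, add_zero]

lemma insert_mem_hor (H : ξ.CartanCalculus ρ) {φ : Form EQ Q V (k + 1)}
    (hφ : φ ∈ ξ.invForms ρ (k + 1)) : ξ.insert φ ∈ ξ.horForms ρ k := by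
  cases k with
  | zero => exact mem_horForms_zero.2 (H.insert_mem hφ)
  | succ k => exact mem_horForms_succ.2 ⟨H.insert_mem hφ, insert_insert φ⟩

lemma Xi_mem_hor (H : ξ.CartanCalculus ρ) {φ : Form EQ Q V k} (hφ : φ ∈ ξ.horForms ρ k) :
    ξ.Xi ρ k φ ∈ ξ.horForms ρ k := by
  cases k with
  | zero => exact mem_horForms_zero.2 (H.Xi_mem hφ.1)
  | succ k =>
    refine mem_horForms_succ.2 ⟨H.Xi_mem hφ.1, ?_⟩
    rw [insert_Xi, (mem_horForms_succ.1 hφ).2, map_zero]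

lemma hatD_mem_hor (H : ξ.CartanCalculus ρ) (hα : ξ.IsContactFormOf α) {φ : Form EQ Q V k}
    (hφ : φ ∈ ξ.horForms ρ k) : ξ.hatD ρ α φ ∈ ξ.horForms ρ (k + 1) := by
  refine mem_horForms_succ.2 ⟨?_, ?_⟩
  · exact sub_mem (H.covD_mem hφ.1) (wedgeA_mem_invForms hα (H.insert_mem (H.covD_mem hφ.1)))
  · rw [hatD_eq, insert_sub, insert_wedgeA_of_mem_hor hα (H.insert_mem_hor (H.covD_mem hφ.1)),
      sub_self]

lemma sub_wedgeA_mem_hor (H : ξ.CartanCalculus ρ) (hα : ξ.IsContactFormOf α)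
    {τ : Form EQ Q V (k + 1)} (hτ : τ ∈ ξ.invForms ρ (k + 1)) :
    τ - wedgeA α (ξ.insert τ) ∈ ξ.horForms ρ (k + 1) := by
  refine mem_horForms_succ.2 ⟨sub_mem hτ (wedgeA_mem_invForms hα (H.insert_mem hτ)), ?_⟩
  rw [insert_sub, insert_wedgeA_of_mem_hor hα (H.insert_mem_hor hτ), sub_self]

lemma hatD_eq_of_hor (H : ξ.CartanCalculus ρ) {φ : Form EQ Q V k} (hφ : φ ∈ ξ.horForms ρ k) :
    ξ.hatD ρ α φ = C.covD ρ φ - wedgeA α (ξ.Xi ρ k φ) := by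
  rw [hatD_eq, H.insert_covD hφ]

lemma wedgeD_eq (hα : ξ.IsContactFormOf α) {φ : Form EQ Q V k} (hφ : φ ∈ ξ.invForms ρ k) :
    wedgeD α φ = C.covD ρ (wedgeA α φ) + wedgeA α (C.covD ρ φ) := by
  rw [covD_wedgeA hα.mem.1 hφ.1.1, sub_add_cancel]

lemma wedgeD_mem_hor (H : ξ.CartanCalculus ρ) (hα : ξ.IsContactFormOf α) {φ : Form EQ Q V k}
    (hφ : φ ∈ ξ.horForms ρ k) : wedgeD α φ ∈ ξ.horForms ρ (k + 2) := by
  refine mem_horForms_succ.2 ⟨?_, ?_⟩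
  · rw [wedgeD_eq hα hφ.1]
    exact add_mem (H.covD_mem (wedgeA_mem_invForms hα hφ.1))
      (wedgeA_mem_invForms hα (H.covD_mem hφ.1))
  · cases k with
    | zero => exact insert_wedgeD_zero hα φ
    | succ k => rw [insert_wedgeD hα, (mem_horForms_succ.1 hφ).2, wedgeD_zero]

lemma wedgeD_Xi (H : ξ.CartanCalculus ρ) (hα : ξ.IsContactFormOf α) {φ : Form EQ Q V k}
    (hφ : φ ∈ ξ.invForms ρ k) :
    wedgeD α (ξ.Xi ρ k φ) = ξ.Xi ρ (k + 2) (wedgeD α φ) := by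
  rw [wedgeD_eq hα hφ, wedgeD_eq hα (H.Xi_mem hφ), map_add, Xi_wedgeA, ← Xi_wedgeA, H.covD_Xi hφ,
    H.covD_Xi (wedgeA_mem_invForms hα hφ)]

lemma hatD_Xi (H : ξ.CartanCalculus ρ) {φ : Form EQ Q V k}
    (hφ : φ ∈ ξ.horForms ρ k) : ξ.hatD ρ α (ξ.Xi ρ k φ) = ξ.Xi ρ (k + 1) (ξ.hatD ρ α φ) := by
  rw [hatD_eq, hatD_eq, H.covD_Xi hφ.1, insert_Xi, map_sub, Xi_wedgeA]

/-- The square of `d̂` on horizontal forms takes values in the image of `Ξ_*`. -/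
lemma hatD_hatD (H : ξ.CartanCalculus ρ) (hα : ξ.IsContactFormOf α) {φ : Form EQ Q V k}
    (hφ : φ ∈ ξ.horForms ρ k) :
    ξ.hatD ρ α (ξ.hatD ρ α φ) = ξ.Xi ρ (k + 2) (-wedgeD α φ) := by
  have hX := H.Xi_mem hφ.1
  have hd := H.covD_mem hφ.1
  rw [H.hatD_eq_of_hor (H.hatD_mem_hor hα hφ), H.hatD_eq_of_hor hφ,
    covD_sub hd.1.1 (wedgeA_mem_invForms hα hX).1.1, H.covD_covD hφ.1,
    covD_wedgeA hα.mem.1 hX.1.1, map_sub, Xi_wedgeA, wedgeA_sub, wedgeA_wedgeA, H.covD_Xi hφ.1,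
    H.wedgeD_Xi hα hφ.1, map_neg]
  abel

/-- The part of `d^∇ τ` which is not horizontal, in terms of the components of
`τ = α ∧ i_ξ τ + (τ - α ∧ i_ξ τ)`. -/
lemma insert_covD_eq (H : ξ.CartanCalculus ρ) {τ : Form EQ Q V (k + 1)}
    (hτ : τ ∈ ξ.invForms ρ (k + 1)) :
    ξ.insert (C.covD ρ τ) = ξ.Xi ρ (k + 1) (τ - wedgeA α (ξ.insert τ)) -
      ξ.hatD ρ α (ξ.insert τ) := by
  rw [H.hatD_eq_of_hor (H.insert_mem_hor hτ), eq_sub_of_add_eq (H.cartan_succ hτ), map_sub,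
    Xi_wedgeA]
  abel

/-- The derivative of `α ∧ φ + ψ` is horizontal if `d̂ φ = Ξ_* ψ`, and then represents the value of
the connecting homomorphism. -/
lemma covD_wedgeA_add (H : ξ.CartanCalculus ρ) (hα : ξ.IsContactFormOf α) {φ : Form EQ Q V k}
    (hφ : φ ∈ ξ.horForms ρ k) {ψ : Form EQ Q V (k + 1)} (hψ : ψ ∈ ξ.horForms ρ (k + 1))
    (h : ξ.hatD ρ α φ = ξ.Xi ρ (k + 1) ψ) :
    C.covD ρ (wedgeA α φ + ψ) = wedgeD α φ + ξ.hatD ρ α ψ := by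
  rw [C.covD_add ρ (wedgeA_mem_invForms hα hφ.1).1.1 hψ.1.1.1, covD_wedgeA hα.mem.1 hφ.1.1.1,
    H.hatD_eq_of_hor hψ, ← h, H.hatD_eq_of_hor hφ, wedgeA_sub, wedgeA_wedgeA]
  abel

/-- The coboundaries of the complex `(C^*, d̂)` are represented by the elements of
`i_ξ d^∇(A^*)`. -/
lemma mem_coboundariesC (H : ξ.CartanCalculus ρ) (hα : ξ.IsContactFormOf α) {φ : Form EQ Q V k} :
    φ ∈ ξ.coboundariesC ρ α k ↔ ∃ σ ∈ ξ.invForms ρ k, ξ.insert (C.covD ρ σ) = φ := by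
  cases k with
  | zero =>
    rw [mem_coboundariesC_zero]
    constructor
    · rintro ⟨χ, h1, h2⟩
      exact ⟨χ, h1.1, (H.insert_covD h1).trans h2⟩
    · rintro ⟨χ, h1, h2⟩
      exact ⟨χ, mem_horForms_zero.2 h1, (H.insert_covD (mem_horForms_zero.2 h1)).symm.trans h2⟩
  | succ k =>
    rw [mem_coboundariesC_succ]
    constructor
    · rintro ⟨β, h1, χ, h2, h3⟩
      have hβ := wedgeA_mem_invForms hα h1.1
      have hσ := sub_mem h2.1 hβ
      have hi : ξ.insert (χ - wedgeA α β) = -β := by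
        rw [insert_sub, (mem_horForms_succ.1 h2).2, insert_wedgeA_of_mem_hor hα h1, zero_sub]
      refine ⟨χ - wedgeA α β, hσ, ?_⟩
      have h4 : ξ.hatD ρ α (-β) = -ξ.hatD ρ α β := hatD_neg h1.1.1
      have h5 : wedgeA α (-β) = -wedgeA α β := by
        rw [← zero_sub, wedgeA_sub, wedgeA_zero, zero_sub]
      rw [H.insert_covD_eq (α := α) hσ, hi, h4, h5, ← h3]
      rw [sub_neg_eq_add, sub_neg_eq_add, sub_add_cancel]
      exact add_comm _ _
    · rintro ⟨σ, h1, h2⟩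
      refine ⟨-ξ.insert σ, neg_mem (H.insert_mem_hor h1), _, H.sub_wedgeA_mem_hor hα h1, ?_⟩
      have h4 : ξ.hatD ρ α (-ξ.insert σ) = -ξ.hatD ρ α (ξ.insert σ) :=
        hatD_neg (H.insert_mem_hor h1).1.1
      rw [h4, ← h2, H.insert_covD_eq (α := α) h1]
      abel

lemma covD_mem_kerForms (H : ξ.CartanCalculus ρ) {φ : Form EQ Q V k}
    (hφ : φ ∈ ξ.invForms ρ k) (h : ξ.insert (C.covD ρ φ) = 0) :
    C.covD ρ φ ∈ ξ.kerForms ρ (k + 1) := by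
  have h1 : C.covD ρ φ ∈ ξ.horForms ρ (k + 1) := mem_horForms_succ.2 ⟨H.covD_mem hφ, h⟩
  refine mem_kerForms.2 ⟨h1, ?_⟩
  rw [← H.insert_covD h1, H.covD_covD hφ]
  rfl

lemma mem_kerForms_of_insert (H : ξ.CartanCalculus ρ) {φ : Form EQ Q V (k + 1)}
    (hφ : φ ∈ ξ.invForms ρ (k + 1)) (h : ξ.insert φ = 0) (h' : ξ.insert (C.covD ρ φ) = 0) :
    φ ∈ ξ.kerForms ρ (k + 1) := by
  have h1 : φ ∈ ξ.horForms ρ (k + 1) := mem_horForms_succ.2 ⟨hφ, h⟩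
  exact mem_kerForms.2 ⟨h1, (H.insert_covD h1).symm.trans h'⟩

/-- The elements of `A^{k+1}` whose derivatives lie in `K^{k+2}`. -/
def liftForms (ξ : C.InfAut) (ρ : G →* (V →L[ℝ] V)) (k : ℕ) :
    Submodule ℝ (Form EQ Q V (k + 1)) where
  carrier := {τ | τ ∈ ξ.invForms ρ (k + 1) ∧ ξ.insert (C.covD ρ τ) = 0}
  add_mem' := by
    rintro τ τ' ⟨h1, h2⟩ ⟨h1', h2'⟩
    refine ⟨add_mem h1 h1', ?_⟩
    rw [C.covD_add ρ h1.1.1 h1'.1.1, insert_add, h2, h2', add_zero]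
  zero_mem' := ⟨zero_mem _, by rw [covD_zero]; rfl⟩
  smul_mem' := by
    rintro a τ ⟨h1, h2⟩
    refine ⟨Submodule.smul_mem _ a h1, ?_⟩
    have h3 : ξ.insert (a • C.covD ρ τ) = a • ξ.insert (C.covD ρ τ) := rfl
    rw [C.covD_smul ρ, h3, h2, smul_zero]

lemma insert_mem_cocyclesC (H : ξ.CartanCalculus ρ) (hα : ξ.IsContactFormOf α)
    {τ : Form EQ Q V (k + 1)} (hτ : τ ∈ liftForms ξ ρ k) :
    ξ.insert τ ∈ ξ.cocyclesC ρ α k := by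
  refine mem_cocyclesC.2 ⟨H.insert_mem_hor hτ.1, _, H.sub_wedgeA_mem_hor hα hτ.1, ?_⟩
  exact sub_eq_zero.1 ((H.insert_covD_eq hτ.1).symm.trans hτ.2)

lemma wedgeA_add_mem_liftForms (H : ξ.CartanCalculus ρ) (hα : ξ.IsContactFormOf α)
    {φ : Form EQ Q V k} (hφ : φ ∈ ξ.horForms ρ k) {ψ : Form EQ Q V (k + 1)}
    (hψ : ψ ∈ ξ.horForms ρ (k + 1)) (h : ξ.hatD ρ α φ = ξ.Xi ρ (k + 1) ψ) :
    wedgeA α φ + ψ ∈ liftForms ξ ρ k ∧ ξ.insert (wedgeA α φ + ψ) = φ := by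
  have h1 : ξ.insert (wedgeA α φ + ψ) = φ := by
    rw [insert_add, insert_wedgeA_of_mem_hor hα hφ, (mem_horForms_succ.1 hψ).2, add_zero]
  have h2 := add_mem (wedgeA_mem_invForms hα hφ.1) hψ.1
  refine ⟨⟨h2, ?_⟩, h1⟩
  rw [H.insert_covD_eq (α := α) h2, h1, add_sub_cancel_left, h, sub_self]

lemma covD_mem_cocyclesK (H : ξ.CartanCalculus ρ) {τ : Form EQ Q V (k + 1)}
    (hτ : τ ∈ liftForms ξ ρ k) : C.covD ρ τ ∈ ξ.cocyclesK ρ (k + 2) :=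
  mem_cocyclesK.2 ⟨H.covD_mem_kerForms hτ.1 hτ.2, H.covD_covD hτ.1⟩

lemma cocyclesK_le (φ : Form EQ Q V k) (h : φ ∈ ξ.cocyclesK ρ k) : φ ∈ ξ.cocyclesA ρ k :=
  mem_cocyclesA.2 ⟨h.1.1.1, (mem_cocyclesK.1 h).2⟩

lemma cocyclesA_le (φ : Form EQ Q V (k + 1)) (h : φ ∈ ξ.cocyclesA ρ (k + 1)) :
    φ ∈ liftForms ξ ρ k :=
  ⟨h.1, by rw [(mem_cocyclesA.1 h).2]; rfl⟩

lemma classA_eq_zero {φ : Form EQ Q V k} {h : φ ∈ ξ.cocyclesA ρ k} :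
    ξ.classA ρ φ h = 0 ↔ φ ∈ ξ.coboundariesA ρ k :=
  (Submodule.Quotient.mk_eq_zero _).trans Iff.rfl

lemma classK_eq_zero {φ : Form EQ Q V k} {h : φ ∈ ξ.cocyclesK ρ k} :
    ξ.classK ρ φ h = 0 ↔ φ ∈ ξ.coboundariesK ρ k :=
  (Submodule.Quotient.mk_eq_zero _).trans Iff.rfl

lemma classC_eq_zero {φ : Form EQ Q V k} {h : φ ∈ ξ.cocyclesC ρ α k} :
    ξ.classC ρ α φ h = 0 ↔ φ ∈ ξ.coboundariesC ρ α k :=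
  (Submodule.Quotient.mk_eq_zero _).trans Iff.rfl

/-- The map in cohomology induced by the inclusion `K^* → A^*`. -/
lemma exists_inclusion (ξ : C.InfAut) (ρ : G →* (V →L[ℝ] V)) (k : ℕ) :
    ∃ j : ξ.cohK ρ k →ₗ[ℝ] ξ.cohA ρ k, ∀ (φ : Form EQ Q V k) (h : φ ∈ ξ.cocyclesK ρ k),
      j (ξ.classK ρ φ h) = ξ.classA ρ φ (cocyclesK_le φ h) := by
  obtain ⟨j, hj⟩ := exists_linearMap_comp_eq
    ((ξ.coboundariesK ρ k).submoduleOf (ξ.cocyclesK ρ k)).mkQ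
    (((ξ.coboundariesA ρ k).submoduleOf (ξ.cocyclesA ρ k)).mkQ.comp
      (Submodule.inclusion cocyclesK_le)) (Submodule.mkQ_surjective _) (by
      rintro ⟨φ, h⟩ h0
      have h1 : φ ∈ ξ.coboundariesK ρ k := classK_eq_zero.1 h0
      refine classA_eq_zero.2 ?_
      cases k with
      | zero => exact h1
      | succ k =>
        obtain ⟨σ, h2, h3⟩ := mem_coboundariesK.1 h1
        exact mem_coboundariesA.2 ⟨σ, h2.1.1, h3⟩)
  exact ⟨j, fun φ h => hj ⟨φ, h⟩⟩

/-- The map in cohomology induced by the insertion of `ξ`. -/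
lemma exists_insertion (H : ξ.CartanCalculus ρ) (hα : ξ.IsContactFormOf α) (k : ℕ) :
    ∃ π : ξ.cohA ρ (k + 1) →ₗ[ℝ] ξ.cohC ρ α k,
      ∀ (τ : Form EQ Q V (k + 1)) (h : τ ∈ ξ.cocyclesA ρ (k + 1)),
        π (ξ.classA ρ τ h) =
          ξ.classC ρ α (ξ.insert τ) (H.insert_mem_cocyclesC hα (cocyclesA_le τ h)) := by
  let g : ξ.cocyclesA ρ (k + 1) →ₗ[ℝ] ξ.cocyclesC ρ α k :=
    { toFun := fun τ => ⟨ξ.insert τ.1, H.insert_mem_cocyclesC hα (cocyclesA_le τ.1 τ.2)⟩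
      map_add' := fun _ _ => rfl
      map_smul' := fun _ _ => rfl }
  obtain ⟨π, hπ⟩ := exists_linearMap_comp_eq
    ((ξ.coboundariesA ρ (k + 1)).submoduleOf (ξ.cocyclesA ρ (k + 1))).mkQ
    (((ξ.coboundariesC ρ α k).submoduleOf (ξ.cocyclesC ρ α k)).mkQ.comp g)
    (Submodule.mkQ_surjective _) (by
      rintro ⟨τ, h⟩ h0
      obtain ⟨σ, h2, h3⟩ := mem_coboundariesA.1 (classA_eq_zero.1 h0)
      exact classC_eq_zero.2 ((H.mem_coboundariesC hα).2 ⟨σ, h2, congrArg ξ.insert h3⟩))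
  exact ⟨π, fun φ h => hπ ⟨φ, h⟩⟩

/-- The connecting homomorphism: the class of `i_ξ τ` is mapped to the class of `d^∇ τ`. -/
lemma exists_connecting (H : ξ.CartanCalculus ρ) (hα : ξ.IsContactFormOf α) (k : ℕ) :
    ∃ δ : ξ.cohC ρ α k →ₗ[ℝ] ξ.cohK ρ (k + 2),
      ∀ (τ : Form EQ Q V (k + 1)) (h : τ ∈ liftForms ξ ρ k),
        δ (ξ.classC ρ α (ξ.insert τ) (H.insert_mem_cocyclesC hα h)) =
          ξ.classK ρ (C.covD ρ τ) (H.covD_mem_cocyclesK h) := by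
  let f : liftForms ξ ρ k →ₗ[ℝ] ξ.cocyclesC ρ α k :=
    { toFun := fun τ => ⟨ξ.insert τ.1, H.insert_mem_cocyclesC hα τ.2⟩
      map_add' := fun _ _ => rfl
      map_smul' := fun _ _ => rfl }
  let g : liftForms ξ ρ k →ₗ[ℝ] ξ.cocyclesK ρ (k + 2) :=
    { toFun := fun τ => ⟨C.covD ρ τ.1, H.covD_mem_cocyclesK τ.2⟩
      map_add' := fun τ τ' => Subtype.ext (C.covD_add ρ τ.2.1.1.1 τ'.2.1.1.1)
      map_smul' := fun a τ => Subtype.ext (C.covD_smul ρ a τ.1) }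
  have hf : Function.Surjective f := by
    rintro ⟨φ, hφ⟩
    obtain ⟨h1, ψ, h2, h3⟩ := mem_cocyclesC.1 hφ
    obtain ⟨h4, h5⟩ := H.wedgeA_add_mem_liftForms hα h1 h2 h3.symm
    exact ⟨⟨_, h4⟩, Subtype.ext h5⟩
  obtain ⟨δ, hδ⟩ := exists_linearMap_comp_eq
    (((ξ.coboundariesC ρ α k).submoduleOf (ξ.cocyclesC ρ α k)).mkQ.comp f)
    (((ξ.coboundariesK ρ (k + 2)).submoduleOf (ξ.cocyclesK ρ (k + 2))).mkQ.comp g)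
    ((Submodule.mkQ_surjective _).comp hf) (by
      rintro ⟨τ, h⟩ h0
      obtain ⟨σ, h1, h2⟩ := (H.mem_coboundariesC hα).1 (classC_eq_zero.1 h0)
      have hd := H.covD_mem h1
      have h3 : C.covD ρ (τ - C.covD ρ σ) = C.covD ρ τ := by
        rw [covD_sub h.1.1.1 hd.1.1, H.covD_covD h1, sub_zero]
      refine classK_eq_zero.2 (mem_coboundariesK.2 ⟨τ - C.covD ρ σ, ?_, h3⟩)
      refine H.mem_kerForms_of_insert (sub_mem h.1 hd) ?_ ?_
      · rw [insert_sub, h2]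
        exact sub_self _
      · rw [h3]
        exact h.2)
  exact ⟨δ, fun τ h => hδ ⟨τ, h⟩⟩

/-- The long exact sequence, written in terms of representatives. -/
theorem exists_longExactSequence (H : ξ.CartanCalculus ρ) (hα : ξ.IsContactFormOf α) :
    ∃ (j : ∀ k, ξ.cohK ρ k →ₗ[ℝ] ξ.cohA ρ k)
      (π : ∀ k, ξ.cohA ρ (k + 1) →ₗ[ℝ] ξ.cohC ρ α k)
      (δ : ∀ k, ξ.cohC ρ α k →ₗ[ℝ] ξ.cohK ρ (k + 2)),
      (∀ (k : ℕ) (φ : Form EQ Q V k) (h : φ ∈ ξ.cocyclesK ρ k),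
        ∃ h' : φ ∈ ξ.cocyclesA ρ k, j k (ξ.classK ρ φ h) = ξ.classA ρ φ h') ∧
      (∀ (k : ℕ) (τ : Form EQ Q V (k + 1)) (h : τ ∈ ξ.cocyclesA ρ (k + 1)),
        ∃ h' : ξ.insert τ ∈ ξ.cocyclesC ρ α k,
          π k (ξ.classA ρ τ h) = ξ.classC ρ α (ξ.insert τ) h') ∧
      (∀ (k : ℕ) (φ : Form EQ Q V k) (h : φ ∈ ξ.cocyclesC ρ α k),
        ∀ ψ ∈ ξ.horForms ρ (k + 1), ξ.hatD ρ α φ = ξ.Xi ρ (k + 1) ψ →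
          ∃ h' : wedgeD α φ + ξ.hatD ρ α ψ ∈ ξ.cocyclesK ρ (k + 2),
            δ k (ξ.classC ρ α φ h) = ξ.classK ρ _ h') ∧
      Function.Bijective (j 0) ∧ Function.Injective (j 1) ∧
      (∀ k, Function.Exact (j (k + 1)) (π k)) ∧
      (∀ k, Function.Exact (π k) (δ k)) ∧
      (∀ k, Function.Exact (δ k) (j (k + 2))) := by
  choose j hj using fun k => exists_inclusion ξ ρ k
  choose π hπ using fun k => H.exists_insertion hα k
  choose δ hδ using fun k => H.exists_connecting hα k
  have congrC : ∀ {k : ℕ} {φ φ' : Form EQ Q V k} (e : φ = φ') (h : φ ∈ ξ.cocyclesC ρ α k)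
      (h' : φ' ∈ ξ.cocyclesC ρ α k), ξ.classC ρ α φ h = ξ.classC ρ α φ' h' := by
    rintro k φ _ rfl h h'; rfl
  have congrK : ∀ {k : ℕ} {φ φ' : Form EQ Q V k} (e : φ = φ') (h : φ ∈ ξ.cocyclesK ρ k)
      (h' : φ' ∈ ξ.cocyclesK ρ k), ξ.classK ρ φ h = ξ.classK ρ φ' h' := by
    rintro k φ _ rfl h h'; rfl
  have congrA : ∀ {k : ℕ} {φ φ' : Form EQ Q V k} (h : φ ∈ ξ.cocyclesA ρ k)
      (h' : φ' ∈ ξ.cocyclesA ρ k), φ - φ' ∈ ξ.coboundariesA ρ k →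
      ξ.classA ρ φ h = ξ.classA ρ φ' h' := by
    intro k φ φ' h h' hs
    exact (Submodule.Quotient.eq _).2 hs
  refine ⟨j, π, δ, fun k φ h => ⟨_, hj k φ h⟩, fun k τ h => ⟨_, hπ k τ h⟩, ?_, ⟨?_, ?_⟩, ?_,
    ?_, ?_, ?_⟩
  · intro k φ h ψ hψ he
    have hφ := (mem_cocyclesC.1 h).1
    obtain ⟨h1, h2⟩ := H.wedgeA_add_mem_liftForms hα hφ hψ he
    have h3 := H.covD_wedgeA_add hα hφ hψ he
    have h4 : wedgeD α φ + ξ.hatD ρ α ψ ∈ ξ.cocyclesK ρ (k + 2) := h3 ▸ H.covD_mem_cocyclesK h1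
    refine ⟨h4, ?_⟩
    exact (congrArg (δ k) (congrC h2.symm h (H.insert_mem_cocyclesC hα h1))).trans
      ((hδ k _ h1).trans (congrK h3 _ _))
  · rw [injective_iff_map_eq_zero]
    intro x hx
    obtain ⟨⟨φ, h⟩, rfl⟩ := Submodule.mkQ_surjective _ x
    exact classK_eq_zero.2 (classA_eq_zero.1 ((hj 0 φ h).symm.trans hx))
  · -- a closed form in `A^0` satisfies `Ξ_* φ = i_ξ d^∇ φ = 0`
    intro x
    obtain ⟨⟨φ, h⟩, rfl⟩ := Submodule.mkQ_surjective _ x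
    obtain ⟨h1, h2⟩ := mem_cocyclesA.1 h
    have h3 : φ ∈ ξ.cocyclesK ρ 0 := by
      refine mem_cocyclesK.2 ⟨mem_kerForms.2 ⟨mem_horForms_zero.2 h1, ?_⟩, h2⟩
      rw [← H.cartan_zero h1, h2]
      rfl
    exact ⟨ξ.classK ρ φ h3, hj 0 φ h3⟩
  · -- if `d^∇ σ` is horizontal for `σ ∈ A^0`, then `Ξ_* σ = i_ξ d^∇ σ = 0`
    rw [injective_iff_map_eq_zero]
    intro x hx
    obtain ⟨⟨φ, h⟩, rfl⟩ := Submodule.mkQ_surjective _ x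
    obtain ⟨σ, h1, h2⟩ := mem_coboundariesA.1 (classA_eq_zero.1 ((hj 1 φ h).symm.trans hx))
    refine classK_eq_zero.2 (mem_coboundariesK.2 ⟨σ, ?_, h2⟩)
    refine mem_kerForms.2 ⟨mem_horForms_zero.2 h1, ?_⟩
    rw [← H.cartan_zero h1, h2]
    exact (mem_horForms_succ.1 h.1.1).2
  · -- if `i_ξ τ = i_ξ d^∇ σ`, then `τ - d^∇ σ` is a cocycle of `K^*` in the class of `τ`
    intro k x
    obtain ⟨⟨τ, h⟩, rfl⟩ := Submodule.mkQ_surjective _ x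
    constructor
    · intro hx
      obtain ⟨σ, h1, h2⟩ := (H.mem_coboundariesC hα).1
        (classC_eq_zero.1 ((hπ k τ h).symm.trans hx))
      have hd := H.covD_mem h1
      have h3 : C.covD ρ (τ - C.covD ρ σ) = 0 := by
        rw [covD_sub h.1.1.1 hd.1.1, H.covD_covD h1, (mem_cocyclesA.1 h).2, sub_zero]
      have h4 : τ - C.covD ρ σ ∈ ξ.cocyclesK ρ (k + 1) := by
        refine mem_cocyclesK.2 ⟨H.mem_kerForms_of_insert (sub_mem h.1 hd) ?_ ?_, h3⟩
        · rw [insert_sub, h2]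
          exact sub_self _
        · rw [h3]
          rfl
      refine ⟨ξ.classK ρ _ h4, (hj (k + 1) _ h4).trans (congrA _ _ ?_)⟩
      refine mem_coboundariesA.2 ⟨-σ, neg_mem h1, ?_⟩
      rw [← neg_one_smul ℝ σ, covD_smul, neg_one_smul]
      abel
    · rintro ⟨y, hy⟩
      obtain ⟨⟨φ, h'⟩, rfl⟩ := Submodule.mkQ_surjective _ y
      rw [← hy]
      refine (congrArg (π k) (hj (k + 1) φ h')).trans ((hπ k φ _).trans (classC_eq_zero.2 ?_))
      rw [(mem_horForms_succ.1 h'.1.1).2]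
      exact zero_mem _
  · -- if `d^∇ (α ∧ φ + ψ) = d^∇ μ` with `μ ∈ K^{k+1}`, then `α ∧ φ + ψ - μ` is a cocycle of `A^*`
    -- which is mapped to the class of `φ`
    intro k x
    constructor
    · intro hx
      obtain ⟨⟨φ, h⟩, rfl⟩ := Submodule.mkQ_surjective _ x
      obtain ⟨h1, ψ, h2, h3⟩ := mem_cocyclesC.1 h
      obtain ⟨h4, h5⟩ := H.wedgeA_add_mem_liftForms hα h1 h2 h3.symm
      have h6 : ξ.classC ρ α φ h = ξ.classC ρ α _ (H.insert_mem_cocyclesC hα h4) :=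
        congrC h5.symm _ _
      have h7 := (hδ k _ h4).symm.trans ((congrArg (δ k) h6.symm).trans hx)
      obtain ⟨μ, h8, h9⟩ := mem_coboundariesK.1 (classK_eq_zero.1 h7)
      have h10 : wedgeA α φ + ψ - μ ∈ ξ.cocyclesA ρ (k + 1) := by
        refine mem_cocyclesA.2 ⟨sub_mem h4.1 h8.1.1, ?_⟩
        rw [covD_sub h4.1.1.1 h8.1.1.1.1, h9, sub_self]
      refine ⟨ξ.classA ρ _ h10, (hπ k _ h10).trans (congrC ?_ _ _)⟩
      rw [insert_sub, h5, (mem_horForms_succ.1 h8.1).2, sub_zero]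
    · rintro ⟨y, rfl⟩
      obtain ⟨⟨τ, h⟩, rfl⟩ := Submodule.mkQ_surjective _ y
      refine (congrArg (δ k) (hπ k τ h)).trans ((hδ k τ (cocyclesA_le τ h)).trans
        (classK_eq_zero.2 ?_))
      rw [(mem_cocyclesA.1 h).2]
      exact zero_mem _
  · -- if `κ = d^∇ σ` with `σ ∈ A^{k+1}`, then the class of `κ` is the image of that of `i_ξ σ`
    intro k x
    constructor
    · intro hx
      obtain ⟨⟨κ, h⟩, rfl⟩ := Submodule.mkQ_surjective _ x
      obtain ⟨σ, h1, h2⟩ := mem_coboundariesA.1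
        (classA_eq_zero.1 ((hj (k + 2) κ h).symm.trans hx))
      have h3 : σ ∈ liftForms ξ ρ k := ⟨h1, by rw [h2]; exact (mem_horForms_succ.1 h.1.1).2⟩
      exact ⟨_, (hδ k σ h3).trans (congrK h2 _ _)⟩
    · rintro ⟨y, rfl⟩
      obtain ⟨⟨φ, h⟩, rfl⟩ := Submodule.mkQ_surjective _ y
      obtain ⟨h1, ψ, h2, h3⟩ := mem_cocyclesC.1 h
      obtain ⟨h4, h5⟩ := H.wedgeA_add_mem_liftForms hα h1 h2 h3.symm
      have h6 : ξ.classC ρ α φ h = ξ.classC ρ α _ (H.insert_mem_cocyclesC hα h4) :=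
        congrC h5.symm _ _
      refine (congrArg (j (k + 2)) ((congrArg (δ k) h6).trans (hδ k _ h4))).trans
        ((hj (k + 2) _ _).trans (classA_eq_zero.2 ?_))
      exact mem_coboundariesA.2 ⟨_, h4.1, rfl⟩

end CartanCalculus

end InfAut

end CartanGeometry

end ExactSequence

/-! ### The contact form of a transverse normal infinitesimal automorphism -/

section ContactForm

open Filter Topology

namespace ContactGrading

variable {L : Type*} [LieRing L] [LieAlgebra ℝ L] (c : ContactGrading L)

lemma filt_mono {i j : ℤ} (h : i ≤ j) : c.filt j ≤ c.filt i :=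
  iSup_mono fun _ => iSup_le fun hl => le_iSup_of_le (h.trans hl) le_rfl

lemma isCompl_filt_neg_one : IsCompl (c.filt (-1)) (c.gr (-2)) := by
  constructor
  · refine ((c.isInternal.submodule_iSupIndep (-2)).symm).mono_left ?_
    exact iSup_mono fun j => iSup_le fun hj => le_iSup_of_le (by omega) le_rfl
  · rw [codisjoint_iff, eq_top_iff, ← c.isInternal.submodule_iSup_eq_top]
    refine iSup_le fun j => ?_
    rcases lt_trichotomy j (-2) with h | h | h
    · rw [c.eq_bot j (by rw [abs_of_neg (by omega)]; omega)]
      exact bot_le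
    · rw [h]
      exact le_sup_right
    · exact le_sup_of_le_left (le_iSup₂_of_le j (by omega) le_rfl)

/-- Since `𝔤₋₂` is one-dimensional, `𝔤^{-1}` is the kernel of a linear functional. -/
lemma exists_functional : ∃ l : L →ₗ[ℝ] ℝ, ∀ X, l X = 0 ↔ X ∈ c.filt (-1) := by
  have h1 : Module.Finite ℝ (c.gr (-2)) :=
    Module.finite_of_finrank_pos (by rw [c.finrank_neg_two]; exact one_pos)
  let e : c.gr (-2) ≃ₗ[ℝ] ℝ := LinearEquiv.ofFinrankEq _ _
    (c.finrank_neg_two.trans (Module.finrank_self ℝ).symm)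
  let e' := (Submodule.quotientEquivOfIsCompl _ _ c.isCompl_filt_neg_one).trans e
  refine ⟨e'.toLinearMap.comp (c.filt (-1)).mkQ, fun X => ?_⟩
  rw [LinearMap.comp_apply, LinearEquiv.coe_toLinearMap, LinearEquiv.map_eq_zero_iff,
    Submodule.mkQ_apply, Submodule.Quotient.mk_eq_zero]

end ContactGrading

namespace CartanGeometry

variable {EG G EP P EQ EM : Type*}
  [NormedAddCommGroup EG] [NormedSpace ℝ EG] [FiniteDimensional ℝ EG]
  [TopologicalSpace G] [ChartedSpace EG G] [Group G] [LieGroup 𝓘(ℝ, EG) ∞ G]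
  [NormedAddCommGroup EP] [NormedSpace ℝ EP]
  [TopologicalSpace P] [ChartedSpace EP P] [Group P]
  [NormedAddCommGroup EQ] [NormedSpace ℝ EQ] [FiniteDimensional ℝ EQ]
  [NormedAddCommGroup EM] [NormedSpace ℝ EM]
  {c : ContactGrading (LieAlg EG G)} {S : ParabolicSubgroup c EP P} {Q M : Type*}
  [TopologicalSpace Q] [ChartedSpace EQ Q] [IsManifold 𝓘(ℝ, EQ) ∞ Q]
  [TopologicalSpace M] [ChartedSpace EM M]
  {C : CartanGeometry S EQ Q EM M}

namespace InfAut

variable {ξ : C.InfAut}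

lemma alternatize_zero {E V : Type*} [NormedAddCommGroup E] [NormedSpace ℝ E]
    [NormedAddCommGroup V] [NormedSpace ℝ V] {k : ℕ} :
    ContinuousAlternatingMap.alternatizeUncurryFin (0 : E →L[ℝ] E [⋀^Fin k]→L[ℝ] V) = 0 :=
  map_zero (ContinuousAlternatingMap.alternatizeUncurryFinCLM ℝ E V)

/-- Linear functionals as alternating maps in one variable. -/
def ofLin (E : Type*) [NormedAddCommGroup E] [NormedSpace ℝ E] :
    (E →L[ℝ] ℝ) →L[ℝ] (E [⋀^Fin 1]→L[ℝ] ℝ) :=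
  (ContinuousAlternatingMap.ofSubsingletonLIE (𝕜 := ℝ) (E := E) (F := ℝ)
    (0 : Fin 1)).toContinuousLinearEquiv.toContinuousLinearMap

lemma ext_one {E : Type*} [NormedAddCommGroup E] [NormedSpace ℝ E] {β β' : E [⋀^Fin 1]→L[ℝ] ℝ}
    (h : ∀ v, β ![v] = β' ![v]) : β = β' := by
  ext v
  have : v = ![v 0] := by ext i; fin_cases i; rfl
  rw [this]
  exact h _

lemma sec_notMem (hξ : ξ.IsTransverse) (u : Q) : ξ.sec u ∉ c.filt (-1) := fun h =>
  hξ u ⟨ξ.lift u, h, ξ.mfderiv_proj u⟩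

lemma isContactFormOf_unique {α α' : Form EQ Q ℝ 1} (hα : ξ.IsContactFormOf α)
    (hα' : ξ.IsContactFormOf α') : α = α' := by
  funext u
  refine ext_one fun v => ?_
  have h1 : toLin EQ (α u) (ξ.liftE u) = 1 := hα.insert_eq_one u
  have h2 : toLin EQ (α' u) (ξ.liftE u) = 1 := hα'.insert_eq_one u
  have h3 : toLin EQ (α u) (v - toLin EQ (α u) v • ξ.liftE u) = 0 := by
    rw [map_sub, map_smul, h1, smul_eq_mul, mul_one, sub_self]
  have h4 : toLin EQ (α' u) (v - toLin EQ (α u) v • ξ.liftE u) = 0 :=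
    (hα'.eq_zero_iff u _).2 ((hα.eq_zero_iff u _).1 h3)
  rw [map_sub, map_smul, h2, smul_eq_mul, mul_one] at h4
  exact (sub_eq_zero.1 h4).symm

lemma infRep_trivial : infRep' EG (1 : G →* (ℝ →L[ℝ] ℝ)) = 0 :=
  mder_const (E := EG) (E' := ℝ →L[ℝ] ℝ) (1 : ℝ →L[ℝ] ℝ) (1 : G)

lemma covD_trivial {k : ℕ} (φ : Form EQ Q ℝ k) :
    C.covD (1 : G →* (ℝ →L[ℝ] ℝ)) φ = extD φ := by
  funext u
  have h1 : C.connAct (1 : G →* (ℝ →L[ℝ] ℝ)) φ u = 0 := by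
    rw [connAct_eq, infRep_trivial]
    ext v x
    rfl
  rw [covD, h1, alternatize_zero, add_zero]

/-- The one-form on `Q` induced by the Cartan connection and a functional on the Lie algebra `𝔤`,
normalized in such a way that its value on `ξ̃` is one. -/
def reebForm (ξ : C.InfAut) (l : EG →L[ℝ] ℝ) : Form EQ Q ℝ 1 := fun u =>
  (l (ξ.secE u))⁻¹ • ofLin EQ (l.comp (C.connE u).toContinuousLinearMap)

lemma reebForm_apply (l : EG →L[ℝ] ℝ) (u : Q) (v : Fin 1 → EQ) :
    ξ.reebForm l u v = (l (ξ.secE u))⁻¹ * l (C.connE u (v 0)) := rfl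

variable {l : EG →L[ℝ] ℝ}

lemma functional_secE_ne (hl : ∀ X : LieAlg EG G, l X = 0 ↔ X ∈ c.filt (-1))
    (hξ : ξ.IsTransverse) (u : Q) : l (ξ.secE u) ≠ 0 := fun h => sec_notMem hξ u ((hl _).1 h)

lemma isSmoothForm_reebForm (hl : ∀ X : LieAlg EG G, l X = 0 ↔ X ∈ c.filt (-1))
    (hξ : ξ.IsTransverse) : IsSmoothForm (ξ.reebForm l) := by
  intro u
  have h1 : ContDiffOn ℝ ∞ (fun y => (l (ξ.secE ((extChartAt 𝓘(ℝ, EQ) u).symm y)))⁻¹)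
      (extChartAt 𝓘(ℝ, EQ) u).target :=
    (l.contDiff.comp_contDiffOn (ξ.contDiffOn_secE u)).inv fun y _ => functional_secE_ne hl hξ _
  have h2 : ContDiffOn ℝ ∞ (fun y => ofLin EQ (l.comp (C.connRep u y)))
      (extChartAt 𝓘(ℝ, EQ) u).target :=
    (ofLin EQ).contDiff.comp_contDiffOn (contDiffOn_const.clm_comp (C.contDiffOn_connRep u))
  exact (h1.smul h2).congr fun _ _ => rfl

/-- The adjoint action of `P` preserves `𝔤^{-1}`, so it rescales the functional `l`; this does not
affect the Reeb form. -/
lemma reebForm_act (hl : ∀ X : LieAlg EG G, l X = 0 ↔ X ∈ c.filt (-1))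
    (hξ : ξ.IsTransverse) (u : Q) (h : P) (v : EQ) :
    (l (ξ.secE (C.act u h)))⁻¹ * l (C.connE (C.act u h) (C.actDeriv h u v)) =
      (l (ξ.secE u))⁻¹ * l (C.connE u v) := by
  have hn := functional_secE_ne hl hξ u
  have hn' := functional_secE_ne hl hξ (C.act u h)
  set r := (l (ξ.secE u))⁻¹ * l (C.connE u v) with hr
  have h1 : l (C.connE u v - r • ξ.secE u) = 0 := by
    rw [map_sub, map_smul, smul_eq_mul, hr, mul_right_comm, inv_mul_cancel₀ hn, one_mul, sub_self]
  let A : EG →L[ℝ] EG := Ad (S.incl h⁻¹)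
  have h2 : l (A (C.connE u v - r • ξ.secE u)) = 0 :=
    (hl _).2 (S.ad_mem h⁻¹ (-1) _ ((hl _).1 h1))
  have h3 : A (C.connE u v) = C.connE (C.act u h) (C.actDeriv h u v) :=
    (C.connE_actDeriv u h v).symm
  have h4 : A (ξ.secE u) = ξ.secE (C.act u h) := (ξ.secE_act u h).symm
  rw [map_sub, map_smul, h3, h4, map_sub, map_smul, smul_eq_mul, sub_eq_zero] at h2
  rw [h2, mul_comm, mul_assoc, mul_inv_cancel₀ hn', mul_one]

lemma reebForm_mem (hl : ∀ X : LieAlg EG G, l X = 0 ↔ X ∈ c.filt (-1))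
    (hξ : ξ.IsTransverse) : ξ.reebForm l ∈ C.bundleForms (1 : G →* (ℝ →L[ℝ] ℝ)) 1 := by
  refine ⟨isSmoothForm_reebForm hl hξ, fun u h => ?_, ?_⟩
  · ext v
    exact reebForm_act hl hξ u h (v 0)
  · rintro u v ⟨i, hi⟩
    rw [Subsingleton.elim i 0] at hi
    have h1 : l (C.connE u (v 0)) = 0 := (hl _).2 (c.filt_mono (by norm_num) hi)
    rw [reebForm_apply, h1, mul_zero]

lemma reebForm_insert (hl : ∀ X : LieAlg EG G, l X = 0 ↔ X ∈ c.filt (-1))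
    (hξ : ξ.IsTransverse) (u : Q) : ξ.reebForm l u ![ξ.lift u] = 1 :=
  inv_mul_cancel₀ (functional_secE_ne hl hξ u)

/-- The Reeb form is preserved by the flow of `ξ`, since `s` is constant along `ξ`. -/
lemma reebForm_mem_invForms (hl : ∀ X : LieAlg EG G, l X = 0 ↔ X ∈ c.filt (-1))
    (hξ : ξ.IsTransverse) (hn : ξ.IsNormal) :
    ξ.reebForm l ∈ ξ.invForms (1 : G →* (ℝ →L[ℝ] ℝ)) 1 := by
  refine ⟨reebForm_mem hl hξ, fun u X => ?_⟩
  let f : EG → ℝ := fun x => (l x)⁻¹ * l (X 0)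
  have hf : DifferentiableAt ℝ f (ξ.secE u) :=
    (l.differentiableAt.inv (functional_secE_ne hl hξ u)).mul_const _
  have h1 : (fun u' : Q => ξ.reebForm l u' (fun i => C.constFieldE (X i) u')) = f ∘ ξ.secE := by
    funext u'
    exact congrArg (fun x => (l (ξ.secE u'))⁻¹ * l x) ((C.connE u').apply_symm_apply (X 0))
  have h2 := hf.mdifferentiableAt.comp u (ξ.mdifferentiableAt_secE u)
  have h3 := mder_comp (E := EQ) (E' := EG) (E'' := ℝ) (g := f) u hf.mdifferentiableAt
    (ξ.mdifferentiableAt_secE u)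
  have h4 : mder EQ EG ξ.secE u (ξ.liftE u) = 0 := by
    rw [ξ.mder_secE hn]
    exact lie_self (ξ.sec u)
  refine ⟨mder EQ ℝ (f ∘ ξ.secE) u, ?_, ?_⟩
  · have h5 : HasMFDerivAt 𝓘(ℝ, EQ) 𝓘(ℝ, ℝ)
      (fun u' : Q => ξ.reebForm l u' (fun i => C.constFieldE (X i) u')) u
      (mder EQ ℝ (f ∘ ξ.secE) u) := h1 ▸ h2.hasMFDerivAt
    exact h5
  · change mder EQ ℝ (f ∘ ξ.secE) u (ξ.liftE u) = 0
    rw [h3, ContinuousLinearMap.comp_apply, h4, map_zero]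

theorem isContactFormOf_reebForm (hl : ∀ X : LieAlg EG G, l X = 0 ↔ X ∈ c.filt (-1))
    (hξ : ξ.IsTransverse) (hn : ξ.IsNormal) : ξ.IsContactFormOf (ξ.reebForm l) where
  mem := reebForm_mem hl hξ
  eq_zero_iff u v := by
    rw [reebForm_apply, mul_eq_zero, inv_eq_zero, or_iff_right (functional_secE_ne hl hξ u)]
    exact hl _
  insert_eq_one := reebForm_insert hl hξ
  insert_extD u v := by
    -- Cartan's formula: `i_ξ dα = -d(i_ξ α)`, and `i_ξ α = 1` is constant
    have h1 := (ξ.mem_invForms_succ.1 (reebForm_mem_invForms hl hξ hn)).2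
    have h2 : ξ.Xi (1 : G →* (ℝ →L[ℝ] ℝ)) 1 (ξ.reebForm l) = 0 := by
      funext u
      rw [Xi_apply, infRep_trivial]
      ext v
      rfl
    have h3 : extD (ξ.insert (ξ.reebForm l)) = 0 := by
      funext u
      have h4 : chartRep (ξ.insert (ξ.reebForm l)) u =
          fun _ => ContinuousAlternatingMap.constOfIsEmpty ℝ EQ (Fin 0) (1 : ℝ) := by
        funext y
        ext v
        refine Eq.trans ?_ (reebForm_insert hl hξ ((extChartAt 𝓘(ℝ, EQ) u).symm y))
        rfl
      rw [extD_eq_extDeriv, h4, extDeriv, fderiv_const_apply, alternatize_zero]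
      rfl
    rw [covD_trivial, covD_trivial, h2, h3, add_zero] at h1
    exact DFunLike.congr_fun (congrFun h1 u) ![v]

theorem existsUnique_isContactFormOf (hξ : ξ.IsTransverse) (hn : ξ.IsNormal) :
    ∃! α : Form EQ Q ℝ 1, ξ.IsContactFormOf α := by
  obtain ⟨l, hl⟩ := c.exists_functional
  let l' : EG →L[ℝ] ℝ := LinearMap.toContinuousLinearMap (show EG →ₗ[ℝ] ℝ from l)
  exact ⟨ξ.reebForm l', isContactFormOf_reebForm (l := l') hl hξ hn,
    fun _ h => isContactFormOf_unique h (isContactFormOf_reebForm (l := l') hl hξ hn)⟩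

end InfAut

end CartanGeometry

end ContactForm

end ParabolicContact

end

theorem theorem4p4
    {EG G EP P EQ Q EM M V : Type*}
    -- a semisimple Lie group `G` with a contact grading `c` of its Lie algebra
    [NormedAddCommGroup EG] [NormedSpace ℝ EG] [FiniteDimensional ℝ EG]
    [TopologicalSpace G] [ChartedSpace EG G] [Group G] [LieGroup 𝓘(ℝ, EG) ∞ G]
    [LieAlgebra.IsSemisimple ℝ (ParabolicContact.LieAlg EG G)]
    (c : ParabolicContact.ContactGrading (ParabolicContact.LieAlg EG G))
    -- a parabolic subgroup `P ⊆ G` for this grading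
    [NormedAddCommGroup EP] [NormedSpace ℝ EP] [FiniteDimensional ℝ EP]
    [TopologicalSpace P] [ChartedSpace EP P] [Group P] [LieGroup 𝓘(ℝ, EP) ∞ P]
    (S : ParabolicContact.ParabolicSubgroup c EP P)
    -- a parabolic contact structure `(Q → M, ω)` of type `(G, P)`
    [NormedAddCommGroup EQ] [NormedSpace ℝ EQ] [FiniteDimensional ℝ EQ]
    [TopologicalSpace Q] [ChartedSpace EQ Q] [IsManifold 𝓘(ℝ, EQ) ∞ Q]
    [NormedAddCommGroup EM] [NormedSpace ℝ EM] [FiniteDimensional ℝ EM]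
    [TopologicalSpace M] [ChartedSpace EM M] [IsManifold 𝓘(ℝ, EM) ∞ M]
    (C : ParabolicContact.CartanGeometry S EQ Q EM M) (hC : C.IsParabolicContact)
    -- a transverse normal infinitesimal automorphism `ξ`
    (ξ : C.InfAut) (hξt : ξ.IsTransverse) (hξn : ξ.IsNormal)
    -- a finite-dimensional representation of `G` whose twisted de Rham sequence is a complex
    [NormedAddCommGroup V] [NormedSpace ℝ V] [FiniteDimensional ℝ V]
    (ρ : G →* (V →L[ℝ] V)) (hρ : ContMDiff 𝓘(ℝ, EG) 𝓘(ℝ, V →L[ℝ] V) ∞ ρ)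
    (hflat : ∀ (k : ℕ), ∀ φ ∈ C.bundleForms ρ k, C.covD ρ (C.covD ρ φ) = 0) :
    -- `ξ` determines its contact form
    (∃! α : ParabolicContact.Form EQ Q ℝ 1, ξ.IsContactFormOf α) ∧
    ∀ α : ParabolicContact.Form EQ Q ℝ 1, ξ.IsContactFormOf α →
      -- `(A^*, d^∇)`, its subspace `(K^*, d^∇)` and `(C^*, d̂)` are complexes
      (∀ k, ∀ φ ∈ ξ.invForms ρ k, C.covD ρ φ ∈ ξ.invForms ρ (k + 1)) ∧
      (∀ k, ∀ φ ∈ ξ.kerForms ρ k, C.covD ρ φ ∈ ξ.kerForms ρ (k + 1)) ∧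
      (∀ k, ∀ φ ∈ ξ.horForms ρ k, ξ.hatD ρ α φ ∈ ξ.horForms ρ (k + 1)) ∧
      (∀ k, ξ.imXi ρ k ≤ ξ.horForms ρ k) ∧
      (∀ k, ∀ φ ∈ ξ.imXi ρ k, ξ.hatD ρ α φ ∈ ξ.imXi ρ (k + 1)) ∧
      (∀ k, ∀ φ ∈ ξ.horForms ρ k, ξ.hatD ρ α (ξ.hatD ρ α φ) ∈ ξ.imXi ρ (k + 1 + 1)) ∧
      -- well-defined maps in cohomology
      ∃ (j : ∀ k, ξ.cohK ρ k →ₗ[ℝ] ξ.cohA ρ k)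
        (π : ∀ k, ξ.cohA ρ (k + 1) →ₗ[ℝ] ξ.cohC ρ α k)
        (δ : ∀ k, ξ.cohC ρ α k →ₗ[ℝ] ξ.cohK ρ (k + 2)),
        -- `j` is induced by the inclusion
        (∀ (k : ℕ) (φ : ParabolicContact.Form EQ Q V k) (h : φ ∈ ξ.cocyclesK ρ k),
          ∃ h' : φ ∈ ξ.cocyclesA ρ k, j k (ξ.classK ρ φ h) = ξ.classA ρ φ h') ∧
        -- `π [τ] = [i_ξ τ]`
        (∀ (k : ℕ) (τ : ParabolicContact.Form EQ Q V (k + 1)) (h : τ ∈ ξ.cocyclesA ρ (k + 1)),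
          ∃ h' : ξ.insert τ ∈ ξ.cocyclesC ρ α k,
            π k (ξ.classA ρ τ h) = ξ.classC ρ α (ξ.insert τ) h') ∧
        -- `δ [φ] = [dα ∧ φ + d̂ ψ]` whenever `d̂ φ = Ξ_* ψ`
        (∀ (k : ℕ) (φ : ParabolicContact.Form EQ Q V k) (h : φ ∈ ξ.cocyclesC ρ α k),
          ∀ ψ ∈ ξ.horForms ρ (k + 1), ξ.hatD ρ α φ = ξ.Xi ρ (k + 1) ψ →
            ∃ h' : ParabolicContact.CartanGeometry.InfAut.wedgeD α φ + ξ.hatD ρ α ψ ∈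
                ξ.cocyclesK ρ (k + 2),
              δ k (ξ.classC ρ α φ h) = ξ.classK ρ _ h') ∧
        -- the long exact sequence
        Function.Bijective (j 0) ∧ Function.Injective (j 1) ∧
        (∀ k, Function.Exact (j (k + 1)) (π k)) ∧
        (∀ k, Function.Exact (π k) (δ k)) ∧
        (∀ k, Function.Exact (δ k) (j (k + 2))) := by
  have H : ξ.CartanCalculus ρ := ParabolicContact.CartanGeometry.InfAut.cartanCalculus hξn hρ hflat
  refine ⟨ParabolicContact.CartanGeometry.InfAut.existsUnique_isContactFormOf hξt hξn,
    fun α hα => ⟨fun k φ hφ => H.covD_mem hφ, fun k φ hφ => ?_, fun k φ hφ => H.hatD_mem_hor hα hφ,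
      fun k => ?_, fun k => ?_, fun k φ hφ => ?_, H.exists_longExactSequence hα⟩⟩
  · refine H.covD_mem_kerForms hφ.1.1 ?_
    rw [H.insert_covD hφ.1]
    exact hφ.2
  · rintro _ ⟨φ, hφ, rfl⟩
    exact H.Xi_mem_hor hφ
  · rintro _ ⟨φ, hφ, rfl⟩
    exact ⟨_, H.hatD_mem_hor hα hφ, (H.hatD_Xi hφ).symm⟩
  · exact ⟨_, neg_mem (H.wedgeD_mem_hor hα hφ), (H.hatD_hatD hα hφ).symm⟩
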